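/- Let $n\ge 2$, let $a_0,\dots,a_{n-1}\in\mathbb C$, let $a=[a_0,\dots,a_{n-1},1]^T$, and let $A$ be the companion matrix of $p(\lambda)=\lambda^n+a_{n-1}\lambda^{n-1}+\dots+a_0$ (ones on the subdiagonal, last column $-[a_0,\dots,a_{n-1}]^T$). Write $A=QR$ with $Q$ the cyclic shift ($Qe_j=e_{j+1}$ for $j<n$, $Qe_n=e_1$) and $R$ the identity with last column replaced by $-[a_1,\dots,a_{n-1},a_0]^T$. Put $\alpha=\|a\|$, $x=-\alpha^{-1}[a_1,\dots,a_{n-1},a_0]^T$, $y=e_n$, and $\underline z=-[a_1,\dots,a_{n-1},a_0,1]^T$. Norms are Euclidean norms of vectors and spectral norms of matrices. *Algorithm.* A core transformation in position $i$ is the identity except for a $2\times2$ block $\left[\begin{smallmatrix}c&-d\bar s\\ s&d\bar c\end{smallmatrix}\right]$ in rows and columns $i,i+1$, where $d=\pm1$ and (up to rounding) $|c|^2+|s|^2=1$. The companion QR algorithm stores descending sequences of cores $Q=Q_1\cdots Q_{n-1}$, $C=C_1\cdots C_n$, $B=B_1\cdots B_n$, the last two of order $n+1$; they represent $R$ as the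 leading $n\times n$ block of $C^*(B+e_1\underline w^T)$, where $\underline w^T=-\rho^{-1}e_{n+1}^TC^*B$ and $\rho=e_{n+1}^TC^*e_1$. Initially every $Q_i$ has block $\left[\begin{smallmatrix}0&1\\1&0\end{smallmatrix}\right]$, $C$ is computed so that $C\underline z=\alpha e_1$, $B_i=C_i$ for $i<n$, and $B_n$ is $C_n$ with its columns $n,n+1$ exchanged. Each iteration performs one single-shift core-chasing step on an active (undeflated) block of $Q$, with any nonzero starting vector in $\mathbb C^2$ (thus any shift strategy). The starting core $U_l$ is generated from that vector, its inverse is fused with the first core of the block, and $U_l$ is passed through $R$ from right to left; each ejected core $X_i$ is turned over with $Q_i,Q_{i+1}$ to give $U_{i+1}$, which is moved to the right by a similarity and passed through $R$ in turn; the last ejected core is fused with the last core of the block. Passing a core through $R$ consists of one turnover with $B_i,B_{i+1}$ and one with $C_i,C_{i+1}$. Every new core is rescaled to be unitary up to rounding. In each turnover $G_jG_{j+1}\to\hat G_j\hat G_{j+1}$ one of $\hat s_j,\hat s_{j+1}$ is computed as $s_js_{j+1}$ divided by the other (except when the column or row to be eliminated is already computed as zero). After each iteration every $s_i$ of the $Q$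 sequence whose computed modulus is at most $u$ is set to zero. All operations are performed in floating-point arithmetic with unit roundoff $u$ (each real $+,-,\times,/,\sqrt{\ }$ has relative error at most $u$; no overflow or underflow). After $N$ iterations let $\hat Q$ and $\hat R$ be the matrices represented by the stored cores and $\hat A=\hat Q\hat R$. Let $U$ be the product, in order, of all computed cores used in similarity transformations, and $X$ the product of all computed cores ejected from $R$, each core scaled to be exactly unitary. **Theorem.** There is an absolute constant $K>0$ such that for all $n\ge2$, $N\ge0$, $u$, every such arithmetic, all $a_0,\dots,a_{n-1}\in\mathbb C$ and every run of $N$ iterations, if $\varepsilon:=K\,n(n+N)\,u\le1$, then $U$ and $X$ are unitary and there are $\delta A,\delta Q,\delta R,\delta R_u,E\in\mathbb C^{n\times n}$ and $\delta x,\delta y\in\mathbb C^n$ with (a) $\hat A=U^*(A+\delta A)U$ and $\|\delta A\|\le\varepsilon\|A\|$; (b) $\hat Q=U^*(Q+\delta Q)X$ and $\|\delta Q\|\le\varepsilon$; (c) $\hat R=X^*(R+\delta R)U$ and $\|\delta R\|\le\varepsilon\|A\|$; (d) $\delta R=\delta R_u+\alpha(\delta x\,y^T+x\,\delta y^T)+E$,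 where $\|\delta R_u\|,\|\delta x\|,\|\delta y\|\le\varepsilon$ and $\|E\|\le\varepsilon^2\|A\|$. (With $N=O(n)$ iterations, $\varepsilon$ is $u$ times a quadratic polynomial in $n$.) -/

import Mathlib

open scoped ComplexConjugate Matrix Matrix.Norms.L2Operator

noncomputable section

namespace CompanionQR

/-! ### Floating-point arithmetic -/

/-- The standard model of floating-point arithmetic with unit roundoff `u` and no overflow or
underflow: the result of a real operation `+, -, *, /, √` is the exact result `x` rounded to `fl x`,
with relative error at most `u`. -/
structure FloatArith (u : ℝ) where
  fl : ℝ → ℝ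
  fl_err : ∀ x : ℝ, |fl x - x| ≤ u * |x|

namespace FloatArith

variable {u : ℝ} (F : FloatArith u)

/-- Computed complex sum. -/
def cadd (x y : ℂ) : ℂ := ⟨F.fl (x.re + y.re), F.fl (x.im + y.im)⟩

/-- Computed complex difference. -/
def csub (x y : ℂ) : ℂ := ⟨F.fl (x.re - y.re), F.fl (x.im - y.im)⟩

/-- Computed complex product (four real products, two real sums). -/
def cmul (x y : ℂ) : ℂ :=
  ⟨F.fl (F.fl (x.re * y.re) - F.fl (x.im * y.im)),
   F.fl (F.fl (x.re * y.im) + F.fl (x.im * y.re))⟩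

/-- Computed quotient of a complex number by a real number. -/
def cdiv (x : ℂ) (r : ℝ) : ℂ := ⟨F.fl (x.re / r), F.fl (x.im / r)⟩

/-- Computed Euclidean norm of the vector `(x, y) ∈ ℂ²`. -/
def norm2 (x y : ℂ) : ℝ :=
  F.fl (Real.sqrt (F.fl (F.fl (F.fl (x.re * x.re) + F.fl (x.im * x.im))
    + F.fl (F.fl (y.re * y.re) + F.fl (y.im * y.im)))))

end FloatArith

/-! ### Core transformations -/

/-- A stored core transformation with active part `[[c, -d * conj s], [s, d * conj c]]`.
The determinant `d = ±1` of the exact core tells rotators (`d = 1`) from reflectors (`d = -1`).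
The numbers `c`, `s` are arbitrary, because a computed core is unitary only up to rounding. -/
structure Core where
  c : ℂ
  s : ℂ
  d : ℤˣ

namespace Core

/-- The sign `d` as a complex number. Multiplication by it is a sign change, hence exact. -/
def sgn (g : Core) : ℂ := ((g.d : ℤ) : ℂ)

/-- The `m × m` matrix that is the identity except for the active part of `g` in rows and columns
`i`, `i + 1` (numbered from `0`). -/
def toMatrix (m i : ℕ) (g : Core) : Matrix (Fin m) (Fin m) ℂ :=
  Matrix.of fun j k =>
    if (j : ℕ) = i ∧ (k : ℕ) = i then g.c
    else if (j : ℕ) = i ∧ (k : ℕ) = i + 1 then -(g.sgn * conj g.s)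
    else if (j : ℕ) = i + 1 ∧ (k : ℕ) = i then g.s
    else if (j : ℕ) = i + 1 ∧ (k : ℕ) = i + 1 then g.sgn * conj g.c
    else if j = k then 1 else 0

/-- The inverse (conjugate transpose) of a rotator. -/
def inv (g : Core) : Core := ⟨conj g.c, -g.s, g.d⟩

/-- Transposition of the active part about its antidiagonal. -/
def flip (g : Core) : Core := ⟨g.sgn * conj g.c, g.s, g.d⟩

/-- The core scaled so that it is exactly unitary. -/
def unitize (g : Core) : Core :=
  ⟨g.c / (Real.sqrt (‖g.c‖ ^ 2 + ‖g.s‖ ^ 2) : ℝ), g.s / (Real.sqrt (‖g.c‖ ^ 2 + ‖g.s‖ ^ 2) : ℝ), g.d⟩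

end Core

/-- The product `G 0 * G 1 * ⋯ * G (k - 1)` of a descending sequence of cores, of size `m × m`. -/
def descProd (m k : ℕ) (G : ℕ → Core) : Matrix (Fin m) (Fin m) ℂ :=
  ((List.range k).map fun i => (G i).toMatrix m i).prod

section Operations

variable {u : ℝ} (F : FloatArith u)

/-- The computed core with first column `(x, y)` rescaled to norm one, and sign `d`. -/
def mkCore (x y : ℂ) (d : ℤˣ) : Core :=
  ⟨F.cdiv x (F.norm2 x y), F.cdiv y (F.norm2 x y), d⟩

/-- Computed fusion: the product of two cores in the same position. -/
def fuse (G H : Core) : Core :=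
  mkCore F
    (F.csub (F.cmul G.c H.c) (G.sgn * F.cmul (conj G.s) H.s))
    (F.cadd (F.cmul G.s H.c) (G.sgn * F.cmul (conj G.c) H.s))
    (G.d * H.d)

/-- Computed turnover, right to left. From cores `G₁`, `G₂` in positions `j`, `j + 1` and a rotator
`H` in position `j` it produces `(M, G₁', G₂')` with `G₁ * G₂ * H = M * G₁' * G₂'`, where the
rotator `M` is in position `j + 1`. The vector `(w₁, w₂, w₃)` is the first column of the product; it
determines `M` and `G₁'`; then `G₂'.s` is computed as `G₁.s * G₂.s / G₁'.s`. Every core produced is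
rescaled. If `w₂ = w₃ = 0`, so that the first column needs no elimination, `M` is diagonal. -/
def turnover (G₁ G₂ H : Core) : Core × Core × Core :=
  let w₁ := F.csub (F.cmul G₁.c H.c) (G₁.sgn * F.cmul (F.cmul (conj G₁.s) G₂.c) H.s)
  let w₂ := F.cadd (F.cmul G₁.s H.c) (G₁.sgn * F.cmul (F.cmul (conj G₁.c) G₂.c) H.s)
  let w₃ := F.cmul G₂.s H.s
  let r := F.norm2 w₂ w₃
  if r = 0 then
    let g : ℂ := if H.s = 0 then H.c else 1
    (mkCore F g 0 1, mkCore F w₁ 0 G₁.d, mkCore F (F.cmul (conj g) G₂.c) G₂.s G₂.d)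
  else
    let M := mkCore F w₂ w₃ 1
    let G₁' := mkCore F w₁ (r : ℂ) G₁.d
    let G₂' := mkCore F
      (F.cadd (F.cmul (conj M.c) G₂.c) (G₁.sgn * F.cmul (F.cmul (conj M.s) G₁.c) G₂.s))
      (F.cdiv (F.cmul G₁.s G₂.s) G₁'.s.re) G₂.d
    (M, G₁', G₂')

/-- Computed turnover, left to right. From a rotator `K` in position `j + 1` and cores `G₁`, `G₂` in
positions `j`, `j + 1` it produces `(G₁', G₂', L)` with `K * G₁ * G₂ = G₁' * G₂' * L`, where the
rotator `L` is in position `j`. It is the mirror image of `turnover` under transposition about the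
antidiagonal, which reverses products and exchanges the positions `j` and `j + 1`; here
`G₁'.s` is computed as `G₁.s * G₂.s / G₂'.s`. -/
def turnoverLR (K G₁ G₂ : Core) : Core × Core × Core :=
  let t := turnover F G₂.flip G₁.flip K.flip
  (t.2.2.flip, t.2.1.flip, t.1.flip)

end Operations

/-! ### The problem data -/

/-- The companion matrix of `λ ^ n + a (n - 1) * λ ^ (n - 1) + ⋯ + a 0`. -/
def companion {n : ℕ} (a : Fin n → ℂ) : Matrix (Fin n) (Fin n) ℂ :=
  Matrix.of fun i j =>
    if (j : ℕ) + 1 = n then -a i else if (i : ℕ) = (j : ℕ) + 1 then 1 else 0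

/-- The cyclic shift matrix, the unitary factor of the companion matrix. -/
def qFactor (n : ℕ) : Matrix (Fin n) (Fin n) ℂ :=
  Matrix.of fun i j =>
    if (i : ℕ) = (j : ℕ) + 1 then 1 else if (i : ℕ) = 0 ∧ (j : ℕ) + 1 = n then 1 else 0

/-- The vector `z = -(a 1, …, a (n - 1), a 0, 1)` of length `n + 1`, as a function on `ℕ` that is
used at `0, …, n` only. -/
def zVec {n : ℕ} (a : Fin n → ℂ) (k : ℕ) : ℂ :=
  if h : k + 1 < n then -a ⟨k + 1, h⟩
  else if h : k + 1 = n then -a ⟨0, by omega⟩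
  else -1

/-- The upper triangular factor of the companion matrix: the identity with its last column replaced
by the first `n` entries of `z`. -/
def rFactor {n : ℕ} (a : Fin n → ℂ) : Matrix (Fin n) (Fin n) ℂ :=
  Matrix.of fun i j =>
    if (j : ℕ) + 1 = n then zVec a i else if i = j then 1 else 0

/-- The norm `α = ‖z‖` of the coefficient vector `(a 0, …, a (n - 1), 1)`. -/
def alpha {n : ℕ} (a : Fin n → ℂ) : ℝ := Real.sqrt (∑ i, ‖a i‖ ^ 2 + 1)

/-- The vector `x`: the first `n` entries of `z / α`. -/
def xVec {n : ℕ} (a : Fin n → ℂ) : EuclideanSpace ℂ (Fin n) :=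
  WithLp.toLp 2 fun i => zVec a i / (alpha a : ℂ)

/-- The vector `y`: the last standard basis vector. -/
def yVec (n : ℕ) : EuclideanSpace ℂ (Fin n) :=
  WithLp.toLp 2 fun i => if (i : ℕ) + 1 = n then 1 else 0

/-! ### The algorithm -/

/-- What the algorithm stores: the cores `Q 0, …, Q (n - 2)` of the unitary factor, and the cores
`B 0, …, B (n - 1)`, `C 0, …, C (n - 1)` of the triangular factor `R`. The exact matrices `U` and
`X`, not stored by the algorithm, record the product of the cores used in similarity transformations
and the product of the cores ejected from `R` and absorbed by `Q`. -/
structure State (n : ℕ) where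
  Q : ℕ → Core
  B : ℕ → Core
  C : ℕ → Core
  U : Matrix (Fin n) (Fin n) ℂ
  X : Matrix (Fin n) (Fin n) ℂ

namespace State

variable {n : ℕ} (S : State n)

/-- The unitary factor represented by the state. -/
def Qhat : Matrix (Fin n) (Fin n) ℂ := descProd n (n - 1) S.Q

/-- The product of the stored `B` cores. -/
def Bhat : Matrix (Fin (n + 1)) (Fin (n + 1)) ℂ := descProd (n + 1) n S.B

/-- The product of the stored `C` cores. -/
def Chat : Matrix (Fin (n + 1)) (Fin (n + 1)) ℂ := descProd (n + 1) n S.C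

/-- The unitary part `C* B` of the extended triangular factor. -/
def Ruhat : Matrix (Fin (n + 1)) (Fin (n + 1)) ℂ := S.Chatᴴ * S.Bhat

/-- The number `ρ`, the last entry in the first column of `C*`. -/
def rhohat : ℂ := S.Chatᴴ (Fin.last n) 0

/-- The row vector `α yᵀ`, which is not stored but recovered from the cores: `-ρ⁻¹` times the last
row of `C* B`. -/
def alphaYhat : Fin (n + 1) → ℂ := fun j => -(S.rhohat)⁻¹ * S.Ruhat (Fin.last n) j

/-- The extended triangular factor `C* (B + e₁ (α yᵀ))`. -/
def extRhat : Matrix (Fin (n + 1)) (Fin (n + 1)) ℂ :=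
  S.Chatᴴ * (S.Bhat + Matrix.vecMulVec (Pi.single 0 1) S.alphaYhat)

/-- The triangular factor represented by the state: the leading `n × n` block. -/
def Rhat : Matrix (Fin n) (Fin n) ℂ := S.extRhat.submatrix Fin.castSucc Fin.castSucc

/-- The matrix represented by the state. -/
def Ahat : Matrix (Fin n) (Fin n) ℂ := S.Qhat * S.Rhat

end State

section Algorithm

variable {u : ℝ} (F : FloatArith u) {n : ℕ}

/-- The computed norms `‖(z (n - j), …, z n)‖`, with the sign of `z n = -1` kept for `j = 0`. -/
def tailNorm (a : Fin n → ℂ) : ℕ → ℝ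
  | 0 => -1
  | j + 1 => F.norm2 (zVec a (n - 1 - j)) (tailNorm a j : ℂ)

/-- The computed cores with `C 0 * ⋯ * C (n - 1) * z = α e₁`: the core `C k` maps the entries
`(z k, tailNorm (n - 1 - k))` in positions `k`, `k + 1` to `(tailNorm (n - k), 0)`. -/
def initC (a : Fin n → ℂ) (k : ℕ) : Core :=
  ⟨F.cdiv (conj (zVec a k)) (tailNorm F a (n - k)),
   ((-F.fl (tailNorm F a (n - 1 - k) / tailNorm F a (n - k)) : ℝ) : ℂ), 1⟩

/-- The initial cores of `B`: the same as those of `C`, except that the two columns of the active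
part of the last one are exchanged. -/
def initB (a : Fin n → ℂ) (k : ℕ) : Core :=
  if k + 1 = n then ⟨-conj (initC F a k).s, conj (initC F a k).c, -1⟩ else initC F a k

/-- The initial state. All cores of `Q` have active part `[[0, 1], [1, 0]]`. -/
def initState (a : Fin n → ℂ) : State n where
  Q := fun _ => ⟨0, 1, -1⟩
  B := initB F a
  C := initC F a
  U := 1
  X := 1

/-- Pass the core `G` in position `i` through `R` from right to left: a turnover with
`B i`, `B (i + 1)` ejects `M` in position `i + 1`, and a turnover with `C i`, `C (i + 1)` takes
`C* M` to `L⁻¹ C*`. The result is the new state and the ejected core `L⁻¹` in position `i`. Both `G`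
and the ejected core are recorded in `U` and `X`. -/
def passR (i : ℕ) (G : Core) (S : State n) : State n × Core :=
  let b := turnover F (S.B i) (S.B (i + 1)) G
  let t := turnoverLR F b.1.inv (S.C i) (S.C (i + 1))
  let Y := t.2.2.inv
  ({ Q := S.Q
     B := Function.update (Function.update S.B i b.2.1) (i + 1) b.2.2
     C := Function.update (Function.update S.C i t.1) (i + 1) t.2.1
     U := S.U * G.unitize.toMatrix n i
     X := S.X * Y.unitize.toMatrix n i }, Y)

/-- Chase the misfit `Y`, in position `i` between `Q` and `R`, through `k` further positions, and
fuse it with `Q (i + k)` at the bottom. The deflated core `Q (i + k + 1)`, if there is one, is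
diagonal; the misfit is moved past it before the fusion. -/
def chase : ℕ → ℕ → Core → State n → State n
  | 0, i, Y, S =>
    let Y' : Core := if i + 2 < n then ⟨Y.c, F.cmul (S.Q (i + 1)).c Y.s, Y.d⟩ else Y
    { S with Q := Function.update S.Q i (fuse F (S.Q i) Y') }
  | k + 1, i, Y, S =>
    let t := turnover F (S.Q i) (S.Q (i + 1)) Y
    let p := passR F (i + 1) t.1
      { S with Q := Function.update (Function.update S.Q i t.2.1) (i + 1) t.2.2 }
    chase k (i + 1) p.2 p.1

/-- One single-shift iteration on the active block `Q l, …, Q m`. The starting core `G` has first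
column proportional to `(q₁, q₂)`; its inverse is fused with `Q l`, after moving past the diagonal
core `Q (l - 1)` if there is one, and `G` is passed through `R` and chased to the bottom. -/
def sweep (l m : ℕ) (q₁ q₂ : ℂ) (S : State n) : State n :=
  let G := mkCore F q₁ q₂ 1
  let G' : Core :=
    if l = 0 then G
    else ⟨G.c, F.cmul ((S.Q (l - 1)).sgn * conj (S.Q (l - 1)).c) G.s, G.d⟩
  let p := passR F l G { S with Q := Function.update S.Q l (fuse F G'.inv (S.Q l)) }
  chase F (m - l) l p.2 p.1

/-- Deflation: every `s` in the `Q` sequence of computed modulus at most `u` is set to zero. -/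
def deflate (S : State n) : State n :=
  { S with Q := fun i =>
      if F.norm2 (S.Q i).s 0 ≤ u then ⟨(S.Q i).c, 0, (S.Q i).d⟩ else S.Q i }

/-- `Q l, …, Q m` is an active block: its `s` are nonzero, and it is bounded on either side by a
deflated core or by the end of the sequence. -/
def ActiveBlock (S : State n) (l m : ℕ) : Prop :=
  l ≤ m ∧ m + 1 < n ∧ (∀ i, l ≤ i → i ≤ m → (S.Q i).s ≠ 0) ∧
    (l ≠ 0 → (S.Q (l - 1)).s = 0) ∧ (m + 2 < n → (S.Q (m + 1)).s = 0)

/-- `Run F a N S`: in the arithmetic `F`, the companion QR algorithm applied to the coefficients `a`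
can be in state `S` after `N` iterations. Every iteration works on some active block, with some
nonzero vector `(q₁, q₂)` that determines the starting core. In the algorithm this vector is the
computed first column of `A - μ I` for a shift `μ`; leaving it arbitrary covers every shift
strategy, and every way of evaluating that column in floating-point arithmetic. -/
inductive Run (a : Fin n → ℂ) : ℕ → State n → Prop
  | init : Run a 0 (initState F a)
  | step {N : ℕ} {S : State n} (h : Run a N S) (l m : ℕ) (q₁ q₂ : ℂ)
      (hact : ActiveBlock S l m) (hq : q₁ ≠ 0 ∨ q₂ ≠ 0) :
      Run a (N + 1) (deflate F (sweep F l m q₁ q₂ S))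

end Algorithm

end CompanionQR

end

open CompanionQR

/-!
The algorithm applies `O(n)` elementary operations per iteration to sequences of cores, and the
theorem holds because each of them is backward stable with an error `O(u)` that does not depend on
`n`. All matrices involved are products of nearly unitary cores, so these errors are not
amplified: they add up, to `O(nNu)` for the iterations and `O(n²u)` for the initial factorization.

*The turnover.* Its exact version factors a product of three unitary cores again, in the other
order. Whatever unitary `M` and `G₁'` are computed, the residual `(M G₁')⁻¹ G₁ G₂ H` is a unitary
matrix of order three with known determinant; if its first column is close to `e₁` it is, by
`norm_sub_core_le_of_unitary`, close to the core read off from its last row. Thus it is enough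
that the first column and the last row come out right (`norm_turnover_sub_le`). The first column
is computed directly (`turnover_column`). The last row involves the quotient `s₁ s₂ / N`, where
`N` is the computed norm of the two entries that are eliminated. If `N` is tiny it may have no
correct digit relative to the exact norm, but `s₁` and `s₂` are linked to these entries: the error
of the entries is small relative to a quantity whose product with `|s₂|` is `O(N)`, and so the
quotient is still accurate relative to one (`norm_hyp_mul_botS_sub_le`). By construction the
product of the two new `s` agrees with `s₁ s₂` to high *relative* accuracy. Both facts together
are `turnover_spec`; the turnover in the other direction is its mirror image (`turnoverLR_spec`).

*One iteration.* Since a core in position `i` commutes with all cores but its neighbours, an error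
of a local change in a descending product is an error of the same size in the whole product
(`norm_descProd_mul_sub_le`). A pass through `R` therefore turns `B` into `Mᴴ B G` and `C` into
`Mᴴ C Y`, up to `O(u)`, with the same `M`, in a position other than the first, so that `C* B`
becomes `Y* C* B G` and `M e₁ = e₁`. The number `ρ` is, up to sign, the product of all `s` in `C`
(`State.rhohat_eq`), and keeps a small relative error although it may be tiny (`passR_tracks`).
The chase, the fusions and the deflation are treated in `chase_tracks`, `norm_top_fusion_le`,
`norm_bottom_fusion_le` and `deflate_tracks`, and `Run.tracks` sums up.

*The triangular factor.* After `N` iterations the stored `B` and `C` are close to `Vᴴ B₀ U` and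
`Vᴴ C₀ X`, where `B₀` and `C₀` are the exact initial matrices and `V` is a unitary matrix that
fixes `e₁`. In `C* (B + e₁ wᵀ)` the matrix `V` cancels (`State.mul_Rhat_mul`). The rank-one part
is `α` times the product of the first column of `C*`, close to `x`, and the last row of `C* B`
divided by `-α ρ`, close to `yᵀ`. Here the relative accuracy of `ρ` is essential. Multiplying out
gives the structured perturbation (`exists_structured_perturbation`). All norms are finally
compared by `‖R‖ = ‖A‖` and `α ≤ 2 ‖A‖` (`norm_companion_ge`), and the perturbation of `A` is that
of the product `Q R`.
-/

namespace CompanionQR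

/-! ### Spectral norms -/

theorem norm_single_le {m : ℕ} (i j : Fin m) (c : ℂ) :
    ‖(Matrix.single i j c : Matrix (Fin m) (Fin m) ℂ)‖ ≤ ‖c‖ := by
  have h : (Matrix.single i j c : Matrix (Fin m) (Fin m) ℂ)ᴴ * Matrix.single i j c
      = Matrix.diagonal (Pi.single j (conj c * c)) := by
    rw [Matrix.conjTranspose_single, Matrix.single_mul_single_same, Matrix.diagonal_single]
    rfl
  have h1 := Matrix.l2_opNorm_conjTranspose_mul_self (Matrix.single i j c : Matrix (Fin m) (Fin m) ℂ)
  rw [h, Matrix.l2_opNorm_diagonal, Pi.norm_single] at h1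
  rw [norm_mul, RCLike.norm_conj] at h1
  exact le_of_eq (by
    have := mul_self_inj (norm_nonneg c) (norm_nonneg (Matrix.single i j c : Matrix (Fin m) (Fin m) ℂ))
    exact (this.mp h1).symm)

/-- The spectral norm is at most the sum of the moduli of the entries. -/
theorem norm_le_sum_entries {m : ℕ} (M : Matrix (Fin m) (Fin m) ℂ) :
    ‖M‖ ≤ ∑ i, ∑ j, ‖M i j‖ := by
  conv_lhs => rw [Matrix.matrix_eq_sum_single M]
  refine (norm_sum_le _ _).trans (Finset.sum_le_sum fun i _ => ?_)
  exact (norm_sum_le _ _).trans (Finset.sum_le_sum fun j _ => norm_single_le i j _)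

theorem norm_le_of_conjTranspose_mul_self {m w : ℕ} {P : Matrix (Fin m) (Fin w) ℂ}
    (h : Pᴴ * P = 1) : ‖P‖ ≤ 1 := by
  have h1 := Matrix.l2_opNorm_conjTranspose_mul_self P
  have h2 : ‖(1 : Matrix (Fin w) (Fin w) ℂ)‖ ≤ 1 := by
    rw [← Matrix.diagonal_one, Matrix.l2_opNorm_diagonal]
    exact (pi_norm_le_iff_of_nonneg zero_le_one).2 fun i => by simp
  rw [h] at h1
  nlinarith [norm_nonneg P]

theorem norm_le_one_of_unitary {m : ℕ} {V : Matrix (Fin m) (Fin m) ℂ}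
    (h : V ∈ Matrix.unitaryGroup (Fin m) ℂ) : ‖V‖ ≤ 1 :=
  norm_le_of_conjTranspose_mul_self (Matrix.mem_unitaryGroup_iff'.1 h)

theorem conjTranspose_mem_unitaryGroup {m : ℕ} {V : Matrix (Fin m) (Fin m) ℂ}
    (h : V ∈ Matrix.unitaryGroup (Fin m) ℂ) : Vᴴ ∈ Matrix.unitaryGroup (Fin m) ℂ := by
  rw [← Matrix.star_eq_conjTranspose]
  exact Unitary.star_mem h

theorem conjTranspose_mul_self_of_unitary {m : ℕ} {V : Matrix (Fin m) (Fin m) ℂ}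
    (h : V ∈ Matrix.unitaryGroup (Fin m) ℂ) : Vᴴ * V = 1 := Matrix.mem_unitaryGroup_iff'.1 h

theorem mul_conjTranspose_self_of_unitary {m : ℕ} {V : Matrix (Fin m) (Fin m) ℂ}
    (h : V ∈ Matrix.unitaryGroup (Fin m) ℂ) : V * Vᴴ = 1 := Matrix.mem_unitaryGroup_iff.1 h

theorem norm_unitary_mul {m : ℕ} {V : Matrix (Fin m) (Fin m) ℂ}
    (h : V ∈ Matrix.unitaryGroup (Fin m) ℂ) (M : Matrix (Fin m) (Fin m) ℂ) : ‖V * M‖ = ‖M‖ :=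
  CStarRing.norm_mem_unitary_mul M h

theorem norm_mul_unitary {m : ℕ} {V : Matrix (Fin m) (Fin m) ℂ}
    (h : V ∈ Matrix.unitaryGroup (Fin m) ℂ) (M : Matrix (Fin m) (Fin m) ℂ) : ‖M * V‖ = ‖M‖ :=
  CStarRing.norm_mul_mem_unitary M h

theorem norm_vecMulVec_le {m : ℕ} (x y : EuclideanSpace ℂ (Fin m)) :
    ‖Matrix.vecMulVec x.ofLp y.ofLp‖ ≤ ‖x‖ * ‖y‖ := by
  rw [Matrix.l2_opNorm_def]
  refine ContinuousLinearMap.opNorm_le_bound _ (by positivity) fun v => ?_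
  have h : ((Matrix.toEuclideanLin (𝕜 := ℂ) (m := Fin m) (n := Fin m)).trans
      LinearMap.toContinuousLinearMap) (Matrix.vecMulVec x.ofLp y.ofLp) v
      = (y.ofLp ⬝ᵥ v.ofLp) • x := by
    ext i
    simp [Matrix.toLpLin_apply, Matrix.vecMulVec_mulVec]
  rw [h, norm_smul]
  have h2 : ‖y.ofLp ⬝ᵥ v.ofLp‖ ≤ ‖y‖ * ‖v‖ := by
    have h3 := norm_inner_le_norm (𝕜 := ℂ) (WithLp.toLp 2 (star y.ofLp) : EuclideanSpace ℂ (Fin m)) v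
    have h4 : ‖(WithLp.toLp 2 (star y.ofLp) : EuclideanSpace ℂ (Fin m))‖ = ‖y‖ := by
      simp [EuclideanSpace.norm_eq]
    rw [h4, EuclideanSpace.inner_eq_star_dotProduct] at h3
    simpa [dotProduct_comm] using h3
  calc _ ≤ (‖y‖ * ‖v‖) * ‖x‖ := by gcongr
    _ = _ := by ring

/-! ### Embedding small matrices -/

/-- The isometric inclusion of `ℂ ^ w` into `ℂ ^ m` as the coordinates `i, …, i + w - 1`. -/
def window (m i w : ℕ) : Matrix (Fin m) (Fin w) ℂ :=
  Matrix.of fun j a => if (j : ℕ) = i + a then 1 else 0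

/-- The `m × m` matrix that is the identity except for the block `M` in the rows and columns
`i, …, i + w - 1`. -/
def emb (m i : ℕ) {w : ℕ} (M : Matrix (Fin w) (Fin w) ℂ) : Matrix (Fin m) (Fin m) ℂ :=
  1 + window m i w * (M - 1) * (window m i w)ᴴ

theorem window_conjTranspose_mul {m i w : ℕ} (h : i + w ≤ m) :
    (window m i w)ᴴ * window m i w = 1 := by
  ext a b
  rw [Matrix.mul_apply, Finset.sum_eq_single (⟨i + a, by omega⟩ : Fin m)]
  · simp only [window, Matrix.conjTranspose_apply, Matrix.of_apply, Matrix.one_apply]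
    by_cases hab : a = b
    · simp [hab]
    · have : ¬ (i + (a : ℕ) = i + b) := by
        intro h'; exact hab (Fin.ext (by omega))
      simp [hab, Fin.val_inj]
  · intro j _ hj
    have : (j : ℕ) ≠ i + a := fun h' => hj (Fin.ext h')
    simp [window, this]
  · simp

theorem window_conjTranspose_mul_of_le {m i w j w' : ℕ} (h : i + w ≤ j) :
    (window m i w)ᴴ * window m j w' = 0 := by
  ext a b
  rw [Matrix.mul_apply]
  refine Finset.sum_eq_zero fun k _ => ?_
  simp only [window, Matrix.conjTranspose_apply, Matrix.of_apply]
  have := a.isLt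
  split_ifs <;> first | (exfalso; omega) | simp

theorem norm_window_le {m i w : ℕ} (h : i + w ≤ m) : ‖window m i w‖ ≤ 1 :=
  norm_le_of_conjTranspose_mul_self (window_conjTranspose_mul h)

theorem norm_window_mul_mul_le {m i w : ℕ} (h : i + w ≤ m) (M : Matrix (Fin w) (Fin w) ℂ) :
    ‖window m i w * M * (window m i w)ᴴ‖ ≤ ‖M‖ := by
  have h1 := norm_window_le h
  have h2 : ‖(window m i w)ᴴ‖ ≤ 1 := by rwa [Matrix.l2_opNorm_conjTranspose]
  calc _ ≤ ‖window m i w * M‖ * ‖(window m i w)ᴴ‖ := Matrix.l2_opNorm_mul _ _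
    _ ≤ (‖window m i w‖ * ‖M‖) * ‖(window m i w)ᴴ‖ := by gcongr; exact Matrix.l2_opNorm_mul _ _
    _ ≤ (1 * ‖M‖) * 1 := by gcongr
    _ = _ := by ring

theorem norm_conjTranspose_window_mul_mul_le {m i w : ℕ} (h : i + w ≤ m)
    (M : Matrix (Fin m) (Fin m) ℂ) :
    ‖(window m i w)ᴴ * M * window m i w‖ ≤ ‖M‖ := by
  have h1 := norm_window_le h
  have h2 : ‖(window m i w)ᴴ‖ ≤ 1 := by rwa [Matrix.l2_opNorm_conjTranspose]
  calc _ ≤ ‖(window m i w)ᴴ * M‖ * ‖window m i w‖ := Matrix.l2_opNorm_mul _ _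
    _ ≤ (‖(window m i w)ᴴ‖ * ‖M‖) * ‖window m i w‖ := by gcongr; exact Matrix.l2_opNorm_mul _ _
    _ ≤ (1 * ‖M‖) * 1 := by gcongr
    _ = _ := by ring

theorem emb_one (m i w : ℕ) : emb m i (1 : Matrix (Fin w) (Fin w) ℂ) = 1 := by simp [emb]

theorem emb_mul {m i w : ℕ} (h : i + w ≤ m) (M N : Matrix (Fin w) (Fin w) ℂ) :
    emb m i (M * N) = emb m i M * emb m i N := by
  have hP := window_conjTranspose_mul h
  unfold emb
  set P := window m i w
  have h1 : P * (M - 1) * Pᴴ * (P * (N - 1) * Pᴴ) = P * ((M - 1) * (N - 1)) * Pᴴ := by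
    calc _ = P * (M - 1) * (Pᴴ * P) * (N - 1) * Pᴴ := by simp only [Matrix.mul_assoc]
      _ = _ := by rw [hP]; simp only [Matrix.mul_assoc, Matrix.one_mul]
  rw [Matrix.add_mul, Matrix.mul_add, Matrix.mul_add, h1, Matrix.one_mul, Matrix.one_mul,
    Matrix.mul_one, add_assoc, ← Matrix.add_mul, ← Matrix.mul_add, ← Matrix.add_mul,
    ← Matrix.mul_add]
  congr 4
  noncomm_ring

theorem emb_conjTranspose {m i w : ℕ} (M : Matrix (Fin w) (Fin w) ℂ) :
    emb m i Mᴴ = (emb m i M)ᴴ := by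
  simp [emb, Matrix.conjTranspose_mul, Matrix.mul_assoc]

theorem emb_unitary {m i w : ℕ} (h : i + w ≤ m) {M : Matrix (Fin w) (Fin w) ℂ}
    (hM : M ∈ Matrix.unitaryGroup (Fin w) ℂ) : emb m i M ∈ Matrix.unitaryGroup (Fin m) ℂ := by
  rw [Matrix.mem_unitaryGroup_iff, Matrix.star_eq_conjTranspose, ← emb_conjTranspose, ← emb_mul h,
    mul_conjTranspose_self_of_unitary hM, emb_one]

theorem norm_emb_sub_le {m i w : ℕ} (h : i + w ≤ m) (M N : Matrix (Fin w) (Fin w) ℂ) :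
    ‖emb m i M - emb m i N‖ ≤ ‖M - N‖ := by
  have : emb m i M - emb m i N = window m i w * (M - N) * (window m i w)ᴴ := by
    unfold emb
    rw [add_sub_add_left_eq_sub, ← Matrix.sub_mul, ← Matrix.mul_sub, sub_sub_sub_cancel_right]
  rw [this]
  exact norm_window_mul_mul_le h _

theorem emb_commute {m i w j w' : ℕ} (h : i + w ≤ j) (M : Matrix (Fin w) (Fin w) ℂ)
    (N : Matrix (Fin w') (Fin w') ℂ) : Commute (emb m i M) (emb m j N) := by
  have h1 := window_conjTranspose_mul_of_le (m := m) (w' := w') h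
  have h2 : (window m j w')ᴴ * window m i w = 0 := by
    have := congrArg Matrix.conjTranspose h1
    simpa [Matrix.conjTranspose_mul] using this
  unfold emb
  set P := window m i w
  set P' := window m j w'
  have h3 : P * (M - 1) * Pᴴ * (P' * (N - 1) * P'ᴴ) = 0 := by
    calc _ = P * (M - 1) * (Pᴴ * P') * (N - 1) * P'ᴴ := by simp only [Matrix.mul_assoc]
      _ = _ := by rw [h1]; simp
  have h4 : P' * (N - 1) * P'ᴴ * (P * (M - 1) * Pᴴ) = 0 := by
    calc _ = P' * (N - 1) * (P'ᴴ * P) * (M - 1) * Pᴴ := by simp only [Matrix.mul_assoc]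
      _ = _ := by rw [h2]; simp
  have : Commute (P * (M - 1) * Pᴴ) (P' * (N - 1) * P'ᴴ) := by
    rw [Commute, SemiconjBy, h3, h4]
  exact ((Commute.one_left _).add_left ((Commute.one_right _).add_right this))

theorem emb_apply_mem {m i w : ℕ} (M : Matrix (Fin w) (Fin w) ℂ) {j k : Fin m} {a b : Fin w}
    (hj : (j : ℕ) = i + a) (hk : (k : ℕ) = i + b) : emb m i M j k = M a b := by
  have hw : ∀ (j : Fin m) (a c : Fin w), (j : ℕ) = i + a →
      window m i w j c = if c = a then 1 else 0 := by
    intro j a c h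
    have : ((j : ℕ) = i + c) = (c = a) := by
      rw [h, Fin.ext_iff]; exact propext ⟨fun h => by omega, fun h => by omega⟩
    simp only [window, Matrix.of_apply, this]
  have h1 : (1 : Matrix (Fin m) (Fin m) ℂ) j k = (1 : Matrix (Fin w) (Fin w) ℂ) a b := by
    have : (j = k) = (a = b) := by
      rw [Fin.ext_iff, Fin.ext_iff, hj, hk]; exact propext ⟨fun h => by omega, fun h => by omega⟩
    simp only [Matrix.one_apply, this]
  simp [emb, Matrix.mul_apply, hw j a _ hj, hw k b _ hk, h1]

theorem emb_apply_of_left {m i w : ℕ} (M : Matrix (Fin w) (Fin w) ℂ) {j k : Fin m}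
    (hj : (j : ℕ) < i ∨ i + w ≤ j) : emb m i M j k = if j = k then 1 else 0 := by
  have hw : ∀ c, window m i w j c = 0 := by
    intro c
    simp only [window, Matrix.of_apply, ite_eq_right_iff]
    omega
  simp [emb, Matrix.mul_apply, hw, Matrix.one_apply]

theorem emb_apply_of_right {m i w : ℕ} (M : Matrix (Fin w) (Fin w) ℂ) {j k : Fin m}
    (hj : (k : ℕ) < i ∨ i + w ≤ k) : emb m i M j k = if j = k then 1 else 0 := by
  have hw : ∀ c, window m i w k c = 0 := by
    intro c
    simp only [window, Matrix.of_apply, ite_eq_right_iff]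
    omega
  simp [emb, Matrix.mul_apply, hw, Matrix.one_apply]

theorem Core.toMatrix_eq_emb (g : Core) {m i w p : ℕ} (hp : p + 2 ≤ w) :
    g.toMatrix m (i + p) = emb m i (g.toMatrix w p) := by
  ext j k
  by_cases hj : (j : ℕ) < i ∨ i + w ≤ j
  · rw [emb_apply_of_left _ hj]
    simp only [Core.toMatrix, Matrix.of_apply]
    rw [if_neg (by omega), if_neg (by omega), if_neg (by omega), if_neg (by omega)]
  by_cases hk : (k : ℕ) < i ∨ i + w ≤ k
  · rw [emb_apply_of_right _ hk]
    simp only [Core.toMatrix, Matrix.of_apply]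
    rw [if_neg (by omega), if_neg (by omega), if_neg (by omega), if_neg (by omega)]
  have hja : (j : ℕ) = i + (⟨j - i, by omega⟩ : Fin w) := by simp; omega
  have hkb : (k : ℕ) = i + (⟨k - i, by omega⟩ : Fin w) := by simp; omega
  rw [emb_apply_mem _ hja hkb]
  simp only [Core.toMatrix, Matrix.of_apply, Fin.ext_iff]
  have e1 : ∀ q, ((j : ℕ) - i = q) = ((j : ℕ) = i + q) := fun q => propext (by omega)
  have e2 : ∀ q, ((k : ℕ) - i = q) = ((k : ℕ) = i + q) := fun q => propext (by omega)
  have e3 : ((j : ℕ) = i + ((k : ℕ) - i)) = ((j : ℕ) = k) := propext (by omega)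
  simp only [e1, e2, e3, add_assoc]

theorem Core.toMatrix_eq_emb_two (g : Core) (m i : ℕ) :
    g.toMatrix m i = emb m i (g.toMatrix 2 0) := g.toMatrix_eq_emb (p := 0) le_rfl

theorem Core.toMatrix_eq_emb_three_zero (g : Core) (m i : ℕ) :
    g.toMatrix m i = emb m i (g.toMatrix 3 0) := g.toMatrix_eq_emb (p := 0) (by norm_num)

theorem Core.toMatrix_eq_emb_three_one (g : Core) (m i : ℕ) :
    g.toMatrix m (i + 1) = emb m i (g.toMatrix 3 1) := g.toMatrix_eq_emb (p := 1) (by norm_num)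

theorem Core.toMatrix_commute (g h : Core) {m i j : ℕ} (hij : i + 2 ≤ j) :
    Commute (g.toMatrix m i) (h.toMatrix m j) := by
  rw [g.toMatrix_eq_emb_two, h.toMatrix_eq_emb_two]
  exact emb_commute hij _ _


/-! ### Core transformations and their products -/

namespace Core

/-- The norm of the first column of the active part; a core is this multiple of a unitary core. -/
noncomputable def size (g : Core) : ℝ := Real.sqrt (‖g.c‖ ^ 2 + ‖g.s‖ ^ 2)

/-- The core has size one up to the error `e`. -/
def Near (e : ℝ) (g : Core) : Prop := |g.size - 1| ≤ e

theorem size_nonneg (g : Core) : 0 ≤ g.size := Real.sqrt_nonneg _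

theorem size_sq (g : Core) : g.size ^ 2 = ‖g.c‖ ^ 2 + ‖g.s‖ ^ 2 := Real.sq_sqrt (by positivity)

theorem norm_c_le (g : Core) : ‖g.c‖ ≤ g.size := Real.le_sqrt_of_sq_le (by nlinarith [sq_nonneg ‖g.s‖])

theorem norm_s_le (g : Core) : ‖g.s‖ ≤ g.size := Real.le_sqrt_of_sq_le (by nlinarith [sq_nonneg ‖g.c‖])

theorem Near.mono {e e' : ℝ} {g : Core} (h : g.Near e) (he : e ≤ e') : g.Near e' := le_trans h he

theorem Near.le {e : ℝ} {g : Core} (h : g.Near e) : g.size ≤ 1 + e := by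
  have := abs_le.1 h; linarith

theorem Near.ge {e : ℝ} {g : Core} (h : g.Near e) : 1 - e ≤ g.size := by
  have := abs_le.1 h; linarith

theorem sgn_eq (g : Core) : g.sgn = 1 ∨ g.sgn = -1 := by
  rcases Int.units_eq_one_or g.d with h | h <;> simp [sgn, h]

@[simp] theorem sgn_mul_self (g : Core) : g.sgn * g.sgn = 1 := by
  rcases g.sgn_eq with h | h <;> simp [h]

@[simp] theorem conj_sgn (g : Core) : conj g.sgn = g.sgn := by
  rcases g.sgn_eq with h | h <;> simp [h]

@[simp] theorem norm_sgn (g : Core) : ‖g.sgn‖ = 1 := by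
  rcases g.sgn_eq with h | h <;> simp [h]

@[simp] theorem size_inv (g : Core) : g.inv.size = g.size := by simp [size, inv]

@[simp] theorem size_flip (g : Core) : g.flip.size = g.size := by simp [size, flip]

theorem Near.inv {e : ℝ} {g : Core} (h : g.Near e) : g.inv.Near e := by simpa [Near] using h

theorem Near.flip {e : ℝ} {g : Core} (h : g.Near e) : g.flip.Near e := by simpa [Near] using h

theorem unitize_c (g : Core) : g.unitize.c = g.c / (g.size : ℂ) := rfl

theorem unitize_s (g : Core) : g.unitize.s = g.s / (g.size : ℂ) := rfl

theorem unitize_d (g : Core) : g.unitize.d = g.d := rfl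

@[simp] theorem unitize_sgn (g : Core) : g.unitize.sgn = g.sgn := rfl

theorem size_mul_unitize_c {g : Core} (h : 0 < g.size) : (g.size : ℂ) * g.unitize.c = g.c := by
  have : (g.size : ℂ) ≠ 0 := by exact_mod_cast h.ne'
  rw [unitize_c]; field_simp

theorem size_mul_unitize_s {g : Core} (h : 0 < g.size) : (g.size : ℂ) * g.unitize.s = g.s := by
  have : (g.size : ℂ) ≠ 0 := by exact_mod_cast h.ne'
  rw [unitize_s]; field_simp

theorem size_unitize {g : Core} (h : 0 < g.size) : g.unitize.size = 1 := by
  rw [size, unitize_c, unitize_s, norm_div, norm_div, Complex.norm_real, Real.norm_eq_abs,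
    abs_of_pos h, div_pow, div_pow, ← add_div, ← size_sq, div_self (by positivity), Real.sqrt_one]

theorem unitize_inv (g : Core) : g.inv.unitize = g.unitize.inv := by
  have h : Real.sqrt (‖g.inv.c‖ ^ 2 + ‖g.inv.s‖ ^ 2) = Real.sqrt (‖g.c‖ ^ 2 + ‖g.s‖ ^ 2) := g.size_inv
  simp only [unitize, h]
  simp [inv, neg_div]

theorem unitize_flip (g : Core) : g.flip.unitize = g.unitize.flip := by
  have h : Real.sqrt (‖g.flip.c‖ ^ 2 + ‖g.flip.s‖ ^ 2) = Real.sqrt (‖g.c‖ ^ 2 + ‖g.s‖ ^ 2) :=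
    g.size_flip
  simp only [unitize, h]
  simp [flip, mul_div_assoc, sgn]

theorem flip_flip (g : Core) : g.flip.flip = g := by
  have h : ∀ z : ℂ, g.sgn * (g.sgn * z) = z := fun z => by rw [← mul_assoc, sgn_mul_self, one_mul]
  have h' : (⟨g.sgn * conj g.c, g.s, g.d⟩ : Core).sgn = g.sgn := rfl
  simp [flip, h', h]

theorem toMatrix_two (g : Core) :
    g.toMatrix 2 0 = !![g.c, -(g.sgn * conj g.s); g.s, g.sgn * conj g.c] := by
  ext i j; fin_cases i <;> fin_cases j <;> simp [toMatrix]

theorem toMatrix_three_zero (g : Core) :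
    g.toMatrix 3 0 = !![g.c, -(g.sgn * conj g.s), 0; g.s, g.sgn * conj g.c, 0; 0, 0, 1] := by
  ext i j; fin_cases i <;> fin_cases j <;> simp [toMatrix]

theorem toMatrix_three_one (g : Core) :
    g.toMatrix 3 1 = !![1, 0, 0; 0, g.c, -(g.sgn * conj g.s); 0, g.s, g.sgn * conj g.c] := by
  ext i j; fin_cases i <;> fin_cases j <;> simp [toMatrix]

theorem toMatrix_two_unitary {g : Core} (h : g.size = 1) :
    g.toMatrix 2 0 ∈ Matrix.unitaryGroup (Fin 2) ℂ := by
  have h1 : (g.c * conj g.c + g.s * conj g.s : ℂ) = 1 := by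
    rw [Complex.mul_conj, Complex.mul_conj, Complex.normSq_eq_norm_sq, Complex.normSq_eq_norm_sq]
    have := g.size_sq
    rw [h] at this
    exact_mod_cast this.symm.trans (one_pow 2)
  have h2 := g.sgn_mul_self
  rw [Matrix.mem_unitaryGroup_iff, Matrix.star_eq_conjTranspose, toMatrix_two]
  ext i j
  fin_cases i <;> fin_cases j <;>
    simp [Matrix.mul_apply, Fin.sum_univ_two, Matrix.conjTranspose_apply]
  · linear_combination h1 + (conj g.s * g.s) * h2
  · linear_combination -(conj g.s * g.c) * h2
  · linear_combination -(conj g.c * g.s) * h2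
  · linear_combination h1 + (conj g.c * g.c) * h2

theorem toMatrix_unitary {g : Core} (h : g.size = 1) {m i : ℕ} (hi : i + 2 ≤ m) :
    g.toMatrix m i ∈ Matrix.unitaryGroup (Fin m) ℂ := by
  rw [g.toMatrix_eq_emb_two]
  exact emb_unitary hi (toMatrix_two_unitary h)

theorem unitize_toMatrix_unitary {g : Core} (h : 0 < g.size) {m i : ℕ} (hi : i + 2 ≤ m) :
    g.unitize.toMatrix m i ∈ Matrix.unitaryGroup (Fin m) ℂ :=
  toMatrix_unitary (size_unitize h) hi

theorem norm_toMatrix_sub_unitize {g : Core} (h : 0 < g.size) {m i : ℕ} (hi : i + 2 ≤ m) :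
    ‖g.toMatrix m i - g.unitize.toMatrix m i‖ ≤ |g.size - 1| := by
  rw [g.toMatrix_eq_emb_two, g.unitize.toMatrix_eq_emb_two]
  refine (norm_emb_sub_le hi _ _).trans ?_
  have h1 : g.toMatrix 2 0 - g.unitize.toMatrix 2 0
      = ((g.size - 1 : ℝ) : ℂ) • g.unitize.toMatrix 2 0 := by
    have hc := size_mul_unitize_c h
    have hs := size_mul_unitize_s h
    have hc' : (g.size : ℂ) * conj g.unitize.c = conj g.c := by
      rw [← hc, map_mul, Complex.conj_ofReal]
    have hs' : (g.size : ℂ) * conj g.unitize.s = conj g.s := by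
      rw [← hs, map_mul, Complex.conj_ofReal]
    rw [toMatrix_two, toMatrix_two, unitize_sgn]
    ext i j
    fin_cases i <;> fin_cases j <;> simp
    · linear_combination -hc
    · linear_combination g.sgn * hs'
    · linear_combination -hs
    · linear_combination -g.sgn * hc'
  rw [h1, norm_smul, Complex.norm_real, Real.norm_eq_abs]
  have := norm_le_one_of_unitary (toMatrix_two_unitary (size_unitize h))
  nlinarith [abs_nonneg (g.size - 1)]

theorem norm_toMatrix_le {g : Core} (h : 0 < g.size) {e : ℝ} (he : g.Near e) {m i : ℕ}
    (hi : i + 2 ≤ m) : ‖g.toMatrix m i‖ ≤ 1 + e := by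
  have h1 := norm_toMatrix_sub_unitize h hi
  have h2 := norm_le_one_of_unitary (unitize_toMatrix_unitary h hi)
  have h3 := norm_le_norm_add_norm_sub' (g.toMatrix m i) (g.unitize.toMatrix m i)
  have : |g.size - 1| ≤ e := he
  linarith

theorem toMatrix_inv {g : Core} (hd : g.d = 1) (m i : ℕ) :
    g.inv.toMatrix m i = (g.toMatrix m i)ᴴ := by
  rw [g.inv.toMatrix_eq_emb_two, g.toMatrix_eq_emb_two, ← emb_conjTranspose, toMatrix_two,
    toMatrix_two]
  have : g.sgn = 1 := by simp [sgn, hd]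
  have h' : g.inv.sgn = 1 := by simp [sgn, inv, hd]
  rw [this, h']
  congr 1
  ext i j
  fin_cases i <;> fin_cases j <;> simp [inv]

/-- Changing the entries of a core changes its matrix by at most twice as much. -/
theorem norm_toMatrix_sub_le {g h : Core} (hd : g.d = h.d) {m i : ℕ} (hi : i + 2 ≤ m) :
    ‖g.toMatrix m i - h.toMatrix m i‖ ≤ 2 * ‖g.c - h.c‖ + 2 * ‖g.s - h.s‖ := by
  rw [g.toMatrix_eq_emb_two, h.toMatrix_eq_emb_two]
  refine (norm_emb_sub_le hi _ _).trans ((norm_le_sum_entries _).trans ?_)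
  have hsg : g.sgn = h.sgn := by simp [sgn, hd]
  have h1 : ‖h.sgn * conj h.s - h.sgn * conj g.s‖ = ‖g.s - h.s‖ := by
    rw [← mul_sub, norm_mul, norm_sgn, ← map_sub, RCLike.norm_conj, one_mul, norm_sub_rev]
  have h2 : ‖h.sgn * conj g.c - h.sgn * conj h.c‖ = ‖g.c - h.c‖ := by
    rw [← mul_sub, norm_mul, norm_sgn, ← map_sub, RCLike.norm_conj, one_mul]
  simp only [toMatrix_two, Fin.sum_univ_two, Matrix.sub_apply, hsg]
  simp [h2]
  rw [neg_add_eq_sub, h1]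
  linarith

end Core

/-- The product `G i * ⋯ * G (i + len - 1)` of consecutive cores of a descending sequence. -/
def segProd (m i len : ℕ) (G : ℕ → Core) : Matrix (Fin m) (Fin m) ℂ :=
  ((List.range len).map fun j => (G (i + j)).toMatrix m (i + j)).prod

theorem segProd_zero (m i : ℕ) (G : ℕ → Core) : segProd m i 0 G = 1 := rfl

theorem segProd_succ (m i len : ℕ) (G : ℕ → Core) :
    segProd m i (len + 1) G = segProd m i len G * (G (i + len)).toMatrix m (i + len) := by
  simp [segProd, List.range_succ]

theorem descProd_eq_segProd (m k : ℕ) (G : ℕ → Core) : descProd m k G = segProd m 0 k G := by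
  simp [segProd, descProd]

theorem descProd_succ (m k : ℕ) (G : ℕ → Core) :
    descProd m (k + 1) G = descProd m k G * (G k).toMatrix m k := by
  simp [descProd, List.range_succ]

theorem segProd_add (m i k len : ℕ) (G : ℕ → Core) :
    segProd m i (k + len) G = segProd m i k G * segProd m (i + k) len G := by
  induction len with
  | zero => simp [segProd_zero]
  | succ l ih => rw [← add_assoc, segProd_succ, ih, segProd_succ, Matrix.mul_assoc, add_assoc]

theorem segProd_congr {m i len : ℕ} {G H : ℕ → Core} (h : ∀ j, i ≤ j → j < i + len → G j = H j) :
    segProd m i len G = segProd m i len H := by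
  unfold segProd
  congr 1
  refine List.map_congr_left fun j hj => ?_
  rw [h (i + j) (by omega) (by have := List.mem_range.1 hj; omega)]

theorem segProd_commute_left {m i len j : ℕ} {G : ℕ → Core} (h : Core) (hj : i + len + 1 ≤ j) :
    Commute (segProd m i len G) (h.toMatrix m j) := by
  induction len with
  | zero => rw [segProd_zero]; exact Commute.one_left _
  | succ l ih =>
    rw [segProd_succ]
    exact (ih (by omega)).mul_left ((G (i + l)).toMatrix_commute h (by omega))

theorem segProd_commute_right {m i len j : ℕ} {G : ℕ → Core} (h : Core) (hj : j + 2 ≤ i) :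
    Commute (segProd m i len G) (h.toMatrix m j) := by
  induction len with
  | zero => rw [segProd_zero]; exact Commute.one_left _
  | succ l ih =>
    rw [segProd_succ]
    exact ih.mul_left (h.toMatrix_commute (G (i + l)) (by omega)).symm

theorem segProd_unitary {m i len : ℕ} {G : ℕ → Core} (hm : i + len + 1 ≤ m)
    (h : ∀ j, i ≤ j → j < i + len → (G j).size = 1) :
    segProd m i len G ∈ Matrix.unitaryGroup (Fin m) ℂ := by
  induction len with
  | zero => rw [segProd_zero]; exact one_mem _
  | succ l ih =>
    rw [segProd_succ]
    exact mul_mem (ih (by omega) fun j h1 h2 => h j h1 (by omega))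
      (Core.toMatrix_unitary (h _ (by omega) (by omega)) (by omega))

theorem norm_segProd_le_pow {m i len : ℕ} {G : ℕ → Core} {e : ℝ} (he : e < 1)
    (hm : i + len + 1 ≤ m) (h : ∀ j, i ≤ j → j < i + len → (G j).Near e) :
    ‖segProd m i len G‖ ≤ (1 + e) ^ len := by
  induction len with
  | zero => rw [segProd_zero, pow_zero]; exact norm_le_one_of_unitary (one_mem _)
  | succ l ih =>
    rw [segProd_succ, pow_succ]
    have h1 := h (i + l) (by omega) (by omega)
    have h2 := Core.norm_toMatrix_le (by have := h1.ge; linarith) h1 (m := m) (i := i + l) (by omega)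
    have h3 := ih (by omega) fun j h1 h2 => h j h1 (by omega)
    exact (Matrix.l2_opNorm_mul _ _).trans (mul_le_mul h3 h2 (norm_nonneg _)
      ((norm_nonneg _).trans h3))

theorem one_add_pow_le_two {e : ℝ} {k m : ℕ} (he0 : 0 ≤ e) (hk : k ≤ m) (he : m * e ≤ 1 / 2) :
    (1 + e) ^ k ≤ 2 := by
  have h1 : (1 + e) ^ k ≤ Real.exp (k * e) := by
    rw [Real.exp_nat_mul]
    exact pow_le_pow_left₀ (by linarith) (by linarith [Real.add_one_le_exp e]) _
  have h2 : (k : ℝ) * e ≤ 1 / 2 := le_trans (by gcongr) he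
  have h3 : Real.exp (k * e) ≤ Real.exp (1 / 2) := Real.exp_le_exp.2 h2
  have h4 : Real.exp (1 / 2) ≤ 2 := by
    have h5 : Real.exp (1 / 2) * Real.exp (1 / 2) = Real.exp 1 := by rw [← Real.exp_add]; norm_num
    nlinarith [Real.exp_one_lt_d9, Real.exp_pos (1 / 2)]
  linarith

theorem norm_segProd_le_two {m i len : ℕ} {G : ℕ → Core} {e : ℝ} (he0 : 0 ≤ e)
    (hme : m * e ≤ 1 / 2) (hm : i + len + 1 ≤ m) (h : ∀ j, i ≤ j → j < i + len → (G j).Near e) :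
    ‖segProd m i len G‖ ≤ 2 := by
  have h1 : (1 : ℝ) ≤ m := by exact_mod_cast (by omega : 1 ≤ m)
  have he : e < 1 := by nlinarith
  exact (norm_segProd_le_pow he hm h).trans (one_add_pow_le_two he0 (by omega) hme)

/-- The effect on a product of perturbing all the cores. -/
theorem norm_segProd_sub_le {m i len : ℕ} {G H : ℕ → Core} {e δ : ℝ} (he0 : 0 ≤ e)
    (hme : m * e ≤ 1 / 2) (hm : i + len + 1 ≤ m)
    (hG : ∀ j, i ≤ j → j < i + len → (G j).Near e)
    (hH : ∀ j, i ≤ j → j < i + len → (H j).Near e)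
    (hδ : ∀ j, i ≤ j → j < i + len → ‖(G j).toMatrix m j - (H j).toMatrix m j‖ ≤ δ) :
    ‖segProd m i len G - segProd m i len H‖ ≤ len * (2 * (2 * δ)) := by
  -- `a l` bounds the error of the first `l` factors, relative to the growth of the norms
  have h1 : (1 : ℝ) ≤ m := by exact_mod_cast (by omega : 1 ≤ m)
  have he : e < 1 := by nlinarith
  suffices key : ∀ l, l ≤ len →
      ‖segProd m i l G - segProd m i l H‖ ≤ l * (2 * δ) * (1 + e) ^ l by
    have h2 := key len le_rfl
    have h3 := one_add_pow_le_two he0 (by omega : len ≤ m) hme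
    have h4 : 0 ≤ (len : ℝ) * (2 * δ) := by
      rcases Nat.eq_zero_or_pos len with h | h
      · simp [h]
      · have := (norm_nonneg _).trans (hδ i le_rfl (by omega)); positivity
    nlinarith
  intro l hl
  induction l with
  | zero => simp [segProd_zero]
  | succ l ih =>
    have hδ' := hδ (i + l) (by omega) (by omega)
    have hδ0 : 0 ≤ δ := (norm_nonneg _).trans hδ'
    have hn := hG (i + l) (by omega) (by omega)
    have hg := Core.norm_toMatrix_le (by have := hn.ge; linarith) hn (m := m) (i := i + l) (by omega)
    have hh := norm_segProd_le_two he0 hme (by omega : i + l + 1 ≤ m)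
      (G := H) fun j h1 h2 => hH j h1 (by omega)
    have hih := ih (by omega)
    rw [segProd_succ, segProd_succ]
    have e1 : segProd m i l G * (G (i + l)).toMatrix m (i + l)
        - segProd m i l H * (H (i + l)).toMatrix m (i + l)
        = (segProd m i l G - segProd m i l H) * (G (i + l)).toMatrix m (i + l)
        + segProd m i l H * ((G (i + l)).toMatrix m (i + l) - (H (i + l)).toMatrix m (i + l)) := by
      rw [Matrix.sub_mul, Matrix.mul_sub]; abel
    rw [e1]
    have hp : 1 ≤ (1 + e) ^ (l + 1) := one_le_pow₀ (by linarith)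
    calc _ ≤ ‖segProd m i l G - segProd m i l H‖ * ‖(G (i + l)).toMatrix m (i + l)‖
          + ‖segProd m i l H‖ * ‖(G (i + l)).toMatrix m (i + l) - (H (i + l)).toMatrix m (i + l)‖ :=
          (norm_add_le _ _).trans (add_le_add (Matrix.l2_opNorm_mul _ _) (Matrix.l2_opNorm_mul _ _))
      _ ≤ (l * (2 * δ) * (1 + e) ^ l) * (1 + e) + 2 * δ := by gcongr
      _ ≤ (l * (2 * δ) * (1 + e) ^ l) * (1 + e) + 2 * δ * (1 + e) ^ (l + 1) := by nlinarith
      _ = _ := by push_cast; ring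


/-! ### Floating-point operations -/

theorem norm_le_of_components {z w : ℂ} {d : ℝ} (hd : 0 ≤ d) (h1 : |z.re| ≤ d * |w.re|)
    (h2 : |z.im| ≤ d * |w.im|) : ‖z‖ ≤ d * ‖w‖ := by
  rw [← abs_of_nonneg (norm_nonneg z), ← abs_of_nonneg (mul_nonneg hd (norm_nonneg w)),
    ← sq_le_sq, mul_pow, Complex.sq_norm, Complex.sq_norm, Complex.normSq_apply,
    Complex.normSq_apply]
  have e1 := mul_self_le_mul_self (abs_nonneg _) h1
  have e2 := mul_self_le_mul_self (abs_nonneg _) h2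
  have a1 := abs_mul_abs_self z.re
  have a2 := abs_mul_abs_self z.im
  have a3 := abs_mul_abs_self w.re
  have a4 := abs_mul_abs_self w.im
  nlinarith

/-- The norm of a vector of length two. -/
noncomputable def hyp (x y : ℂ) : ℝ := Real.sqrt (‖x‖ ^ 2 + ‖y‖ ^ 2)

theorem hyp_sq (x y : ℂ) : hyp x y ^ 2 = ‖x‖ ^ 2 + ‖y‖ ^ 2 := Real.sq_sqrt (by positivity)

theorem hyp_nonneg (x y : ℂ) : 0 ≤ hyp x y := Real.sqrt_nonneg _

theorem norm_le_hyp_left (x y : ℂ) : ‖x‖ ≤ hyp x y :=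
  Real.le_sqrt_of_sq_le (by nlinarith [sq_nonneg ‖y‖])

theorem norm_le_hyp_right (x y : ℂ) : ‖y‖ ≤ hyp x y :=
  Real.le_sqrt_of_sq_le (by nlinarith [sq_nonneg ‖x‖])

theorem hyp_le_add (x y : ℂ) : hyp x y ≤ ‖x‖ + ‖y‖ :=
  Real.sqrt_le_iff.2 ⟨by positivity, by nlinarith [norm_nonneg x, norm_nonneg y]⟩

theorem hyp_pos {x y : ℂ} (h : x ≠ 0 ∨ y ≠ 0) : 0 < hyp x y := by
  rcases h with h | h
  · exact (norm_pos_iff.2 h).trans_le (norm_le_hyp_left x y)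
  · exact (norm_pos_iff.2 h).trans_le (norm_le_hyp_right x y)

/-- The function `hyp` is the Euclidean norm, hence nonexpansive. -/
theorem abs_hyp_sub_hyp_le (x y x' y' : ℂ) : |hyp x y - hyp x' y'| ≤ ‖x - x'‖ + ‖y - y'‖ := by
  have h : ∀ a b : ℂ, hyp a b = ‖WithLp.toLp 2 (a, b)‖ := fun a b => by
    rw [WithLp.prod_norm_eq_of_L2]; rfl
  refine le_trans ?_ (hyp_le_add (x - x') (y - y'))
  rw [h, h, h]
  exact abs_norm_sub_norm_le _ _

namespace FloatArith

variable {u : ℝ} (F : FloatArith u)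

include F in
theorem u_nonneg : 0 ≤ u := by
  have h := F.fl_err 1
  have := abs_nonneg (F.fl 1 - 1)
  simp at h; linarith

theorem fl_between {x : ℝ} (hx : 0 ≤ x) : (1 - u) * x ≤ F.fl x ∧ F.fl x ≤ (1 + u) * x := by
  have h := abs_le.1 (F.fl_err x)
  rw [abs_of_nonneg hx] at h
  constructor <;> linarith [h.1, h.2]

theorem norm_cadd_sub_le (x y : ℂ) : ‖F.cadd x y - (x + y)‖ ≤ u * ‖x + y‖ :=
  norm_le_of_components F.u_nonneg (by simpa [cadd] using F.fl_err _)
    (by simpa [cadd] using F.fl_err _)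

theorem norm_cdiv_sub_le (x : ℂ) (r : ℝ) : ‖F.cdiv x r - x / r‖ ≤ u * ‖x / r‖ :=
  norm_le_of_components F.u_nonneg
    (by simpa [cdiv, Complex.div_ofReal_re] using F.fl_err _)
    (by simpa [cdiv, Complex.div_ofReal_im] using F.fl_err _)

theorem abs_fl_sub_two_le (hu : u ≤ 1 / 2) (p q : ℝ) :
    |F.fl (F.fl p - F.fl q) - (p - q)| ≤ 5 / 2 * u * (|p| + |q|) := by
  have h0 := F.u_nonneg
  have h1 := F.fl_err p
  have h2 := F.fl_err q
  have h3 := F.fl_err (F.fl p - F.fl q)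
  have h4 : |F.fl p - F.fl q - (p - q)| ≤ u * (|p| + |q|) := by
    have : F.fl p - F.fl q - (p - q) = (F.fl p - p) - (F.fl q - q) := by ring
    rw [this]
    exact (abs_sub _ _).trans (by linarith)
  have h5 : |F.fl p - F.fl q| ≤ (1 + u) * (|p| + |q|) := by
    have := abs_sub_abs_le_abs_sub (F.fl p - F.fl q) (p - q)
    have := abs_sub p q
    linarith
  have h6 : |F.fl (F.fl p - F.fl q) - (p - q)| ≤
      |F.fl (F.fl p - F.fl q) - (F.fl p - F.fl q)| + |F.fl p - F.fl q - (p - q)| :=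
    abs_sub_le _ _ _
  have h7 : 0 ≤ |p| + |q| := by positivity
  have h8 : u * |F.fl p - F.fl q| ≤ u * ((1 + u) * (|p| + |q|)) := by gcongr
  nlinarith [mul_nonneg h0 h7]

theorem abs_fl_add_two_le (hu : u ≤ 1 / 2) (p q : ℝ) :
    |F.fl (F.fl p + F.fl q) - (p + q)| ≤ 5 / 2 * u * (|p| + |q|) := by
  have h0 := F.u_nonneg
  have h1 := F.fl_err p
  have h2 := F.fl_err q
  have h3 := F.fl_err (F.fl p + F.fl q)
  have h4 : |F.fl p + F.fl q - (p + q)| ≤ u * (|p| + |q|) := by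
    have : F.fl p + F.fl q - (p + q) = (F.fl p - p) + (F.fl q - q) := by ring
    rw [this]
    exact (abs_add_le _ _).trans (by linarith)
  have h5 : |F.fl p + F.fl q| ≤ (1 + u) * (|p| + |q|) := by
    have := abs_sub_abs_le_abs_sub (F.fl p + F.fl q) (p + q)
    have := abs_add_le p q
    linarith
  have h6 : |F.fl (F.fl p + F.fl q) - (p + q)| ≤
      |F.fl (F.fl p + F.fl q) - (F.fl p + F.fl q)| + |F.fl p + F.fl q - (p + q)| :=
    abs_sub_le _ _ _
  have h7 : 0 ≤ |p| + |q| := by positivity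
  have h8 : u * |F.fl p + F.fl q| ≤ u * ((1 + u) * (|p| + |q|)) := by gcongr
  nlinarith [mul_nonneg h0 h7]

/-- The four products and two sums of a complex multiplication give a relative error of the complex
product as a whole, by the Cauchy–Schwarz inequality; its real and imaginary parts may lose all
digits by cancellation. -/
theorem norm_cmul_sub_le (hu : u ≤ 1 / 2) (x y : ℂ) :
    ‖F.cmul x y - x * y‖ ≤ 5 * u * (‖x‖ * ‖y‖) := by
  have h0 := F.u_nonneg
  have h1 := F.abs_fl_sub_two_le hu (x.re * y.re) (x.im * y.im)
  have h2 := F.abs_fl_add_two_le hu (x.re * y.im) (x.im * y.re)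
  have cs : ∀ a b c d : ℝ, |a| * |c| + |b| * |d| ≤
      Real.sqrt (a ^ 2 + b ^ 2) * Real.sqrt (c ^ 2 + d ^ 2) := by
    intro a b c d
    rw [← Real.sqrt_mul (by positivity)]
    refine Real.le_sqrt_of_sq_le ?_
    nlinarith [sq_nonneg (|a| * |d| - |b| * |c|), sq_abs a, sq_abs b, sq_abs c, sq_abs d]
  have hx : ‖x‖ = Real.sqrt (x.re ^ 2 + x.im ^ 2) := by
    rw [← Complex.normSq_add_mul_I, ← Complex.sq_norm, Real.sqrt_sq (norm_nonneg _),
      Complex.re_add_im]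
  have hy : ‖y‖ = Real.sqrt (y.re ^ 2 + y.im ^ 2) := by
    rw [← Complex.normSq_add_mul_I, ← Complex.sq_norm, Real.sqrt_sq (norm_nonneg _),
      Complex.re_add_im]
  have c1 := cs x.re x.im y.re y.im
  have c2 := cs x.re x.im y.im y.re
  rw [add_comm (y.im ^ 2)] at c2
  rw [← hx, ← hy] at c1 c2
  rw [abs_mul, abs_mul] at h1 h2
  have e : ‖F.cmul x y - x * y‖ ≤ |(F.cmul x y - x * y).re| + |(F.cmul x y - x * y).im| :=
    Complex.norm_le_abs_re_add_abs_im _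
  have h1' : |(F.cmul x y - x * y).re| ≤ 5 / 2 * u * (|x.re| * |y.re| + |x.im| * |y.im|) := by
    simpa [cmul] using h1
  have h2' : |(F.cmul x y - x * y).im| ≤ 5 / 2 * u * (|x.re| * |y.im| + |x.im| * |y.re|) := by
    simpa [cmul] using h2
  have g1 := mul_le_mul_of_nonneg_left c1 (by positivity : 0 ≤ 5 / 2 * u)
  have g2 := mul_le_mul_of_nonneg_left c2 (by positivity : 0 ≤ 5 / 2 * u)
  linarith

theorem one_add_pow_three_le {v : ℝ} (h0 : 0 ≤ v) (h : v ≤ 1 / 100) :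
    (1 + v) ^ 3 ≤ (1 + 7 / 4 * v) ^ 2 := by
  have : v * (v * v) ≤ v * (1 / 2) := mul_le_mul_of_nonneg_left (by nlinarith) h0
  nlinarith [mul_nonneg h0 h0]

theorem le_one_sub_pow_three {v : ℝ} (h0 : 0 ≤ v) (h : v ≤ 1 / 100) :
    (1 - 7 / 4 * v) ^ 2 ≤ (1 - v) ^ 3 := by
  have : v * (v * v) ≤ v * (1 / 4) := mul_le_mul_of_nonneg_left (by nlinarith) h0
  have : v * v ≤ v * (1 / 100) := mul_le_mul_of_nonneg_left h h0
  nlinarith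

/-- No cancellation occurs in a sum of squares, so that the computed norm has a small relative
error. -/
theorem abs_norm2_sub_le (hu : u ≤ 1 / 100) (x y : ℂ) :
    |F.norm2 x y - hyp x y| ≤ 3 * u * hyp x y := by
  have h0 := F.u_nonneg
  have sq : ∀ a : ℝ, 0 ≤ a * a := mul_self_nonneg
  obtain ⟨a1, a2⟩ := F.fl_between (sq x.re)
  obtain ⟨b1, b2⟩ := F.fl_between (sq x.im)
  obtain ⟨c1, c2⟩ := F.fl_between (sq y.re)
  obtain ⟨d1, d2⟩ := F.fl_between (sq y.im)
  have hu1 : 0 ≤ 1 - u := by linarith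
  have pos : ∀ a, 0 ≤ (1 - u) * (a * a) := fun a => mul_nonneg hu1 (sq a)
  obtain ⟨p1, p2⟩ := F.fl_between (add_nonneg ((pos _).trans a1) ((pos _).trans b1))
  obtain ⟨q1, q2⟩ := F.fl_between (add_nonneg ((pos _).trans c1) ((pos _).trans d1))
  set P := F.fl (F.fl (x.re * x.re) + F.fl (x.im * x.im))
  set Q := F.fl (F.fl (y.re * y.re) + F.fl (y.im * y.im))
  have hX : ‖x‖ ^ 2 = x.re * x.re + x.im * x.im := by
    rw [Complex.sq_norm, Complex.normSq_apply]
  have hY : ‖y‖ ^ 2 = y.re * y.re + y.im * y.im := by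
    rw [Complex.sq_norm, Complex.normSq_apply]
  have p1' : (1 - u) ^ 2 * ‖x‖ ^ 2 ≤ P := by
    rw [hX]
    exact le_trans (by nlinarith) p1
  have p2' : P ≤ (1 + u) ^ 2 * ‖x‖ ^ 2 := by
    rw [hX]
    exact p2.trans (by nlinarith)
  have q1' : (1 - u) ^ 2 * ‖y‖ ^ 2 ≤ Q := by
    rw [hY]
    exact le_trans (by nlinarith) q1
  have q2' : Q ≤ (1 + u) ^ 2 * ‖y‖ ^ 2 := by
    rw [hY]
    exact q2.trans (by nlinarith)
  have hPQ : 0 ≤ P + Q := by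
    have := mul_nonneg (sq_nonneg (1 - u)) (sq_nonneg ‖x‖)
    have := mul_nonneg (sq_nonneg (1 - u)) (sq_nonneg ‖y‖)
    linarith
  obtain ⟨r1, r2⟩ := F.fl_between hPQ
  have hr0 : 0 ≤ F.fl (P + Q) := le_trans (mul_nonneg hu1 hPQ) r1
  obtain ⟨s1, s2⟩ := F.fl_between (Real.sqrt_nonneg (F.fl (P + Q)))
  have hH := hyp_sq x y
  have hH0 := hyp_nonneg x y
  set H := hyp x y
  have t1 : (1 - u) ^ 3 * H ^ 2 ≤ F.fl (P + Q) := by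
    refine le_trans ?_ r1
    rw [hH, pow_succ', mul_assoc]
    exact mul_le_mul_of_nonneg_left (by linarith) hu1
  have t2 : F.fl (P + Q) ≤ (1 + u) ^ 3 * H ^ 2 := by
    refine r2.trans ?_
    rw [hH, pow_succ', mul_assoc]
    exact mul_le_mul_of_nonneg_left (by linarith) (by linarith)
  -- `(1 ± u)^(3/2)` is replaced by `1 ± 7u/4`
  have v1 : (1 - 7 / 4 * u) * H ≤ Real.sqrt (F.fl (P + Q)) := by
    refine Real.le_sqrt_of_sq_le (le_trans ?_ t1)
    rw [mul_pow]
    exact mul_le_mul_of_nonneg_right (le_one_sub_pow_three h0 hu) (sq_nonneg _)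
  have v2 : Real.sqrt (F.fl (P + Q)) ≤ (1 + 7 / 4 * u) * H := by
    refine Real.sqrt_le_iff.2 ⟨by positivity, t2.trans ?_⟩
    rw [mul_pow]
    exact mul_le_mul_of_nonneg_right (one_add_pow_three_le h0 hu) (sq_nonneg _)
  have hn : F.norm2 x y = F.fl (Real.sqrt (F.fl (P + Q))) := rfl
  have w1 := s1.trans' (mul_le_mul_of_nonneg_left v1 hu1)
  have w2 := s2.trans (mul_le_mul_of_nonneg_left v2 (by linarith : 0 ≤ 1 + u))
  have hHu := mul_nonneg h0 hH0
  have hHuu : u * (u * H) ≤ 1 / 100 * (u * H) := mul_le_mul_of_nonneg_right hu hHu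
  have hHuu0 : 0 ≤ u * (u * H) := mul_nonneg h0 hHu
  rw [hn, abs_le]
  clear_value H
  generalize F.fl (Real.sqrt (F.fl (P + Q))) = Z at w1 w2 ⊢
  constructor <;> linarith

end FloatArith

/-! ### A calculus of relative errors -/

/-- `x` approximates `x'`, a number of modulus at most `X`, with error at most `δ * X`. -/
def Approx (δ X : ℝ) (x x' : ℂ) : Prop := ‖x - x'‖ ≤ δ * X ∧ ‖x'‖ ≤ X

namespace Approx

variable {u δ δ' X Y : ℝ} {x x' y y' : ℂ}

theorem nonneg (h : Approx δ X x x') : 0 ≤ X := (norm_nonneg _).trans h.2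

theorem norm_le (h : Approx δ X x x') : ‖x‖ ≤ (1 + δ) * X := by
  have := norm_le_norm_add_norm_sub' x x'
  linarith [h.1, h.2]

theorem mono (h : Approx δ X x x') (hd : δ ≤ δ') : Approx δ' X x x' :=
  ⟨h.1.trans (mul_le_mul_of_nonneg_right hd h.nonneg), h.2⟩

theorem map_conj (h : Approx δ X x x') : Approx δ X (starRingEnd ℂ x) (starRingEnd ℂ x') := by
  unfold Approx
  rw [← map_sub, RCLike.norm_conj, RCLike.norm_conj]
  exact h

theorem sgn_mul (g : Core) (h : Approx δ X x x') : Approx δ X (g.sgn * x) (g.sgn * x') := by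
  unfold Approx
  rw [← mul_sub, norm_mul, norm_mul, g.norm_sgn, one_mul, one_mul]
  exact h

theorem mul (hδ : 0 ≤ δ) (hx : Approx δ X x x') (hy : Approx δ' Y y y') :
    Approx (δ + δ' + δ * δ') (X * Y) (x * y) (x' * y') := by
  have h1 := hx.nonneg
  have h2 := hy.nonneg
  refine ⟨?_, ?_⟩
  · have e : x * y - x' * y' = (x - x') * y + x' * (y - y') := by ring
    calc _ ≤ ‖x - x'‖ * ‖y‖ + ‖x'‖ * ‖y - y'‖ := by
          rw [e, ← norm_mul, ← norm_mul]; exact norm_add_le _ _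
      _ ≤ (δ * X) * ((1 + δ') * Y) + X * (δ' * Y) := by
          have := hx.1; have := hx.2; have := hy.1; have := hy.norm_le
          gcongr
      _ = _ := by ring
  · rw [norm_mul]; exact mul_le_mul hx.2 hy.2 (norm_nonneg _) h1

theorem cmul (F : FloatArith u) {k l : ℝ} (hu : u ≤ 1 / 10 ^ 6) (hk0 : 0 ≤ k) (hk : k ≤ 100)
    (hl0 : 0 ≤ l) (hl : l ≤ 100) (hx : Approx (k * u) X x x') (hy : Approx (l * u) Y y y') :
    Approx ((k + l + 7) * u) (X * Y) (F.cmul x y) (x' * y') := by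
  have h0 := F.u_nonneg
  have hm := hx.mul (by positivity) hy
  have hXY : 0 ≤ X * Y := mul_nonneg hx.nonneg hy.nonneg
  refine ⟨?_, hm.2⟩
  have e1 := F.norm_cmul_sub_le (by linarith) x y
  have hku : k * u ≤ 1 / 10 ^ 4 := by nlinarith
  have hlu : l * u ≤ 1 / 10 ^ 4 := by nlinarith
  have hklu : k * u * (l * u) ≤ 1 / 10 * u := by
    have : k * (l * u) ≤ 1 / 10 := by nlinarith
    nlinarith
  have e2 : ‖x‖ * ‖y‖ ≤ 11 / 10 * (X * Y) := by
    have h3 : ‖x‖ * ‖y‖ ≤ ((1 + k * u) * X) * ((1 + l * u) * Y) :=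
      mul_le_mul hx.norm_le hy.norm_le (norm_nonneg _) ((norm_nonneg _).trans hx.norm_le)
    have h4 : (1 + k * u) * (1 + l * u) ≤ 11 / 10 := by nlinarith
    nlinarith
  have e3 : ‖F.cmul x y - x' * y'‖ ≤ ‖F.cmul x y - x * y‖ + ‖x * y - x' * y'‖ :=
    norm_sub_le_norm_sub_add_norm_sub _ _ _
  have e4 := hm.1
  have e5 : 5 * u * (‖x‖ * ‖y‖) ≤ 5 * u * (11 / 10 * (X * Y)) := by gcongr
  have e6 : (k * u + l * u + k * u * (l * u)) * (X * Y) ≤ (k * u + l * u + 1 / 10 * u) * (X * Y) := by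
    gcongr
  have := mul_nonneg h0 hXY
  nlinarith

theorem cadd (F : FloatArith u) {k : ℝ} (hu : u ≤ 1 / 10 ^ 6) (hk0 : 0 ≤ k) (hk : k ≤ 100)
    (hx : Approx (k * u) X x x') (hy : Approx (k * u) Y y y') :
    Approx ((k + 2) * u) (X + Y) (F.cadd x y) (x' + y') := by
  have h0 := F.u_nonneg
  have hXY : 0 ≤ X + Y := add_nonneg hx.nonneg hy.nonneg
  refine ⟨?_, (norm_add_le _ _).trans (add_le_add hx.2 hy.2)⟩
  have e1 := F.norm_cadd_sub_le x y
  have hku : k * u ≤ 1 / 10 ^ 4 := by nlinarith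
  have e2 : ‖x + y‖ ≤ 2 * (X + Y) := by
    have := norm_add_le x y
    have := hx.norm_le
    have := hy.norm_le
    nlinarith
  have e3 : ‖F.cadd x y - (x' + y')‖ ≤ ‖F.cadd x y - (x + y)‖ + ‖x + y - (x' + y')‖ :=
    norm_sub_le_norm_sub_add_norm_sub _ _ _
  have e4 : ‖x + y - (x' + y')‖ ≤ k * u * (X + Y) := by
    have : x + y - (x' + y') = (x - x') + (y - y') := by ring
    rw [this]
    have := norm_add_le (x - x') (y - y')
    linarith [hx.1, hy.1]
  have e5 : u * ‖x + y‖ ≤ u * (2 * (X + Y)) := by gcongr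
  linarith

theorem csub (F : FloatArith u) {k : ℝ} (hu : u ≤ 1 / 10 ^ 6) (hk0 : 0 ≤ k) (hk : k ≤ 100)
    (hx : Approx (k * u) X x x') (hy : Approx (k * u) Y y y') :
    Approx ((k + 2) * u) (X + Y) (F.csub x y) (x' - y') := by
  have hy' : Approx (k * u) Y (-y) (-y') := by
    unfold Approx
    rw [← neg_sub', norm_neg, norm_neg]
    exact hy
  have e : F.csub x y = F.cadd x (-y) := by simp [FloatArith.csub, FloatArith.cadd, sub_eq_add_neg]
  rw [e, sub_eq_add_neg]
  exact hx.cadd F hu hk0 hk hy'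

end Approx

theorem Core.approx_unitize_c {g : Core} {e : ℝ} (hg : 0 < g.size) (h : g.Near e) :
    Approx e ‖g.unitize.c‖ g.c g.unitize.c := by
  refine ⟨?_, le_rfl⟩
  have : g.c - g.unitize.c = ((g.size - 1 : ℝ) : ℂ) * g.unitize.c := by
    push_cast
    rw [sub_mul, Core.size_mul_unitize_c hg, one_mul]
  rw [this, norm_mul, Complex.norm_real, Real.norm_eq_abs]
  exact mul_le_mul_of_nonneg_right h (norm_nonneg _)

theorem Core.approx_unitize_s {g : Core} {e : ℝ} (hg : 0 < g.size) (h : g.Near e) :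
    Approx e ‖g.unitize.s‖ g.s g.unitize.s := by
  refine ⟨?_, le_rfl⟩
  have : g.s - g.unitize.s = ((g.size - 1 : ℝ) : ℂ) * g.unitize.s := by
    push_cast
    rw [sub_mul, Core.size_mul_unitize_s hg, one_mul]
  rw [this, norm_mul, Complex.norm_real, Real.norm_eq_abs]
  exact mul_le_mul_of_nonneg_right h (norm_nonneg _)

/-! ### Rescaling -/

section MkCore

variable {u : ℝ} (F : FloatArith u)

theorem norm_cdiv_norm2_sub_le (hu : u ≤ 1 / 10 ^ 6) {x y : ℂ} (h : 0 < hyp x y) (z : ℂ) :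
    ‖F.cdiv z (F.norm2 x y) - z / (hyp x y : ℂ)‖ ≤ 5 * u * ‖z / (hyp x y : ℂ)‖ := by
  have h0 := F.u_nonneg
  have h1 := abs_le.1 (F.abs_norm2_sub_le (by linarith) x y)
  set H := hyp x y
  set R := F.norm2 x y
  have hR : 0 < R := by nlinarith
  have h2 := F.norm_cdiv_sub_le z R
  have hRc : (R : ℂ) ≠ 0 := by exact_mod_cast hR.ne'
  have hHc : (H : ℂ) ≠ 0 := by exact_mod_cast h.ne'
  have e1 : z / (R : ℂ) - z / (H : ℂ) = ((H - R) / R : ℝ) * (z / (H : ℂ)) := by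
    push_cast; field_simp
  have e2 : |(H - R) / R| ≤ 7 / 2 * u := by
    rw [abs_div, abs_of_pos hR, div_le_iff₀ hR, abs_le]
    constructor <;> nlinarith
  have e3 : ‖z / (R : ℂ) - z / (H : ℂ)‖ ≤ 7 / 2 * u * ‖z / (H : ℂ)‖ := by
    rw [e1, norm_mul, Complex.norm_real, Real.norm_eq_abs]
    gcongr
  have e4 : ‖z / (R : ℂ)‖ ≤ 5 / 4 * ‖z / (H : ℂ)‖ := by
    have := norm_le_norm_add_norm_sub' (z / (R : ℂ)) (z / (H : ℂ))
    nlinarith [norm_nonneg (z / (H : ℂ))]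
  have e5 := norm_sub_le_norm_sub_add_norm_sub (F.cdiv z R) (z / (R : ℂ)) (z / (H : ℂ))
  have e6 : u * ‖z / (R : ℂ)‖ ≤ u * (5 / 4 * ‖z / (H : ℂ)‖) := by gcongr
  have := mul_nonneg h0 (norm_nonneg (z / (H : ℂ)))
  linarith

theorem norm_mkCore_c_sub_le (hu : u ≤ 1 / 10 ^ 6) {x y : ℂ} (h : 0 < hyp x y) (d : ℤˣ) :
    ‖(mkCore F x y d).c - x / (hyp x y : ℂ)‖ ≤ 5 * u * ‖x / (hyp x y : ℂ)‖ :=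
  norm_cdiv_norm2_sub_le F hu h x

theorem norm_mkCore_s_sub_le (hu : u ≤ 1 / 10 ^ 6) {x y : ℂ} (h : 0 < hyp x y) (d : ℤˣ) :
    ‖(mkCore F x y d).s - y / (hyp x y : ℂ)‖ ≤ 5 * u * ‖y / (hyp x y : ℂ)‖ :=
  norm_cdiv_norm2_sub_le F hu h y

/-- Entrywise relative errors in a unit vector change its norm by at most the same amount. -/
theorem Core.near_of_relative {g : Core} {c s : ℂ} {e : ℝ} (he : e ≤ 1)
    (hcs : ‖c‖ ^ 2 + ‖s‖ ^ 2 = 1) (hc : ‖g.c - c‖ ≤ e * ‖c‖) (hs : ‖g.s - s‖ ≤ e * ‖s‖) :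
    g.Near e := by
  have he0 : 0 ≤ e := by
    by_contra hneg
    have h1 := norm_nonneg (g.c - c)
    have h2 := norm_nonneg (g.s - s)
    have h3 : ‖c‖ = 0 := by nlinarith [norm_nonneg c]
    have h4 : ‖s‖ = 0 := by nlinarith [norm_nonneg s]
    simp [h3, h4] at hcs
  have bd : ∀ a b : ℂ, ‖a - b‖ ≤ e * ‖b‖ → (1 - e) * ‖b‖ ≤ ‖a‖ ∧ ‖a‖ ≤ (1 + e) * ‖b‖ := by
    intro a b h
    have h1 := norm_le_norm_add_norm_sub' a b
    have h2 := norm_le_norm_add_norm_sub' b a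
    rw [norm_sub_rev] at h2
    constructor <;> linarith
  obtain ⟨c1, c2⟩ := bd _ _ hc
  obtain ⟨s1, s2⟩ := bd _ _ hs
  have hs := g.size_sq
  have h0 := g.size_nonneg
  have k1 : (1 - e) ^ 2 ≤ g.size ^ 2 := by
    have a1 := pow_le_pow_left₀ (mul_nonneg (by linarith) (norm_nonneg _)) c1 2
    have a2 := pow_le_pow_left₀ (mul_nonneg (by linarith) (norm_nonneg _)) s1 2
    rw [mul_pow] at a1 a2
    nlinarith
  have k2 : g.size ^ 2 ≤ (1 + e) ^ 2 := by
    have a1 := pow_le_pow_left₀ (norm_nonneg _) c2 2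
    have a2 := pow_le_pow_left₀ (norm_nonneg _) s2 2
    rw [mul_pow] at a1 a2
    nlinarith
  have k1' := abs_le_of_sq_le_sq' k1 h0
  have k2' := abs_le_of_sq_le_sq' k2 (by linarith)
  exact abs_le.2 ⟨by linarith [k1'.2], by linarith [k2'.2]⟩

theorem norm_div_hyp_sq {x y : ℂ} (h : 0 < hyp x y) :
    ‖x / (hyp x y : ℂ)‖ ^ 2 + ‖y / (hyp x y : ℂ)‖ ^ 2 = 1 := by
  rw [norm_div, norm_div, Complex.norm_real, Real.norm_eq_abs, abs_of_pos h, div_pow, div_pow,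
    ← add_div, ← hyp_sq, div_self (by positivity)]

theorem mkCore_near (hu : u ≤ 1 / 10 ^ 6) {x y : ℂ} (h : 0 < hyp x y) (d : ℤˣ) :
    (mkCore F x y d).Near (5 * u) :=
  Core.near_of_relative (by linarith) (norm_div_hyp_sq h) (norm_mkCore_c_sub_le F hu h d)
    (norm_mkCore_s_sub_le F hu h d)

theorem norm_div_size_sub_le (hu : u ≤ 1 / 10 ^ 6) {σ : ℝ} (hσ : |σ - 1| ≤ 5 * u) {z w : ℂ}
    (h : ‖z - w‖ ≤ 5 * u * ‖w‖) : ‖z / (σ : ℂ) - w‖ ≤ 11 * u * ‖w‖ := by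
  have hu0 : 0 ≤ u := by have := abs_nonneg (σ - 1); linarith
  obtain ⟨h1, h2⟩ := abs_le.1 hσ
  have hσ0 : 0 < σ := by linarith
  have hσc : (σ : ℂ) ≠ 0 := by exact_mod_cast hσ0.ne'
  have e : z / (σ : ℂ) - w = (z - w - ((σ - 1 : ℝ) : ℂ) * w) / (σ : ℂ) := by
    push_cast; field_simp; ring
  rw [e, norm_div, Complex.norm_real, Real.norm_eq_abs, abs_of_pos hσ0, div_le_iff₀ hσ0]
  have h3 : ‖((σ - 1 : ℝ) : ℂ) * w‖ ≤ 5 * u * ‖w‖ := by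
    rw [norm_mul, Complex.norm_real, Real.norm_eq_abs]; gcongr
  have h4 := norm_sub_le (z - w) (((σ - 1 : ℝ) : ℂ) * w)
  have := mul_nonneg hu0 (norm_nonneg w)
  nlinarith

/-- Scaling a computed core to be exactly unitary changes its entries by relative errors only. -/
theorem norm_unitize_mkCore_c_sub_le (hu : u ≤ 1 / 10 ^ 6) {x y : ℂ} (h : 0 < hyp x y) (d : ℤˣ) :
    ‖(mkCore F x y d).unitize.c - x / (hyp x y : ℂ)‖ ≤ 11 * u * ‖x / (hyp x y : ℂ)‖ :=
  norm_div_size_sub_le hu (mkCore_near F hu h d) (norm_mkCore_c_sub_le F hu h d)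

theorem norm_unitize_mkCore_s_sub_le (hu : u ≤ 1 / 10 ^ 6) {x y : ℂ} (h : 0 < hyp x y) (d : ℤˣ) :
    ‖(mkCore F x y d).unitize.s - y / (hyp x y : ℂ)‖ ≤ 11 * u * ‖y / (hyp x y : ℂ)‖ :=
  norm_div_size_sub_le hu (mkCore_near F hu h d) (norm_mkCore_s_sub_le F hu h d)

end MkCore


/-! ### The turnover of exactly unitary cores -/

theorem norm_entry_le {m : ℕ} (A : Matrix (Fin m) (Fin m) ℂ) (i j : Fin m) : ‖A i j‖ ≤ ‖A‖ := by
  have h := A.l2_opNorm_mulVec (EuclideanSpace.single j (1 : ℂ))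
  rw [PiLp.norm_single, norm_one, mul_one] at h
  refine le_trans ?_ h
  have h2 := PiLp.norm_apply_le ((EuclideanSpace.equiv (Fin m) ℂ).symm
    (A.mulVec (EuclideanSpace.single j (1 : ℂ)).ofLp)) i
  refine le_trans (le_of_eq ?_) h2
  simp

/-- The first entry in the first column of `g₁ * g₂ * h`. -/
noncomputable def colA (g₁ g₂ h : Core) : ℂ := g₁.c * h.c - g₁.sgn * (conj g₁.s * g₂.c * h.s)

/-- The second entry in the first column of `g₁ * g₂ * h`. -/
noncomputable def colB (g₁ g₂ h : Core) : ℂ := g₁.s * h.c + g₁.sgn * (conj g₁.c * g₂.c * h.s)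

/-- The third entry in the first column of `g₁ * g₂ * h`. -/
noncomputable def colC (g₂ h : Core) : ℂ := g₂.s * h.s

/-- The entry `c` of the last core of a turnover, in terms of the eliminating rotator `m`. -/
noncomputable def botC (g₁ g₂ m : Core) : ℂ :=
  conj m.c * g₂.c + g₁.sgn * (conj m.s * g₁.c * g₂.s)

/-- The entry `s` of the last core of a turnover, in terms of the eliminating rotator `m`. -/
noncomputable def botS (g₁ g₂ h m : Core) : ℂ :=
  m.s * g₁.s * conj h.s - g₁.sgn * (m.s * conj g₁.c * g₂.c * conj h.c) + m.c * g₂.s * conj h.c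

theorem Core.mul_conj_add {g : Core} (h : g.size = 1) : g.c * conj g.c + g.s * conj g.s = 1 := by
  rw [Complex.mul_conj, Complex.mul_conj, Complex.normSq_eq_norm_sq, Complex.normSq_eq_norm_sq]
  have := g.size_sq
  rw [h] at this
  exact_mod_cast this.symm.trans (one_pow 2)

theorem Core.det_three_zero {g : Core} (h : g.size = 1) : (g.toMatrix 3 0).det = g.sgn := by
  rw [toMatrix_three_zero, Matrix.det_fin_three]
  simp
  linear_combination g.sgn * mul_conj_add h

theorem Core.det_three_one {g : Core} (h : g.size = 1) : (g.toMatrix 3 1).det = g.sgn := by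
  rw [toMatrix_three_one, Matrix.det_fin_three]
  simp
  linear_combination g.sgn * mul_conj_add h

/-- The product that the last core of a turnover has to equal, given the other two. -/
noncomputable def turnoverResidual (g₁ g₂ h m a : Core) : Matrix (Fin 3) (Fin 3) ℂ :=
  (m.toMatrix 3 1 * a.toMatrix 3 0)ᴴ * (g₁.toMatrix 3 0 * g₂.toMatrix 3 1 * h.toMatrix 3 0)

section

variable {g₁ g₂ h m a : Core} {η : ℝ}

theorem turnoverResidual_unitary (h1 : g₁.size = 1) (h2 : g₂.size = 1) (hh : h.size = 1)
    (hm : m.size = 1) (ha : a.size = 1) :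
    turnoverResidual g₁ g₂ h m a ∈ Matrix.unitaryGroup (Fin 3) ℂ :=
  mul_mem (conjTranspose_mem_unitaryGroup (mul_mem (Core.toMatrix_unitary hm (by norm_num))
    (Core.toMatrix_unitary ha (by norm_num))))
    (mul_mem (mul_mem (Core.toMatrix_unitary h1 (by norm_num))
      (Core.toMatrix_unitary h2 (by norm_num))) (Core.toMatrix_unitary hh (by norm_num)))

theorem turnoverResidual_det (h1 : g₁.size = 1) (h2 : g₂.size = 1) (hh : h.size = 1)
    (hm : m.size = 1) (ha : a.size = 1) (hhs : h.sgn = 1) (hms : m.sgn = 1)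
    (has : a.sgn = g₁.sgn) : (turnoverResidual g₁ g₂ h m a).det = g₂.sgn := by
  rw [turnoverResidual, Matrix.det_mul, Matrix.det_conjTranspose, Matrix.det_mul, Matrix.det_mul,
    Matrix.det_mul, Core.det_three_one hm, Core.det_three_zero ha, Core.det_three_zero h1,
    Core.det_three_one h2, Core.det_three_zero hh, hhs, hms, has]
  simp
  linear_combination g₂.sgn * g₁.sgn_mul_self

/-- Beyond its first column, the last row of the residual does not involve `a`: it is given by `botS`
and `botC`, which are therefore what the last core of the turnover has to reproduce. -/
theorem turnoverResidual_two_one (hhs : h.sgn = 1) (hms : m.sgn = 1) :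
    turnoverResidual g₁ g₂ h m a 2 1 = botS g₁ g₂ h m := by
  rw [turnoverResidual, Core.toMatrix_three_one, Core.toMatrix_three_zero,
    Core.toMatrix_three_zero, Core.toMatrix_three_one, Core.toMatrix_three_zero, hhs, hms]
  simp [Matrix.mul_apply, Fin.sum_univ_three, botS]
  ring

theorem turnoverResidual_two_two (hms : m.sgn = 1) :
    turnoverResidual g₁ g₂ h m a 2 2 = g₂.sgn * conj (botC g₁ g₂ m) := by
  rw [turnoverResidual, Core.toMatrix_three_one, Core.toMatrix_three_zero,
    Core.toMatrix_three_zero, Core.toMatrix_three_one, Core.toMatrix_three_zero, hms]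
  simp [Matrix.mul_apply, Fin.sum_univ_three, botC]
  ring

/-- If the first two cores of a turnover reproduce the first column of the product, then the first
column of the residual is close to the first unit vector. -/
theorem norm_turnoverResidual_col_sub_le (hm : m.size = 1) (ha : a.size = 1)
    (hA : ‖colA g₁ g₂ h - a.c‖ ≤ η) (hB : ‖colB g₁ g₂ h - m.c * a.s‖ ≤ η)
    (hC : ‖colC g₂ h - m.s * a.s‖ ≤ η) (i : Fin 3) :
    ‖turnoverResidual g₁ g₂ h m a i 0 - (1 : Matrix (Fin 3) (Fin 3) ℂ) i 0‖ ≤ 3 * η := by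
  have hZ : m.toMatrix 3 1 * a.toMatrix 3 0 ∈ Matrix.unitaryGroup (Fin 3) ℂ :=
    mul_mem (Core.toMatrix_unitary hm (by norm_num)) (Core.toMatrix_unitary ha (by norm_num))
  have c0 : ∀ k, (m.toMatrix 3 1 * a.toMatrix 3 0) k 0 = ![a.c, m.c * a.s, m.s * a.s] k := by
    intro k
    rw [Core.toMatrix_three_one, Core.toMatrix_three_zero]
    fin_cases k <;> simp [Matrix.mul_apply, Fin.sum_univ_three]
  have c1 : ∀ k, (g₁.toMatrix 3 0 * g₂.toMatrix 3 1 * h.toMatrix 3 0) k 0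
      = ![colA g₁ g₂ h, colB g₁ g₂ h, colC g₂ h] k := by
    intro k
    rw [Core.toMatrix_three_zero, Core.toMatrix_three_one, Core.toMatrix_three_zero]
    fin_cases k <;> simp [Matrix.mul_apply, Fin.sum_univ_three, colA, colB, colC] <;> ring
  unfold turnoverResidual
  set Z := m.toMatrix 3 1 * a.toMatrix 3 0
  set T := g₁.toMatrix 3 0 * g₂.toMatrix 3 1 * h.toMatrix 3 0
  have e : (Zᴴ * T) i 0 - (1 : Matrix (Fin 3) (Fin 3) ℂ) i 0 = ∑ k, conj (Z k i) * (T k 0 - Z k 0) := by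
    rw [← conjTranspose_mul_self_of_unitary hZ, ← Matrix.sub_apply, ← Matrix.mul_sub,
      Matrix.mul_apply]
    rfl
  rw [e]
  have hz : ∀ k, ‖conj (Z k i)‖ ≤ 1 := fun k => by
    rw [RCLike.norm_conj]; exact entry_norm_bound_of_unitary hZ k i
  refine (norm_sum_le _ _).trans ?_
  have hT : ∀ k, ‖T k 0 - Z k 0‖ ≤ η := by
    intro k
    rw [c0, c1]
    fin_cases k
    · simpa using hA
    · simpa using hB
    · simpa using hC
  calc ∑ k, ‖conj (Z k i) * (T k 0 - Z k 0)‖ ≤ ∑ _k : Fin 3, η := by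
        refine Finset.sum_le_sum fun k _ => ?_
        rw [norm_mul]
        have := mul_le_mul (hz k) (hT k) (norm_nonneg _) zero_le_one
        linarith
    _ = 3 * η := by simp

/-- The last row of the residual is a unit vector whose first entry is small. -/
theorem norm_botC_sq_add (h1 : g₁.size = 1) (h2 : g₂.size = 1) (hh : h.size = 1)
    (hm : m.size = 1) (ha : a.size = 1) (hhs : h.sgn = 1) (hms : m.sgn = 1)
    (hA : ‖colA g₁ g₂ h - a.c‖ ≤ η) (hB : ‖colB g₁ g₂ h - m.c * a.s‖ ≤ η)
    (hC : ‖colC g₂ h - m.s * a.s‖ ≤ η) :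
    1 - (3 * η) ^ 2 ≤ hyp (botC g₁ g₂ m) (botS g₁ g₂ h m) ^ 2 ∧
      hyp (botC g₁ g₂ m) (botS g₁ g₂ h m) ^ 2 ≤ 1 := by
  have hW := turnoverResidual_unitary h1 h2 hh hm ha
  have e := norm_turnoverResidual_col_sub_le hm ha hA hB hC 2
  have e1 : (turnoverResidual g₁ g₂ h m a * (turnoverResidual g₁ g₂ h m a)ᴴ) 2 2 = 1 := by
    rw [mul_conjTranspose_self_of_unitary hW]; simp
  rw [Matrix.mul_apply, Fin.sum_univ_three] at e1
  simp only [Matrix.conjTranspose_apply, RCLike.star_def, Complex.mul_conj,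
    Complex.normSq_eq_norm_sq] at e1
  rw [turnoverResidual_two_one hhs hms, turnoverResidual_two_two hms, norm_mul, Core.norm_sgn,
    RCLike.norm_conj, one_mul] at e1
  have e2 : ‖turnoverResidual g₁ g₂ h m a 2 0‖ ^ 2 + ‖botS g₁ g₂ h m‖ ^ 2 + ‖botC g₁ g₂ m‖ ^ 2 = 1 := by
    exact_mod_cast e1
  have e3 : ‖turnoverResidual g₁ g₂ h m a 2 0‖ ≤ 3 * η := by simpa using e
  rw [hyp_sq]
  have := pow_le_pow_left₀ (norm_nonneg _) e3 2
  constructor <;> nlinarith [sq_nonneg ‖turnoverResidual g₁ g₂ h m a 2 0‖]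

/-- A special unitary matrix of order three is determined, stably, by its first column and the rest
of its last row: its remaining entries are conjugate cofactors. -/
theorem norm_sub_core_le_of_unitary {W : Matrix (Fin 3) (Fin 3) ℂ} {b : Core}
    (hW : W ∈ Matrix.unitaryGroup (Fin 3) ℂ) (hdet : W.det = b.sgn)
    (hcol : ∀ i, ‖W i 0 - (1 : Matrix (Fin 3) (Fin 3) ℂ) i 0‖ ≤ 3 * η)
    (hs : ‖W 2 1 - b.s‖ ≤ η) (hc : ‖W 2 2 - b.sgn * conj b.c‖ ≤ η) :
    ‖W - b.toMatrix 3 1‖ ≤ 40 * η := by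
  have hent := fun i j => entry_norm_bound_of_unitary hW i j
  have hadj : W.adjugate = b.sgn • Wᴴ := by
    calc W.adjugate = Wᴴ * W * W.adjugate := by
          rw [conjTranspose_mul_self_of_unitary hW, Matrix.one_mul]
      _ = _ := by rw [Matrix.mul_assoc, Matrix.mul_adjugate, hdet]; simp
  have h0 := hcol 0
  have h1 := hcol 1
  have h2 := hcol 2
  simp at h0 h1 h2
  have hadj' : ∀ i j, W i j = b.sgn * conj (W.adjugate j i) := by
    intro i j
    rw [hadj]
    simp [← mul_assoc]
  have pr : ∀ x y : ℂ, ∀ p q : ℝ, ‖x‖ ≤ p → ‖y‖ ≤ q → ‖x * y‖ ≤ p * q := fun x y p q hx hy => by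
    rw [norm_mul]; exact mul_le_mul hx hy (norm_nonneg _) ((norm_nonneg _).trans hx)
  have hη : 0 ≤ η := (norm_nonneg _).trans hs
  have h01 : ‖W 0 1‖ ≤ 6 * η := by
    rw [hadj' 0 1, norm_mul, Core.norm_sgn, RCLike.norm_conj, one_mul, Matrix.adjugate_fin_three]
    simp
    have k1 := pr _ _ _ _ h1 (hent 2 2)
    have k2 := pr _ _ _ _ (hent 1 2) h2
    refine (norm_add_le _ _).trans ?_
    rw [norm_neg]
    linarith
  have h02 : ‖W 0 2‖ ≤ 6 * η := by
    rw [hadj' 0 2, norm_mul, Core.norm_sgn, RCLike.norm_conj, one_mul, Matrix.adjugate_fin_three]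
    simp
    have k1 := pr _ _ _ _ h1 (hent 2 1)
    have k2 := pr _ _ _ _ (hent 1 1) h2
    refine (norm_sub_le _ _).trans ?_
    linarith
  have h11 : ‖W 1 1 - b.c‖ ≤ 7 * η := by
    have e : W 1 1 - b.c = b.sgn * conj ((W 0 0 - 1) * W 2 2 + (W 2 2 - b.sgn * conj b.c)
        - W 0 2 * W 2 0) := by
      rw [hadj' 1 1, Matrix.adjugate_fin_three]
      simp
      linear_combination b.c * b.sgn_mul_self
    rw [e, norm_mul, Core.norm_sgn, RCLike.norm_conj, one_mul]
    have k1 := pr _ _ _ _ h0 (hent 2 2)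
    have k2 := pr _ _ _ _ (hent 0 2) h2
    have k3 := norm_sub_le ((W 0 0 - 1) * W 2 2 + (W 2 2 - b.sgn * conj b.c)) (W 0 2 * W 2 0)
    have k4 := norm_add_le ((W 0 0 - 1) * W 2 2) (W 2 2 - b.sgn * conj b.c)
    linarith
  have h12 : ‖W 1 2 - -(b.sgn * conj b.s)‖ ≤ 7 * η := by
    have e : W 1 2 - -(b.sgn * conj b.s) = b.sgn * conj (-((W 0 0 - 1) * W 2 1) - (W 2 1 - b.s)
        + W 0 1 * W 2 0) := by
      rw [hadj' 1 2, Matrix.adjugate_fin_three]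
      simp
      ring
    rw [e, norm_mul, Core.norm_sgn, RCLike.norm_conj, one_mul]
    have k1 := pr _ _ _ _ h0 (hent 2 1)
    have k2 := pr _ _ _ _ (hent 0 1) h2
    have k3 := norm_add_le (-((W 0 0 - 1) * W 2 1) - (W 2 1 - b.s)) (W 0 1 * W 2 0)
    have k4 := norm_sub_le (-((W 0 0 - 1) * W 2 1)) (W 2 1 - b.s)
    rw [norm_neg] at k4
    linarith
  refine (norm_le_sum_entries _).trans ?_
  rw [Core.toMatrix_three_one]
  simp only [Fin.sum_univ_three]
  simp [- neg_add_rev, - sub_neg_eq_add]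
  linarith

/-- Backward stability of a turnover, for exactly unitary cores: it is enough that the new cores
reproduce the first column of the product and the last row of the residual. -/
theorem norm_turnover_sub_le {b : Core} (h1 : g₁.size = 1) (h2 : g₂.size = 1) (hh : h.size = 1)
    (hm : m.size = 1) (ha : a.size = 1) (hhs : h.sgn = 1) (hms : m.sgn = 1)
    (has : a.sgn = g₁.sgn) (hbs : b.sgn = g₂.sgn)
    (hA : ‖colA g₁ g₂ h - a.c‖ ≤ η) (hB : ‖colB g₁ g₂ h - m.c * a.s‖ ≤ η)
    (hC : ‖colC g₂ h - m.s * a.s‖ ≤ η)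
    (hc : ‖botC g₁ g₂ m - b.c‖ ≤ η) (hs : ‖botS g₁ g₂ h m - b.s‖ ≤ η) :
    ‖g₁.toMatrix 3 0 * g₂.toMatrix 3 1 * h.toMatrix 3 0
      - m.toMatrix 3 1 * a.toMatrix 3 0 * b.toMatrix 3 1‖ ≤ 40 * η := by
  have hZ : m.toMatrix 3 1 * a.toMatrix 3 0 ∈ Matrix.unitaryGroup (Fin 3) ℂ :=
    mul_mem (Core.toMatrix_unitary hm (by norm_num)) (Core.toMatrix_unitary ha (by norm_num))
  have e : g₁.toMatrix 3 0 * g₂.toMatrix 3 1 * h.toMatrix 3 0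
      - m.toMatrix 3 1 * a.toMatrix 3 0 * b.toMatrix 3 1
      = m.toMatrix 3 1 * a.toMatrix 3 0 * (turnoverResidual g₁ g₂ h m a - b.toMatrix 3 1) := by
    rw [turnoverResidual, Matrix.mul_sub, ← Matrix.mul_assoc (m.toMatrix 3 1 * a.toMatrix 3 0),
      mul_conjTranspose_self_of_unitary hZ, Matrix.one_mul]
  rw [e, norm_unitary_mul hZ]
  refine norm_sub_core_le_of_unitary (turnoverResidual_unitary h1 h2 hh hm ha)
    (by rw [turnoverResidual_det h1 h2 hh hm ha hhs hms has, hbs])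
    (norm_turnoverResidual_col_sub_le hm ha hA hB hC) ?_ ?_
  · rwa [turnoverResidual_two_one hhs hms]
  · rw [turnoverResidual_two_two hms, hbs, ← mul_sub, norm_mul, Core.norm_sgn, one_mul, ← map_sub,
      RCLike.norm_conj]
    exact hc

end


/-! ### The computed turnover -/

section Turnover

variable {u : ℝ} (F : FloatArith u)

/-- The computed first entry in the first column of `G₁ * G₂ * H`. -/
noncomputable def flColA (G₁ G₂ H : Core) : ℂ :=
  F.csub (F.cmul G₁.c H.c) (G₁.sgn * F.cmul (F.cmul (conj G₁.s) G₂.c) H.s)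

/-- The computed second entry in the first column of `G₁ * G₂ * H`. -/
noncomputable def flColB (G₁ G₂ H : Core) : ℂ :=
  F.cadd (F.cmul G₁.s H.c) (G₁.sgn * F.cmul (F.cmul (conj G₁.c) G₂.c) H.s)

/-- The computed third entry in the first column of `G₁ * G₂ * H`. -/
noncomputable def flColC (G₂ H : Core) : ℂ := F.cmul G₂.s H.s

variable {G₁ G₂ H : Core}

include F in
theorem Core.Near.size_pos {g : Core} {k : ℝ} (hu : u ≤ 1 / 10 ^ 6) (hk : k ≤ 100)
    (h : g.Near (k * u)) : 0 < g.size := by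
  have := h.ge
  have := F.u_nonneg
  nlinarith

theorem Core.norm_c_le_one {g : Core} (h : g.size = 1) : ‖g.c‖ ≤ 1 := h ▸ g.norm_c_le

theorem Core.norm_s_le_one {g : Core} (h : g.size = 1) : ‖g.s‖ ≤ 1 := h ▸ g.norm_s_le

theorem approx_flColA (hu : u ≤ 1 / 10 ^ 6) (h1 : G₁.Near (20 * u)) (h2 : G₂.Near (20 * u))
    (hh : H.Near (20 * u)) :
    Approx (76 * u) (‖G₁.unitize.c‖ * ‖H.unitize.c‖
      + ‖G₁.unitize.s‖ * ‖G₂.unitize.c‖ * ‖H.unitize.s‖)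
      (flColA F G₁ G₂ H) (colA G₁.unitize G₂.unitize H.unitize) := by
  have h0 := F.u_nonneg
  have p1 := h1.size_pos F hu (by norm_num)
  have p2 := h2.size_pos F hu (by norm_num)
  have ph := hh.size_pos F hu (by norm_num)
  have e1 := (Core.approx_unitize_c p1 h1).cmul F hu (by norm_num) (by norm_num) (by norm_num)
    (by norm_num) (Core.approx_unitize_c ph hh)
  have e2 := (((Core.approx_unitize_s p1 h1).map_conj.cmul F hu (by norm_num) (by norm_num)
    (by norm_num) (by norm_num) (Core.approx_unitize_c p2 h2)).cmul F hu (by norm_num)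
    (by norm_num) (by norm_num) (by norm_num) (Core.approx_unitize_s ph hh)).sgn_mul G₁
  have e3 := (e1.mono (by nlinarith : _ ≤ 74 * u)).csub F hu (by norm_num) (by norm_num)
    (e2.mono (by nlinarith))
  exact e3.mono (by nlinarith)

theorem approx_flColB (hu : u ≤ 1 / 10 ^ 6) (h1 : G₁.Near (20 * u)) (h2 : G₂.Near (20 * u))
    (hh : H.Near (20 * u)) :
    Approx (76 * u) (‖G₁.unitize.s‖ * ‖H.unitize.c‖
      + ‖G₁.unitize.c‖ * ‖G₂.unitize.c‖ * ‖H.unitize.s‖)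
      (flColB F G₁ G₂ H) (colB G₁.unitize G₂.unitize H.unitize) := by
  have h0 := F.u_nonneg
  have p1 := h1.size_pos F hu (by norm_num)
  have p2 := h2.size_pos F hu (by norm_num)
  have ph := hh.size_pos F hu (by norm_num)
  have e1 := (Core.approx_unitize_s p1 h1).cmul F hu (by norm_num) (by norm_num) (by norm_num)
    (by norm_num) (Core.approx_unitize_c ph hh)
  have e2 := (((Core.approx_unitize_c p1 h1).map_conj.cmul F hu (by norm_num) (by norm_num)
    (by norm_num) (by norm_num) (Core.approx_unitize_c p2 h2)).cmul F hu (by norm_num)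
    (by norm_num) (by norm_num) (by norm_num) (Core.approx_unitize_s ph hh)).sgn_mul G₁
  have e3 := (e1.mono (by nlinarith : _ ≤ 74 * u)).cadd F hu (by norm_num) (by norm_num)
    (e2.mono (by nlinarith))
  exact e3.mono (by nlinarith)

theorem approx_flColC (hu : u ≤ 1 / 10 ^ 6) (h2 : G₂.Near (20 * u)) (hh : H.Near (20 * u)) :
    Approx (47 * u) (‖G₂.unitize.s‖ * ‖H.unitize.s‖)
      (flColC F G₂ H) (colC G₂.unitize H.unitize) :=
  ((Core.approx_unitize_s (h2.size_pos F hu (by norm_num)) h2).cmul F hu (by norm_num)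
    (by norm_num) (by norm_num) (by norm_num)
    (Core.approx_unitize_s (hh.size_pos F hu (by norm_num)) hh)).mono (by linarith)

theorem norm_flColA_sub_le (hu : u ≤ 1 / 10 ^ 6) (h1 : G₁.Near (20 * u)) (h2 : G₂.Near (20 * u))
    (hh : H.Near (20 * u)) :
    ‖flColA F G₁ G₂ H - colA G₁.unitize G₂.unitize H.unitize‖ ≤ 152 * u := by
  have e := (approx_flColA F hu h1 h2 hh).1
  have h0 := F.u_nonneg
  have s1 := Core.size_unitize (h1.size_pos F hu (by norm_num))
  have s2 := Core.size_unitize (h2.size_pos F hu (by norm_num))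
  have sh := Core.size_unitize (hh.size_pos F hu (by norm_num))
  have k1 := mul_le_one₀ (Core.norm_c_le_one s1) (norm_nonneg _) (Core.norm_c_le_one sh)
  have k2 := mul_le_one₀ (mul_le_one₀ (Core.norm_s_le_one s1) (norm_nonneg _)
    (Core.norm_c_le_one s2)) (norm_nonneg _) (Core.norm_s_le_one sh)
  nlinarith

theorem norm_flColB_sub_le (hu : u ≤ 1 / 10 ^ 6) (h1 : G₁.Near (20 * u)) (h2 : G₂.Near (20 * u))
    (hh : H.Near (20 * u)) :
    ‖flColB F G₁ G₂ H - colB G₁.unitize G₂.unitize H.unitize‖ ≤ 152 * u := by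
  have e := (approx_flColB F hu h1 h2 hh).1
  have h0 := F.u_nonneg
  have s1 := Core.size_unitize (h1.size_pos F hu (by norm_num))
  have s2 := Core.size_unitize (h2.size_pos F hu (by norm_num))
  have sh := Core.size_unitize (hh.size_pos F hu (by norm_num))
  have k1 := mul_le_one₀ (Core.norm_s_le_one s1) (norm_nonneg _) (Core.norm_c_le_one sh)
  have k2 := mul_le_one₀ (mul_le_one₀ (Core.norm_c_le_one s1) (norm_nonneg _)
    (Core.norm_c_le_one s2)) (norm_nonneg _) (Core.norm_s_le_one sh)
  nlinarith

theorem norm_flColC_sub_le (hu : u ≤ 1 / 10 ^ 6) (h2 : G₂.Near (20 * u)) (hh : H.Near (20 * u)) :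
    ‖flColC F G₂ H - colC G₂.unitize H.unitize‖ ≤ 47 * u := by
  have e := (approx_flColC F hu h2 hh).1
  have h0 := F.u_nonneg
  have s2 := Core.size_unitize (h2.size_pos F hu (by norm_num))
  have sh := Core.size_unitize (hh.size_pos F hu (by norm_num))
  have k1 := mul_le_one₀ (Core.norm_s_le_one s2) (norm_nonneg _) (Core.norm_s_le_one sh)
  nlinarith

theorem col_norm_sq {g₁ g₂ h : Core} (h1 : g₁.size = 1) (h2 : g₂.size = 1) (hh : h.size = 1) :
    ‖colA g₁ g₂ h‖ ^ 2 + (‖colB g₁ g₂ h‖ ^ 2 + ‖colC g₂ h‖ ^ 2) = 1 := by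
  have e1 := Core.mul_conj_add h1
  have e2 := Core.mul_conj_add h2
  have eh := Core.mul_conj_add hh
  have : (colA g₁ g₂ h * conj (colA g₁ g₂ h) + (colB g₁ g₂ h * conj (colB g₁ g₂ h)
      + colC g₂ h * conj (colC g₂ h)) : ℂ) = 1 := by
    simp only [colA, colB, colC, map_add, map_sub, map_mul, Complex.conj_conj, Core.conj_sgn]
    linear_combination (h.c * conj h.c + g₁.sgn * g₁.sgn * g₂.c * conj g₂.c * h.s * conj h.s) * e1
      + g₂.c * conj g₂.c * h.s * conj h.s * g₁.sgn_mul_self + h.s * conj h.s * e2 + eh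
  rw [Complex.mul_conj, Complex.mul_conj, Complex.mul_conj, Complex.normSq_eq_norm_sq,
    Complex.normSq_eq_norm_sq, Complex.normSq_eq_norm_sq] at this
  exact_mod_cast this

theorem norm_ofReal_hyp (x y : ℂ) : ‖((hyp x y : ℝ) : ℂ)‖ = hyp x y := by
  rw [Complex.norm_real, Real.norm_eq_abs, abs_of_nonneg (hyp_nonneg _ _)]

theorem hyp_col {g₁ g₂ h : Core} (h1 : g₁.size = 1) (h2 : g₂.size = 1) (hh : h.size = 1) :
    hyp (colA g₁ g₂ h) ((hyp (colB g₁ g₂ h) (colC g₂ h) : ℝ) : ℂ) = 1 := by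
  rw [hyp, norm_ofReal_hyp, hyp_sq, col_norm_sq h1 h2 hh, Real.sqrt_one]

/-- The computed first column is a unit vector up to rounding. -/
theorem abs_hyp_flCol_sub_one_le (hu : u ≤ 1 / 10 ^ 6) (h1 : G₁.Near (20 * u))
    (h2 : G₂.Near (20 * u)) (hh : H.Near (20 * u)) :
    |hyp (flColA F G₁ G₂ H) ((F.norm2 (flColB F G₁ G₂ H) (flColC F G₂ H) : ℝ) : ℂ) - 1|
      ≤ 360 * u := by
  have h0 := F.u_nonneg
  have s1 := Core.size_unitize (h1.size_pos F hu (by norm_num))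
  have s2 := Core.size_unitize (h2.size_pos F hu (by norm_num))
  have sh := Core.size_unitize (hh.size_pos F hu (by norm_num))
  have eA := norm_flColA_sub_le F hu h1 h2 hh
  have eB := norm_flColB_sub_le F hu h1 h2 hh
  have eC := norm_flColC_sub_le F hu h2 hh
  have hc := hyp_col s1 s2 sh
  have hsq := col_norm_sq s1 s2 sh
  set A := colA G₁.unitize G₂.unitize H.unitize
  set B := colB G₁.unitize G₂.unitize H.unitize
  set C := colC G₂.unitize H.unitize
  have n1 := abs_hyp_sub_hyp_le (flColB F G₁ G₂ H) (flColC F G₂ H) B C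
  have n2 := F.abs_norm2_sub_le (by linarith) (flColB F G₁ G₂ H) (flColC F G₂ H)
  have n3 := abs_hyp_sub_hyp_le (flColA F G₁ G₂ H)
    ((F.norm2 (flColB F G₁ G₂ H) (flColC F G₂ H) : ℝ) : ℂ) A ((hyp B C : ℝ) : ℂ)
  rw [hc, ← Complex.ofReal_sub, Complex.norm_real, Real.norm_eq_abs] at n3
  have hBC : hyp B C ≤ 1 := by
    exact Real.sqrt_le_iff.2 ⟨zero_le_one, by nlinarith [sq_nonneg ‖A‖]⟩
  set R := F.norm2 (flColB F G₁ G₂ H) (flColC F G₂ H)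
  set N := hyp (flColB F G₁ G₂ H) (flColC F G₂ H)
  have n4 := abs_sub_le R N (hyp B C)
  have n5 : N ≤ 11 / 10 := by
    have := (abs_le.1 n1).2; linarith
  have n6 : 3 * u * N ≤ 3 * u * (11 / 10) := by gcongr
  linarith

/-- The core used to eliminate the second and third entries of the computed column, and the core
that eliminates what is left, reproduce the first column of the exact product. -/
theorem turnover_column {M : Core} (hu : u ≤ 1 / 10 ^ 6) (h1 : G₁.Near (20 * u))
    (h2 : G₂.Near (20 * u)) (hh : H.Near (20 * u)) (d : ℤˣ)
    (hMc : ‖M.c * (hyp (flColB F G₁ G₂ H) (flColC F G₂ H) : ℂ) - flColB F G₁ G₂ H‖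
      ≤ 11 * u * ‖flColB F G₁ G₂ H‖)
    (hMs : ‖M.s * (hyp (flColB F G₁ G₂ H) (flColC F G₂ H) : ℂ) - flColC F G₂ H‖
      ≤ 11 * u * ‖flColC F G₂ H‖) (hM : M.size = 1) :
    let a := mkCore F (flColA F G₁ G₂ H) (F.norm2 (flColB F G₁ G₂ H) (flColC F G₂ H) : ℂ) d
    a.Near (5 * u) ∧
      ‖a.unitize.s - (hyp (flColB F G₁ G₂ H) (flColC F G₂ H) : ℂ)‖
        ≤ 400 * u * hyp (flColB F G₁ G₂ H) (flColC F G₂ H) ∧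
      ‖a.s - (hyp (flColB F G₁ G₂ H) (flColC F G₂ H) : ℂ)‖
        ≤ 400 * u * hyp (flColB F G₁ G₂ H) (flColC F G₂ H) ∧
      ‖colA G₁.unitize G₂.unitize H.unitize - a.unitize.c‖ ≤ 600 * u ∧
      ‖colB G₁.unitize G₂.unitize H.unitize - M.c * a.unitize.s‖ ≤ 600 * u ∧
      ‖colC G₂.unitize H.unitize - M.s * a.unitize.s‖ ≤ 600 * u := by
  have h0 := F.u_nonneg
  have eA := norm_flColA_sub_le F hu h1 h2 hh
  have eB := norm_flColB_sub_le F hu h1 h2 hh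
  have eC := norm_flColC_sub_le F hu h2 hh
  have eN := abs_hyp_flCol_sub_one_le F hu h1 h2 hh
  have n2 := F.abs_norm2_sub_le (by linarith) (flColB F G₁ G₂ H) (flColC F G₂ H)
  have hMc1 := Core.norm_c_le_one hM
  have hMs1 := Core.norm_s_le_one hM
  have bB := norm_le_hyp_left (flColB F G₁ G₂ H) (flColC F G₂ H)
  have bC := norm_le_hyp_right (flColB F G₁ G₂ H) (flColC F G₂ H)
  have bN := hyp_nonneg (flColB F G₁ G₂ H) (flColC F G₂ H)
  set A := colA G₁.unitize G₂.unitize H.unitize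
  set B := colB G₁.unitize G₂.unitize H.unitize
  set C := colC G₂.unitize H.unitize
  set N := hyp (flColB F G₁ G₂ H) (flColC F G₂ H)
  set R := F.norm2 (flColB F G₁ G₂ H) (flColC F G₂ H)
  set wA := flColA F G₁ G₂ H
  set wB := flColB F G₁ G₂ H
  set wC := flColC F G₂ H
  set N₁ := hyp wA (R : ℂ)
  obtain ⟨l1, l2⟩ := abs_le.1 eN
  have hN1 : 0 < N₁ := by linarith
  have hN1c : (N₁ : ℂ) ≠ 0 := by exact_mod_cast hN1.ne'
  intro a
  -- division by a number close to one
  have hdiv : ∀ z : ℂ, ‖z / (N₁ : ℂ) - z‖ ≤ 362 * u * ‖z‖ := by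
    intro z
    have e : z / (N₁ : ℂ) - z = ((1 - N₁ : ℝ) : ℂ) * z / (N₁ : ℂ) := by
      push_cast; field_simp
    rw [e, norm_div, norm_mul, Complex.norm_real, Complex.norm_real, Real.norm_eq_abs,
      Real.norm_eq_abs, abs_of_pos hN1, div_le_iff₀ hN1, abs_sub_comm]
    have : |N₁ - 1| ≤ 362 * u * N₁ := by nlinarith
    nlinarith [norm_nonneg z]
  have hdiv' : ∀ z w : ℂ, ‖w - z / (N₁ : ℂ)‖ ≤ 11 * u * ‖z / (N₁ : ℂ)‖ →
      ‖w - z‖ ≤ 375 * u * ‖z‖ := by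
    intro z w h
    have k1 := hdiv z
    have k2 : ‖z / (N₁ : ℂ)‖ ≤ 11 / 10 * ‖z‖ := by
      have := norm_le_norm_add_norm_sub' (z / (N₁ : ℂ)) z
      nlinarith [norm_nonneg z]
    have k3 := norm_sub_le_norm_sub_add_norm_sub w (z / (N₁ : ℂ)) z
    have k4 : 11 * u * ‖z / (N₁ : ℂ)‖ ≤ 11 * u * (11 / 10 * ‖z‖) := by gcongr
    nlinarith [mul_nonneg h0 (norm_nonneg z)]
  have hRN : ‖(R : ℂ) - (N : ℂ)‖ ≤ 3 * u * N := by
    rw [← Complex.ofReal_sub, Complex.norm_real]; exact n2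
  have hRn : ‖(R : ℂ)‖ ≤ 101 / 100 * N := by
    have k := norm_le_norm_add_norm_sub' (R : ℂ) (N : ℂ)
    rw [norm_ofReal_hyp] at k
    nlinarith
  have hsN : ∀ w : ℂ, ‖w - (R : ℂ)‖ ≤ 375 * u * ‖(R : ℂ)‖ → ‖w - (N : ℂ)‖ ≤ 400 * u * N := by
    intro w h
    have k := norm_sub_le_norm_sub_add_norm_sub w (R : ℂ) (N : ℂ)
    nlinarith [mul_nonneg h0 bN]
  have as := hsN _ (hdiv' (R : ℂ) a.unitize.s (norm_unitize_mkCore_s_sub_le F hu hN1 d))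
  have as' := hsN a.s (hdiv' (R : ℂ) a.s ((norm_mkCore_s_sub_le F hu hN1 d).trans
    (by gcongr; norm_num)))
  have ac := hdiv' wA a.unitize.c (norm_unitize_mkCore_c_sub_le F hu hN1 d)
  have small : ∀ (z w z' : ℂ) (y : ℝ), y ≤ 152 → ‖z - z'‖ ≤ y * u → ‖w * (N : ℂ) - z‖ ≤ 11 * u * ‖z‖ →
      ‖w‖ ≤ 1 → ‖z‖ ≤ N → N ≤ 101 / 100 → ‖z' - w * a.unitize.s‖ ≤ 600 * u := by
    intro z w z' y hy k1 k2 k3 k4 k5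
    have e : z' - w * a.unitize.s = (z' - z) - (w * (N : ℂ) - z) - w * (a.unitize.s - (N : ℂ)) := by
      ring
    rw [e]
    have m1 := norm_sub_le ((z' - z) - (w * (N : ℂ) - z)) (w * (a.unitize.s - (N : ℂ)))
    have m2 := norm_sub_le (z' - z) (w * (N : ℂ) - z)
    have m3 : ‖w * (a.unitize.s - (N : ℂ))‖ ≤ 1 * (400 * u * N) := by
      rw [norm_mul]; exact mul_le_mul k3 as (norm_nonneg _) zero_le_one
    rw [norm_sub_rev z' z] at m2
    have m4 : 11 * u * ‖z‖ ≤ 11 * u * (101 / 100) := by gcongr; linarith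
    have m5 : 1 * (400 * u * N) ≤ 400 * u * (101 / 100) := by rw [one_mul]; gcongr
    have m6 : y * u ≤ 152 * u := by gcongr
    linarith
  have hN11 : N ≤ 101 / 100 := by
    have k := norm_le_hyp_right wA (R : ℂ)
    have k2 : N ≤ ‖(R : ℂ)‖ + 3 * u * N := by
      have k := norm_le_norm_add_norm_sub (R : ℂ) (N : ℂ)
      rw [norm_ofReal_hyp] at k
      linarith
    have k3 : ‖(R : ℂ)‖ ≤ N₁ := k
    nlinarith
  refine ⟨mkCore_near F hu hN1 d, as, as', ?_, ?_, ?_⟩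
  · have k := norm_sub_le_norm_sub_add_norm_sub A wA a.unitize.c
    have k' : ‖A - wA‖ = ‖wA - A‖ := norm_sub_rev _ _
    have k'' : ‖wA - a.unitize.c‖ = ‖a.unitize.c - wA‖ := norm_sub_rev _ _
    have k2 : ‖wA‖ ≤ 11 / 10 := (norm_le_hyp_left wA (R : ℂ)).trans (by linarith)
    have k3 : 375 * u * ‖wA‖ ≤ 375 * u * (11 / 10) := by gcongr
    linarith
  · exact small wB M.c B 152 le_rfl eB hMc hMc1 bB (by linarith)
  · exact small wC M.s C 47 (by norm_num) eC hMs hMs1 bC (by linarith)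

end Turnover


/-! ### The last core of a turnover -/

section Turnover

variable {u : ℝ} (F : FloatArith u) {G₁ G₂ H : Core}

theorem Core.unitize_sgn_eq_one {g : Core} (hd : g.d = 1) : g.unitize.sgn = 1 := by
  rw [Core.unitize_sgn, Core.sgn, hd]; simp

/-- The exact value of the last `s` in a turnover is close to `g₁.s * g₂.s / N`, where `N` is the
norm of the last two entries of the computed column, *relative to one*, even when `N` is tiny and
has no correct digit: the error in these entries is small relative to `|g₁.s h.c| + |h.s|`, and
`|g₂.s| * (|g₁.s h.c| + |h.s|)` is bounded by a multiple of `N`. -/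
theorem norm_hyp_mul_botS_sub_le {m : Core} (hu : u ≤ 1 / 10 ^ 6) (h1 : G₁.Near (20 * u))
    (h2 : G₂.Near (20 * u)) (hh : H.Near (20 * u))
    (hmc : ‖m.c * (hyp (flColB F G₁ G₂ H) (flColC F G₂ H) : ℂ) - flColB F G₁ G₂ H‖
      ≤ 11 * u * ‖flColB F G₁ G₂ H‖)
    (hms : ‖m.s * (hyp (flColB F G₁ G₂ H) (flColC F G₂ H) : ℂ) - flColC F G₂ H‖
      ≤ 11 * u * ‖flColC F G₂ H‖) :
    ‖(hyp (flColB F G₁ G₂ H) (flColC F G₂ H) : ℂ) * botS G₁.unitize G₂.unitize H.unitize m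
      - G₁.unitize.s * G₂.unitize.s‖ ≤ 420 * u * hyp (flColB F G₁ G₂ H) (flColC F G₂ H) := by
  have h0 := F.u_nonneg
  have s1 := Core.size_unitize (h1.size_pos F hu (by norm_num))
  have s2 := Core.size_unitize (h2.size_pos F hu (by norm_num))
  have sh := Core.size_unitize (hh.size_pos F hu (by norm_num))
  have eB := approx_flColB F hu h1 h2 hh
  have eC := approx_flColC F hu h2 hh
  have bB := norm_le_hyp_left (flColB F G₁ G₂ H) (flColC F G₂ H)
  have bC := norm_le_hyp_right (flColB F G₁ G₂ H) (flColC F G₂ H)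
  have bN := hyp_nonneg (flColB F G₁ G₂ H) (flColC F G₂ H)
  set N := hyp (flColB F G₁ G₂ H) (flColC F G₂ H)
  set wB := flColB F G₁ G₂ H
  set wC := flColC F G₂ H
  set g₁ := G₁.unitize
  set g₂ := G₂.unitize
  set h := H.unitize
  have id : (N : ℂ) * botS g₁ g₂ h m - g₁.s * g₂.s
      = (m.s * N - colC g₂ h) * (g₁.s * conj h.s - g₁.sgn * (conj g₁.c * g₂.c * conj h.c))
        + (m.c * N - colB g₁ g₂ h) * (g₂.s * conj h.c) := by
    unfold botS colB colC
    linear_combination (g₁.s * g₂.s) * Core.mul_conj_add sh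
  have c1 := Core.norm_c_le_one s1
  have c2 := Core.norm_c_le_one s2
  have ch := Core.norm_c_le_one sh
  have t1 := Core.norm_s_le_one s1
  have t2 := Core.norm_s_le_one s2
  have th := Core.norm_s_le_one sh
  have b1 : ‖g₁.s * conj h.s - g₁.sgn * (conj g₁.c * g₂.c * conj h.c)‖ ≤ 2 := by
    refine (norm_sub_le _ _).trans ?_
    simp only [norm_mul, Core.norm_sgn, RCLike.norm_conj, one_mul]
    have := mul_le_one₀ t1 (norm_nonneg _) th
    have := mul_le_one₀ (mul_le_one₀ c1 (norm_nonneg _) c2) (norm_nonneg _) ch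
    linarith
  have b2 : ‖g₂.s * conj h.c‖ ≤ ‖g₂.s‖ := by
    rw [norm_mul, RCLike.norm_conj]
    exact mul_le_of_le_one_right (norm_nonneg _) ch
  have hS1 : ‖g₁.s‖ * ‖h.c‖ ≤ ‖colB g₁ g₂ h‖ + ‖h.s‖ := by
    have e : g₁.s * h.c = colB g₁ g₂ h - g₁.sgn * (conj g₁.c * g₂.c * h.s) := by unfold colB; ring
    rw [← norm_mul, e]
    refine (norm_sub_le _ _).trans ?_
    simp only [norm_mul, Core.norm_sgn, RCLike.norm_conj, one_mul]
    have := mul_le_of_le_one_left (norm_nonneg h.s) (mul_le_one₀ c1 (norm_nonneg _) c2)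
    linarith
  have hX2 : ‖g₁.s‖ * ‖h.c‖ + ‖g₁.c‖ * ‖g₂.c‖ * ‖h.s‖ ≤ ‖g₁.s‖ * ‖h.c‖ + ‖h.s‖ := by
    have := mul_le_of_le_one_left (norm_nonneg h.s) (mul_le_one₀ c1 (norm_nonneg _) c2)
    linarith
  set S := ‖g₁.s‖ * ‖h.c‖
  set X := S + ‖g₁.c‖ * ‖g₂.c‖ * ‖h.s‖
  set T := ‖g₂.s‖
  set σ := ‖h.s‖
  have hX0 : 0 ≤ X := eB.nonneg
  have hσ0 : 0 ≤ σ := norm_nonneg _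
  have hS0 : 0 ≤ S := by positivity
  have hT0 : 0 ≤ T := norm_nonneg _
  have hTσ0 : 0 ≤ T * σ := mul_nonneg hT0 hσ0
  have hTS0 : 0 ≤ T * S := mul_nonneg hT0 hS0
  have nB : ‖wB‖ ≤ 101 / 100 * X := by have := eB.norm_le; nlinarith
  have nC : ‖wC‖ ≤ 101 / 100 * (T * σ) := by have := eC.norm_le; nlinarith
  have dC : ‖m.s * N - colC g₂ h‖ ≤ 59 * u * (T * σ) := by
    have k := norm_sub_le_norm_sub_add_norm_sub (m.s * N) wC (colC g₂ h)
    have k2 := eC.1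
    have k3 : 11 * u * ‖wC‖ ≤ 11 * u * (101 / 100 * (T * σ)) := by gcongr
    nlinarith [mul_nonneg h0 hTσ0]
  have dB : ‖m.c * N - colB g₁ g₂ h‖ ≤ 88 * u * (S + σ) := by
    have k := norm_sub_le_norm_sub_add_norm_sub (m.c * N) wB (colB g₁ g₂ h)
    have k2 := eB.1
    have k3 : 11 * u * ‖wB‖ ≤ 11 * u * (101 / 100 * X) := by gcongr
    have k4 : 88 * u * X ≤ 88 * u * (S + σ) := by gcongr
    nlinarith [mul_nonneg h0 hX0]
  have hTσ : T * σ ≤ 101 / 100 * N := by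
    -- `|wC|` has a small relative error and is at most `N`
    have k : ‖colC g₂ h‖ ≤ ‖wC‖ + ‖wC - colC g₂ h‖ := by
      have := norm_le_norm_add_norm_sub' (colC g₂ h) wC
      rwa [norm_sub_rev] at this
    have k1 : ‖colC g₂ h‖ = T * σ := norm_mul _ _
    have k2 := eC.1
    nlinarith
  have hTS : T * S ≤ 21 / 10 * N := by
    have k : ‖colB g₁ g₂ h‖ ≤ ‖wB‖ + ‖wB - colB g₁ g₂ h‖ := by
      have := norm_le_norm_add_norm_sub' (colB g₁ g₂ h) wB
      rwa [norm_sub_rev] at this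
    have k2 := eB.1
    have k3 : 76 * u * X ≤ 76 * u * (S + σ) := by gcongr
    have k4 : S ≤ N + 76 * u * (S + σ) + σ := by linarith
    have k5 : T * S ≤ T * (N + 76 * u * (S + σ) + σ) := by gcongr
    have k6 : T * N ≤ N := mul_le_of_le_one_left bN t2
    have k7 : T * (N + 76 * u * (S + σ) + σ)
        = T * N + 76 * u * (T * S) + 76 * u * (T * σ) + T * σ := by ring
    have k8 : 76 * u * (T * S) ≤ 1 / 1000 * (T * S) := by gcongr; linarith
    have k9 : 76 * u * (T * σ) ≤ 1 / 1000 * (T * σ) := by gcongr; linarith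
    clear_value S X T σ N
    linarith
  rw [id]
  refine (norm_add_le _ _).trans ?_
  rw [norm_mul, norm_mul]
  have f1 : ‖m.s * N - colC g₂ h‖ * ‖g₁.s * conj h.s - g₁.sgn * (conj g₁.c * g₂.c * conj h.c)‖
      ≤ 59 * u * (T * σ) * 2 := by gcongr
  have f2 : ‖m.c * N - colB g₁ g₂ h‖ * ‖g₂.s * conj h.c‖ ≤ 88 * u * (S + σ) * T := by gcongr
  have f6 : 88 * u * (S + σ) * T = 88 * u * (T * S) + 88 * u * (T * σ) := by ring
  have f7 : 59 * u * (T * σ) * 2 = 118 * u * (T * σ) := by ring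
  have f3 : 118 * u * (T * σ) ≤ 118 * u * (101 / 100 * N) := by gcongr
  have f4 : 88 * u * (T * S) ≤ 88 * u * (21 / 10 * N) := by gcongr
  have f5 : 88 * u * (T * σ) ≤ 88 * u * (101 / 100 * N) := by gcongr
  have f8 := mul_nonneg h0 bN
  rw [f6] at f2
  rw [f7] at f1
  linarith

/-- Rescaling the computed last core of a turnover. -/
theorem turnover_last {g₁ g₂ h m a : Core} (hu : u ≤ 1 / 10 ^ 6) (h1 : g₁.size = 1)
    (h2 : g₂.size = 1) (hh : h.size = 1)
    (hm : m.size = 1) (ha : a.size = 1) (hhs : h.sgn = 1) (hms : m.sgn = 1)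
    (hA : ‖colA g₁ g₂ h - a.c‖ ≤ 600 * u) (hB : ‖colB g₁ g₂ h - m.c * a.s‖ ≤ 600 * u)
    (hC : ‖colC g₂ h - m.s * a.s‖ ≤ 600 * u) {p q : ℂ} (hp : ‖p - botC g₁ g₂ m‖ ≤ 2000 * u)
    (hq : ‖q - botS g₁ g₂ h m‖ ≤ 2000 * u) (d : ℤˣ) :
    (mkCore F p q d).Near (5 * u) ∧
      ‖botC g₁ g₂ m - (mkCore F p q d).unitize.c‖ ≤ 6100 * u ∧
      ‖botS g₁ g₂ h m - (mkCore F p q d).unitize.s‖ ≤ 6100 * u ∧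
      ‖(mkCore F p q d).s - q‖ ≤ 4100 * u * ‖q‖ := by
  have h0 := F.u_nonneg
  obtain ⟨e1, e2⟩ := norm_botC_sq_add h1 h2 hh hm ha hhs hms hA hB hC
  set C := botC g₁ g₂ m
  set S := botS g₁ g₂ h m
  have n0 := hyp_nonneg C S
  have n1 : hyp C S ≤ 1 := by nlinarith
  have n2 : 1 - 4 * u ≤ hyp C S := by nlinarith
  have n3 := abs_le.1 (abs_hyp_sub_hyp_le p q C S)
  set N := hyp p q
  have hNl : 1 - 4004 * u ≤ N := by linarith [n3.1]
  have hNr : N ≤ 1 + 4000 * u := by linarith [n3.2]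
  have hN : 0 < N := by linarith
  have hNc : (N : ℂ) ≠ 0 := by exact_mod_cast hN.ne'
  have hdiv : ∀ z : ℂ, ‖z / (N : ℂ) - z‖ ≤ 4040 * u * ‖z‖ := by
    intro z
    have e : z / (N : ℂ) - z = ((1 - N : ℝ) : ℂ) * z / (N : ℂ) := by
      push_cast; field_simp
    rw [e, norm_div, norm_mul, Complex.norm_real, Complex.norm_real, Real.norm_eq_abs,
      Real.norm_eq_abs, abs_of_pos hN, div_le_iff₀ hN]
    have : |1 - N| ≤ 4040 * u * N := abs_le.2 ⟨by nlinarith, by nlinarith⟩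
    nlinarith [norm_nonneg z]
  have hdiv' : ∀ z w : ℂ, ‖w - z / (N : ℂ)‖ ≤ 11 * u * ‖z / (N : ℂ)‖ →
      ‖w - z‖ ≤ 4060 * u * ‖z‖ := by
    intro z w h
    have k1 := hdiv z
    have k2 : ‖z / (N : ℂ)‖ ≤ 11 / 10 * ‖z‖ := by
      have := norm_le_norm_add_norm_sub' (z / (N : ℂ)) z
      nlinarith [norm_nonneg z]
    have k3 := norm_sub_le_norm_sub_add_norm_sub w (z / (N : ℂ)) z
    have k4 : 11 * u * ‖z / (N : ℂ)‖ ≤ 11 * u * (11 / 10 * ‖z‖) := by gcongr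
    nlinarith [mul_nonneg h0 (norm_nonneg z)]
  have hfin : ∀ z w z' : ℂ, ‖w - z‖ ≤ 4060 * u * ‖z‖ → ‖z - z'‖ ≤ 2000 * u → ‖z‖ ≤ N →
      ‖z' - w‖ ≤ 6100 * u := by
    intro z w z' k1 k2 k3
    have k := norm_sub_le_norm_sub_add_norm_sub w z z'
    rw [norm_sub_rev z' w]
    have : 4060 * u * ‖z‖ ≤ 4060 * u * (1 + 4000 * u) := by gcongr; linarith
    nlinarith
  refine ⟨mkCore_near F hu hN d, ?_, ?_, ?_⟩
  · exact hfin p _ C (hdiv' p _ (norm_unitize_mkCore_c_sub_le F hu hN d)) hp (norm_le_hyp_left p q)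
  · exact hfin q _ S (hdiv' q _ (norm_unitize_mkCore_s_sub_le F hu hN d)) hq (norm_le_hyp_right p q)
  · have := hdiv' q (mkCore F p q d).s ((norm_mkCore_s_sub_le F hu hN d).trans
      (by gcongr; norm_num))
    nlinarith [mul_nonneg h0 (norm_nonneg q)]

/-- What a computed turnover `(M, G₁', G₂')` of `G₁`, `G₂`, `H` achieves: cores that are unitary up
to rounding, backward stability, and a product of the numbers `s` that is preserved to high relative
accuracy. -/
structure TurnoverSpec (u : ℝ) (G₁ G₂ H : Core) (t : Core × Core × Core) : Prop where
  near_fst : t.1.Near (5 * u)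
  near_snd : t.2.1.Near (5 * u)
  near_thd : t.2.2.Near (5 * u)
  d_fst : t.1.d = 1
  d_snd : t.2.1.d = G₁.d
  d_thd : t.2.2.d = G₂.d
  err : ‖G₁.toMatrix 3 0 * G₂.toMatrix 3 1 * H.unitize.toMatrix 3 0
    - t.1.unitize.toMatrix 3 1 * t.2.1.toMatrix 3 0 * t.2.2.toMatrix 3 1‖ ≤ 3 * 10 ^ 5 * u
  s_mul_s : G₁.s ≠ 0 → G₂.s ≠ 0 → ‖t.2.1.s * t.2.2.s - G₁.s * G₂.s‖ ≤ 5000 * u * ‖G₁.s * G₂.s‖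

theorem norm_mul_sub_mul_le {m : ℕ} (A B A' B' : Matrix (Fin m) (Fin m) ℂ) :
    ‖A * B - A' * B'‖ ≤ ‖A - A'‖ * ‖B‖ + ‖A'‖ * ‖B - B'‖ := by
  have e : A * B - A' * B' = (A - A') * B + A' * (B - B') := by
    rw [Matrix.sub_mul, Matrix.mul_sub]; abel
  rw [e]
  exact (norm_add_le _ _).trans (add_le_add (Matrix.l2_opNorm_mul _ _) (Matrix.l2_opNorm_mul _ _))

include F in
/-- The error of a turnover in terms of the stored cores, from that of the unitary ones. -/
theorem norm_turnover_stored_sub_le {M a b : Core} (hu : u ≤ 1 / 10 ^ 6)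
    (h1 : G₁.Near (20 * u)) (h2 : G₂.Near (20 * u)) (hh : H.Near (20 * u))
    (hM : M.Near (5 * u)) (ha : a.Near (5 * u)) (hb : b.Near (5 * u))
    (h : ‖G₁.unitize.toMatrix 3 0 * G₂.unitize.toMatrix 3 1 * H.unitize.toMatrix 3 0
      - M.unitize.toMatrix 3 1 * a.unitize.toMatrix 3 0 * b.unitize.toMatrix 3 1‖
      ≤ 40 * (6100 * u)) :
    ‖G₁.toMatrix 3 0 * G₂.toMatrix 3 1 * H.unitize.toMatrix 3 0
      - M.unitize.toMatrix 3 1 * a.toMatrix 3 0 * b.toMatrix 3 1‖ ≤ 3 * 10 ^ 5 * u := by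
  have h0 := F.u_nonneg
  have p1 := h1.size_pos F hu (by norm_num)
  have p2 := h2.size_pos F hu (by norm_num)
  have ph := hh.size_pos F hu (by norm_num)
  have pM := hM.size_pos F hu (by norm_num)
  have pa := ha.size_pos F hu (by norm_num)
  have pb := hb.size_pos F hu (by norm_num)
  have k1 := (Core.norm_toMatrix_sub_unitize p1 (m := 3) (i := 0) (by norm_num)).trans h1
  have k2 := (Core.norm_toMatrix_sub_unitize p2 (m := 3) (i := 1) (by norm_num)).trans h2
  have ka := (Core.norm_toMatrix_sub_unitize pa (m := 3) (i := 0) (by norm_num)).trans ha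
  have kb := (Core.norm_toMatrix_sub_unitize pb (m := 3) (i := 1) (by norm_num)).trans hb
  have n2 := Core.norm_toMatrix_le p2 h2 (m := 3) (i := 1) (by norm_num)
  have nb := Core.norm_toMatrix_le pb hb (m := 3) (i := 1) (by norm_num)
  have n1 := norm_le_one_of_unitary (Core.unitize_toMatrix_unitary p1 (m := 3) (i := 0) (by norm_num))
  have na := norm_le_one_of_unitary (Core.unitize_toMatrix_unitary pa (m := 3) (i := 0) (by norm_num))
  have uH := Core.unitize_toMatrix_unitary ph (m := 3) (i := 0) (by norm_num)
  have uM := Core.unitize_toMatrix_unitary pM (m := 3) (i := 1) (by norm_num)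
  have e1 : ‖G₁.toMatrix 3 0 * G₂.toMatrix 3 1 * H.unitize.toMatrix 3 0
      - G₁.unitize.toMatrix 3 0 * G₂.unitize.toMatrix 3 1 * H.unitize.toMatrix 3 0‖ ≤ 50 * u := by
    rw [← Matrix.sub_mul, norm_mul_unitary uH]
    refine (norm_mul_sub_mul_le _ _ _ _).trans ?_
    calc _ ≤ (20 * u) * (1 + 20 * u) + 1 * (20 * u) := by gcongr
      _ ≤ _ := by nlinarith
  have e2 : ‖M.unitize.toMatrix 3 1 * a.unitize.toMatrix 3 0 * b.unitize.toMatrix 3 1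
      - M.unitize.toMatrix 3 1 * a.toMatrix 3 0 * b.toMatrix 3 1‖ ≤ 20 * u := by
    rw [Matrix.mul_assoc, Matrix.mul_assoc, ← Matrix.mul_sub, norm_unitary_mul uM, norm_sub_rev]
    refine (norm_mul_sub_mul_le _ _ _ _).trans ?_
    calc _ ≤ (5 * u) * (1 + 5 * u) + 1 * (5 * u) := by gcongr
      _ ≤ _ := by nlinarith
  have t1 := norm_sub_le_norm_sub_add_norm_sub
    (G₁.toMatrix 3 0 * G₂.toMatrix 3 1 * H.unitize.toMatrix 3 0)
    (G₁.unitize.toMatrix 3 0 * G₂.unitize.toMatrix 3 1 * H.unitize.toMatrix 3 0)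
    (M.unitize.toMatrix 3 1 * a.toMatrix 3 0 * b.toMatrix 3 1)
  have t2 := norm_sub_le_norm_sub_add_norm_sub
    (G₁.unitize.toMatrix 3 0 * G₂.unitize.toMatrix 3 1 * H.unitize.toMatrix 3 0)
    (M.unitize.toMatrix 3 1 * a.unitize.toMatrix 3 0 * b.unitize.toMatrix 3 1)
    (M.unitize.toMatrix 3 1 * a.toMatrix 3 0 * b.toMatrix 3 1)
  linarith

/-- The parts of `TurnoverSpec` that do not concern the product of the numbers `s`, for any
eliminating rotator and any last core close to the exact one. -/
theorem turnover_assemble {M : Core} (hu : u ≤ 1 / 10 ^ 6)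
    (h1 : G₁.Near (20 * u)) (h2 : G₂.Near (20 * u)) (hh : H.Near (20 * u)) (hd : H.d = 1)
    (hM : M.Near (5 * u)) (hMd : M.d = 1)
    (hMc : ‖M.unitize.c * (hyp (flColB F G₁ G₂ H) (flColC F G₂ H) : ℂ) - flColB F G₁ G₂ H‖
      ≤ 11 * u * ‖flColB F G₁ G₂ H‖)
    (hMs : ‖M.unitize.s * (hyp (flColB F G₁ G₂ H) (flColC F G₂ H) : ℂ) - flColC F G₂ H‖
      ≤ 11 * u * ‖flColC F G₂ H‖) {p q : ℂ}
    (hp : ‖p - botC G₁.unitize G₂.unitize M.unitize‖ ≤ 2000 * u)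
    (hq : ‖q - botS G₁.unitize G₂.unitize H.unitize M.unitize‖ ≤ 2000 * u)
    (hprod : ‖(mkCore F p q G₂.d).s - q‖ ≤ 4100 * u * ‖q‖ → G₁.s ≠ 0 → G₂.s ≠ 0 →
      ‖(mkCore F (flColA F G₁ G₂ H) (F.norm2 (flColB F G₁ G₂ H) (flColC F G₂ H) : ℂ) G₁.d).s
        * (mkCore F p q G₂.d).s - G₁.s * G₂.s‖ ≤ 5000 * u * ‖G₁.s * G₂.s‖) :
    TurnoverSpec u G₁ G₂ H
      (M, mkCore F (flColA F G₁ G₂ H) (F.norm2 (flColB F G₁ G₂ H) (flColC F G₂ H) : ℂ) G₁.d,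
        mkCore F p q G₂.d) := by
  have s1 := Core.size_unitize (h1.size_pos F hu (by norm_num))
  have s2 := Core.size_unitize (h2.size_pos F hu (by norm_num))
  have sh := Core.size_unitize (hh.size_pos F hu (by norm_num))
  have sM := Core.size_unitize (hM.size_pos F hu (by norm_num))
  have hhs := Core.unitize_sgn_eq_one hd
  have hMs' := Core.unitize_sgn_eq_one hMd
  obtain ⟨na, -, -, hA, hB, hC⟩ := turnover_column F hu h1 h2 hh G₁.d hMc hMs sM
  have sa := Core.size_unitize (na.size_pos F hu (by norm_num))
  obtain ⟨nb, hbc, hbs, hbq⟩ := turnover_last F hu s1 s2 sh sM sa hhs hMs' hA hB hC hp hq G₂.d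
  have h0 := F.u_nonneg
  refine ⟨hM, na, nb, hMd, rfl, rfl, ?_, hprod hbq⟩
  refine norm_turnover_stored_sub_le F hu h1 h2 hh hM na nb ?_
  exact norm_turnover_sub_le s1 s2 sh sM sa hhs hMs' rfl rfl (hA.trans (by nlinarith))
    (hB.trans (by nlinarith)) (hC.trans (by nlinarith)) hbc hbs

/-- A quotient by `σ`, multiplied back by `σ`, has a small relative error. Applied to the last core
of a turnover, this is what preserves the product of the numbers `s`. -/
theorem norm_quotient_mul_sub_le {σ : ℝ} {X q : ℂ} (hσ : 0 < σ)
    (hq : ‖q - X / (σ : ℂ)‖ ≤ u * ‖X / (σ : ℂ)‖) : ‖q * (σ : ℂ) - X‖ ≤ u * ‖X‖ := by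
  have hσc : (σ : ℂ) ≠ 0 := by exact_mod_cast hσ.ne'
  have e : q * (σ : ℂ) - X = (q - X / (σ : ℂ)) * (σ : ℂ) := by field_simp
  rw [e, norm_mul, Complex.norm_real, Real.norm_eq_abs, abs_of_pos hσ]
  rw [norm_div, Complex.norm_real, Real.norm_eq_abs, abs_of_pos hσ] at hq
  calc _ ≤ u * (‖X‖ / σ) * σ := by gcongr
    _ = _ := by field_simp

/-- The computed quotient `q` of `X` by `σ` is close to `t` if `X` approximates `s`, `σ`
approximates `N`, and `s` is close to `N * t`. -/
theorem norm_quotient_sub_le {N σ : ℝ} {X s q t : ℂ} (h0 : 0 ≤ u) (hu : u ≤ 1 / 10 ^ 6)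
    (hN : 0 < N) (hσ : |σ - N| ≤ 400 * u * N) (hX : ‖X - s‖ ≤ 47 * u * ‖s‖)
    (hq : ‖q - X / (σ : ℂ)‖ ≤ u * ‖X / (σ : ℂ)‖) (hkey : ‖(N : ℂ) * t - s‖ ≤ 420 * u * N)
    (ht : ‖t‖ ≤ 1) : ‖q - t‖ ≤ 2000 * u := by
  obtain ⟨hσ1, hσ2⟩ := abs_le.1 hσ
  have hNn : ‖(N : ℂ)‖ = N := by rw [Complex.norm_real, Real.norm_eq_abs, abs_of_pos hN]
  have huN : u * N ≤ 1 / 10 ^ 6 * N := by gcongr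
  have hus : u * ‖s‖ ≤ 1 / 10 ^ 6 * ‖s‖ := by gcongr
  have huX : u * ‖X‖ ≤ 1 / 10 ^ 6 * ‖X‖ := by gcongr
  have hus0 := mul_nonneg h0 (norm_nonneg s)
  have hσN : 99 / 100 * N ≤ σ := by linarith
  have hσ0 : 0 < σ := by linarith
  have hqσ := norm_quotient_mul_sub_le hσ0 hq
  have hXs : ‖X‖ ≤ 1001 / 1000 * ‖s‖ := by
    have := norm_le_norm_add_norm_sub' X s
    have := norm_nonneg s
    linarith
  have hqσn : ‖q‖ * σ ≤ 1001 / 1000 * ‖X‖ := by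
    have k := norm_le_norm_add_norm_sub' (q * (σ : ℂ)) X
    rw [norm_mul, Complex.norm_real, Real.norm_eq_abs, abs_of_pos hσ0] at k
    have := norm_nonneg X
    linarith
  have hqN : ‖q‖ * N ≤ 103 / 100 * ‖s‖ := by
    have : ‖q‖ * (99 / 100 * N) ≤ ‖q‖ * σ := by gcongr
    have := norm_nonneg s
    linarith
  have hqNs : ‖q * (N : ℂ) - s‖ ≤ 470 * u * ‖s‖ := by
    have e : q * (N : ℂ) - s = (q * (σ : ℂ) - X) + (X - s) - q * ((σ - N : ℝ) : ℂ) := by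
      push_cast; ring
    rw [e]
    have k1 := norm_sub_le ((q * (σ : ℂ) - X) + (X - s)) (q * ((σ - N : ℝ) : ℂ))
    have k2 := norm_add_le (q * (σ : ℂ) - X) (X - s)
    have k3 : ‖q * ((σ - N : ℝ) : ℂ)‖ ≤ 400 * u * (103 / 100 * ‖s‖) := by
      rw [norm_mul, Complex.norm_real, Real.norm_eq_abs]
      calc _ ≤ ‖q‖ * (400 * u * N) := by gcongr
        _ = 400 * u * (‖q‖ * N) := by ring
        _ ≤ _ := by gcongr
    have k4 : u * ‖X‖ ≤ u * (1001 / 1000 * ‖s‖) := by gcongr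
    linarith
  have hsN : ‖s‖ ≤ 101 / 100 * N := by
    have k := norm_le_norm_add_norm_sub ((N : ℂ) * t) s
    rw [norm_mul, hNn] at k
    have : N * ‖t‖ ≤ N := mul_le_of_le_one_right hN.le ht
    linarith
  have k := norm_sub_le (q * (N : ℂ) - s) ((N : ℂ) * t - s)
  have e : q * (N : ℂ) - s - ((N : ℂ) * t - s) = (N : ℂ) * (q - t) := by ring
  rw [e, norm_mul, hNn] at k
  have k2 : 470 * u * ‖s‖ ≤ 470 * u * (101 / 100 * N) := by gcongr
  have k3 : N * ‖q - t‖ ≤ N * (2000 * u) := by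
    have := mul_nonneg h0 hN.le
    linarith
  exact le_of_mul_le_mul_left k3 hN

/-- Dividing `X ≈ P` by `σ`, perturbing the quotient, and multiplying by `σ` gives `P` back. -/
theorem norm_mul_quotient_sub_le {σ : ℝ} {X P q b : ℂ} (h0 : 0 ≤ u) (hu : u ≤ 1 / 10 ^ 6)
    (hσ : 0 < σ) (hX : ‖X - P‖ ≤ 5 * u * ‖P‖) (hq : ‖q - X / (σ : ℂ)‖ ≤ u * ‖X / (σ : ℂ)‖)
    (hb : ‖b - q‖ ≤ 4100 * u * ‖q‖) : ‖(σ : ℂ) * b - P‖ ≤ 5000 * u * ‖P‖ := by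
  have huP : u * ‖P‖ ≤ 1 / 10 ^ 6 * ‖P‖ := by gcongr
  have huX : u * ‖X‖ ≤ 1 / 10 ^ 6 * ‖X‖ := by gcongr
  have huP0 := mul_nonneg h0 (norm_nonneg P)
  have hqσ := norm_quotient_mul_sub_le hσ hq
  have hXP : ‖X‖ ≤ 1001 / 1000 * ‖P‖ := by
    have := norm_le_norm_add_norm_sub' X P
    have := norm_nonneg P
    linarith
  have hqσn : ‖q‖ * σ ≤ 1001 / 1000 * ‖X‖ := by
    have k := norm_le_norm_add_norm_sub' (q * (σ : ℂ)) X
    rw [norm_mul, Complex.norm_real, Real.norm_eq_abs, abs_of_pos hσ] at k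
    have := norm_nonneg X
    linarith
  have e : (σ : ℂ) * b - P = (σ : ℂ) * (b - q) + (q * (σ : ℂ) - X) + (X - P) := by ring
  rw [e]
  have k1 := norm_add₃_le (a := (σ : ℂ) * (b - q)) (b := q * (σ : ℂ) - X) (c := X - P)
  have k2 : ‖(σ : ℂ) * (b - q)‖ ≤ 4100 * u * (1001 / 1000 * (1001 / 1000 * ‖P‖)) := by
    rw [norm_mul, Complex.norm_real, Real.norm_eq_abs, abs_of_pos hσ]
    calc _ ≤ σ * (4100 * u * ‖q‖) := by gcongr
      _ = 4100 * u * (‖q‖ * σ) := by ring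
      _ ≤ 4100 * u * (1001 / 1000 * ‖X‖) := by gcongr
      _ ≤ _ := by gcongr
  have k3 : u * ‖X‖ ≤ u * (1001 / 1000 * ‖P‖) := by gcongr
  linarith

/-- The last entry of the first column vanishes in floating-point arithmetic only if it does
exactly. -/
theorem flColC_eq_zero_iff (hu : u ≤ 1 / 10 ^ 6) : flColC F G₂ H = 0 ↔ G₂.s = 0 ∨ H.s = 0 := by
  have h0 := F.u_nonneg
  have e := F.norm_cmul_sub_le (by linarith) G₂.s H.s
  rw [← norm_mul] at e
  rw [← mul_eq_zero]
  constructor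
  · intro h
    rw [flColC] at h
    rw [h, zero_sub, norm_neg] at e
    have := norm_nonneg (G₂.s * H.s)
    exact norm_eq_zero.1 (by nlinarith)
  · intro h
    rw [h] at e
    simpa [flColC] using e

theorem norm2_eq_zero_iff (hu : u ≤ 1 / 10 ^ 6) (x y : ℂ) : F.norm2 x y = 0 ↔ x = 0 ∧ y = 0 := by
  have h0 := F.u_nonneg
  have e := abs_le.1 (F.abs_norm2_sub_le (by linarith) x y)
  constructor
  · intro h
    by_contra hne
    rw [not_and_or] at hne
    have := hyp_pos hne
    rw [h] at e
    nlinarith [e.1]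
  · rintro ⟨rfl, rfl⟩
    have : hyp 0 0 = 0 := by simp [hyp]
    rw [this] at e
    linarith [e.1, e.2]

/-- The generic turnover, in which the first column has something to eliminate. One of the two new
`s` is computed as a quotient by the other, which is where the accuracy of the quotient relative to
one is needed. -/
theorem turnover_spec_of_ne (hu : u ≤ 1 / 10 ^ 6)
    (h1 : G₁.Near (20 * u)) (h2 : G₂.Near (20 * u)) (hh : H.Near (20 * u)) (hd : H.d = 1)
    (hr : F.norm2 (flColB F G₁ G₂ H) (flColC F G₂ H) ≠ 0) :
    TurnoverSpec u G₁ G₂ H (turnover F G₁ G₂ H) := by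
  have h0 := F.u_nonneg
  have hN : 0 < hyp (flColB F G₁ G₂ H) (flColC F G₂ H) :=
    hyp_pos (by rw [Ne, norm2_eq_zero_iff F hu, not_and_or] at hr; exact hr)
  have hNc : (hyp (flColB F G₁ G₂ H) (flColC F G₂ H) : ℂ) ≠ 0 := by exact_mod_cast hN.ne'
  have hM := mkCore_near F hu hN 1
  have hmul : ∀ z w : ℂ, ‖w - z / (hyp (flColB F G₁ G₂ H) (flColC F G₂ H) : ℂ)‖
      ≤ 11 * u * ‖z / (hyp (flColB F G₁ G₂ H) (flColC F G₂ H) : ℂ)‖ →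
      ‖w * (hyp (flColB F G₁ G₂ H) (flColC F G₂ H) : ℂ) - z‖ ≤ 11 * u * ‖z‖ := by
    intro z w h
    have e : w * (hyp (flColB F G₁ G₂ H) (flColC F G₂ H) : ℂ) - z
        = (w - z / (hyp (flColB F G₁ G₂ H) (flColC F G₂ H) : ℂ))
          * (hyp (flColB F G₁ G₂ H) (flColC F G₂ H) : ℂ) := by field_simp
    rw [e, norm_mul, norm_ofReal_hyp]
    rw [norm_div z, norm_ofReal_hyp] at h
    calc _ ≤ 11 * u * (‖z‖ / hyp (flColB F G₁ G₂ H) (flColC F G₂ H))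
          * hyp (flColB F G₁ G₂ H) (flColC F G₂ H) := by gcongr
      _ = _ := by field_simp
  have hMc := hmul _ _ (norm_unitize_mkCore_c_sub_le F hu hN 1)
  have hMs := hmul _ _ (norm_unitize_mkCore_s_sub_le F hu hN 1)
  have s1 := Core.size_unitize (h1.size_pos F hu (by norm_num))
  have s2 := Core.size_unitize (h2.size_pos F hu (by norm_num))
  have sh := Core.size_unitize (hh.size_pos F hu (by norm_num))
  have p1 := h1.size_pos F hu (by norm_num)
  have p2 := h2.size_pos F hu (by norm_num)
  have hkey := norm_hyp_mul_botS_sub_le F hu h1 h2 hh hMc hMs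
  have pM := hM.size_pos F hu (by norm_num)
  have sM := Core.size_unitize pM
  obtain ⟨na, -, hsN, hA, hB, hC⟩ := turnover_column F hu h1 h2 hh G₁.d hMc hMs sM
  have sa := Core.size_unitize (na.size_pos F hu (by norm_num))
  have hhs := Core.unitize_sgn_eq_one hd
  obtain ⟨-, hbot⟩ := norm_botC_sq_add s1 s2 sh sM sa hhs
    (Core.unitize_sgn_eq_one rfl) hA hB hC
  have hreal : (mkCore F (flColA F G₁ G₂ H) (F.norm2 (flColB F G₁ G₂ H) (flColC F G₂ H) : ℂ)
      G₁.d).s = ((mkCore F (flColA F G₁ G₂ H)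
        (F.norm2 (flColB F G₁ G₂ H) (flColC F G₂ H) : ℂ) G₁.d).s.re : ℂ) := by
    have h00 : F.fl 0 = 0 := by simpa using F.fl_err 0
    apply Complex.ext <;> simp [mkCore, FloatArith.cdiv, h00]
  have ht : turnover F G₁ G₂ H =
      (mkCore F (flColB F G₁ G₂ H) (flColC F G₂ H) 1,
        mkCore F (flColA F G₁ G₂ H) (F.norm2 (flColB F G₁ G₂ H) (flColC F G₂ H) : ℂ) G₁.d,
        mkCore F (F.cadd (F.cmul (conj (mkCore F (flColB F G₁ G₂ H) (flColC F G₂ H) 1).c) G₂.c)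
          (G₁.sgn * F.cmul (F.cmul (conj (mkCore F (flColB F G₁ G₂ H) (flColC F G₂ H) 1).s) G₁.c)
            G₂.s))
          (F.cdiv (F.cmul G₁.s G₂.s) (mkCore F (flColA F G₁ G₂ H)
            (F.norm2 (flColB F G₁ G₂ H) (flColC F G₂ H) : ℂ) G₁.d).s.re) G₂.d) := by
    unfold turnover
    exact if_neg hr
  rw [ht]
  set N := hyp (flColB F G₁ G₂ H) (flColC F G₂ H)
  set M := mkCore F (flColB F G₁ G₂ H) (flColC F G₂ H) 1
  set a := mkCore F (flColA F G₁ G₂ H) (F.norm2 (flColB F G₁ G₂ H) (flColC F G₂ H) : ℂ) G₁.d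
  set σ := a.s.re
  set X := F.cmul G₁.s G₂.s
  set q := F.cdiv X σ
  have hσ : |σ - N| ≤ 400 * u * N := by
    rw [hreal, ← Complex.ofReal_sub, Complex.norm_real] at hsN
    exact hsN
  have hσ0 : 0 < σ := by
    have := (abs_le.1 hσ).1
    have : 400 * u * N ≤ 1 / 2 * N := by gcongr; linarith
    linarith
  have hbS : ‖botS G₁.unitize G₂.unitize H.unitize M.unitize‖ ≤ 1 := by
    have := norm_le_hyp_right (botC G₁.unitize G₂.unitize M.unitize)
      (botS G₁.unitize G₂.unitize H.unitize M.unitize)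
    have := hyp_nonneg (botC G₁.unitize G₂.unitize M.unitize)
      (botS G₁.unitize G₂.unitize H.unitize M.unitize)
    nlinarith
  have hX := ((Core.approx_unitize_s p1 h1).cmul F hu (by norm_num) (by norm_num) (by norm_num)
    (by norm_num) (Core.approx_unitize_s p2 h2)).1
  rw [← norm_mul] at hX
  have hq := norm_quotient_sub_le h0 hu hN hσ (hX.trans (by gcongr; norm_num))
    (F.norm_cdiv_sub_le X σ) hkey hbS
  refine turnover_assemble F hu h1 h2 hh hd hM rfl hMc hMs ?_ hq ?_
  · have c1 := Core.norm_c_le_one s1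
    have c2 := Core.norm_c_le_one s2
    have t2 := Core.norm_s_le_one s2
    have cM := Core.norm_c_le_one sM
    have tM := Core.norm_s_le_one sM
    have e1 := (Core.approx_unitize_c pM hM).map_conj.cmul F hu (by norm_num) (by norm_num)
      (by norm_num) (by norm_num) (Core.approx_unitize_c p2 h2)
    have e2 := (((Core.approx_unitize_s pM hM).map_conj.cmul F hu (by norm_num) (by norm_num)
      (by norm_num) (by norm_num) (Core.approx_unitize_c p1 h1)).cmul F hu (by norm_num)
      (by norm_num) (by norm_num) (by norm_num) (Core.approx_unitize_s p2 h2)).sgn_mul G₁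
    have e3 := ((e1.mono (by nlinarith : _ ≤ 59 * u)).cadd F hu (by norm_num) (by norm_num)
      (e2.mono (by nlinarith))).1
    have k1 := mul_le_one₀ cM (norm_nonneg _) c2
    have k2 := mul_le_one₀ (mul_le_one₀ tM (norm_nonneg _) c1) (norm_nonneg _) t2
    refine e3.trans ?_
    calc _ ≤ (59 + 2) * u * (1 + 1) := by gcongr
      _ ≤ _ := by linarith
  · intro hbq _ _
    rw [hreal]
    have hP := F.norm_cmul_sub_le (by linarith : u ≤ 1 / 2) G₁.s G₂.s
    rw [← norm_mul] at hP
    exact norm_mul_quotient_sub_le h0 hu hσ0 hP (F.norm_cdiv_sub_le X σ) hbq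

end Turnover


/-! ### The degenerate turnover -/

section Turnover

variable {u : ℝ} (F : FloatArith u) {G₁ G₂ H : Core}

/-- The eliminating core of a degenerate turnover is diagonal. -/
theorem unitize_mkCore_zero (hu : u ≤ 1 / 10 ^ 6) {x : ℂ} (hx : x ≠ 0) :
    (mkCore F x 0 1).Near (5 * u) ∧
      ‖(mkCore F x 0 1).unitize.c - x / (‖x‖ : ℂ)‖ ≤ 11 * u ∧ (mkCore F x 0 1).unitize.s = 0 := by
  have hN : 0 < hyp x 0 := hyp_pos (Or.inl hx)
  have hN' : hyp x 0 = ‖x‖ := by simp [hyp, Real.sqrt_sq]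
  have hc := norm_unitize_mkCore_c_sub_le F hu hN 1
  have hs := norm_unitize_mkCore_s_sub_le F hu hN 1
  rw [hN'] at hc
  have h1 : ‖x / (‖x‖ : ℂ)‖ = 1 := by
    rw [norm_div, Complex.norm_real, norm_norm, div_self (norm_ne_zero_iff.2 hx)]
  rw [h1, mul_one] at hc
  refine ⟨mkCore_near F hu hN 1, hc, ?_⟩
  simpa using hs

/-- The turnover in which both entries to be eliminated are computed as zero. As there is no
underflow, the last of them vanishes only if `H` or `G₂` is diagonal. The product of the numbers `s`
needs no attention: if `H` is diagonal and `G₁` is not, the other entry cannot vanish, and if `G₂`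
is diagonal there is nothing to show. -/
theorem turnover_spec_of_eq (hu : u ≤ 1 / 10 ^ 6)
    (h1 : G₁.Near (20 * u)) (h2 : G₂.Near (20 * u)) (hh : H.Near (20 * u)) (hd : H.d = 1)
    (hr : F.norm2 (flColB F G₁ G₂ H) (flColC F G₂ H) = 0) :
    TurnoverSpec u G₁ G₂ H (turnover F G₁ G₂ H) := by
  have h0 := F.u_nonneg
  have s1 := Core.size_unitize (h1.size_pos F hu (by norm_num))
  have s2 := Core.size_unitize (h2.size_pos F hu (by norm_num))
  have sh := Core.size_unitize (hh.size_pos F hu (by norm_num))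
  have p1 := h1.size_pos F hu (by norm_num)
  have p2 := h2.size_pos F hu (by norm_num)
  have ph := hh.size_pos F hu (by norm_num)
  have c2 := Core.norm_c_le_one s2
  have t2 := Core.norm_s_le_one s2
  have ch := Core.norm_c_le_one sh
  have e0 := (norm2_eq_zero_iff F hu _ _).1 hr
  have hsC := (flColC_eq_zero_iff F hu).1 e0.2
  have ht : turnover F G₁ G₂ H =
      (mkCore F (if H.s = 0 then H.c else 1) 0 1,
        mkCore F (flColA F G₁ G₂ H) (F.norm2 (flColB F G₁ G₂ H) (flColC F G₂ H) : ℂ) G₁.d,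
        mkCore F (F.cmul (conj (if H.s = 0 then H.c else 1)) G₂.c) G₂.s G₂.d) := by
    have : turnover F G₁ G₂ H = (mkCore F (if H.s = 0 then H.c else 1) 0 1,
        mkCore F (flColA F G₁ G₂ H) 0 G₁.d,
        mkCore F (F.cmul (conj (if H.s = 0 then H.c else 1)) G₂.c) G₂.s G₂.d) := by
      unfold turnover
      exact if_pos hr
    rw [this, hr, Complex.ofReal_zero]
  have hz : hyp 0 0 = 0 := by simp [hyp]
  have hcolB : ∀ z : ℂ, ‖z * (hyp (flColB F G₁ G₂ H) (flColC F G₂ H) : ℂ) - flColB F G₁ G₂ H‖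
      ≤ 11 * u * ‖flColB F G₁ G₂ H‖ := by
    intro z; rw [e0.1, e0.2, hz]; simp
  have hcolC : ∀ z : ℂ, ‖z * (hyp (flColB F G₁ G₂ H) (flColC F G₂ H) : ℂ) - flColC F G₂ H‖
      ≤ 11 * u * ‖flColC F G₂ H‖ := by
    intro z; rw [e0.1, e0.2, hz]; simp
  have eg := (Core.approx_unitize_s p2 h2).1
  have egc := (Core.approx_unitize_c p2 h2)
  rw [ht]
  by_cases hHs : H.s = 0
  · -- the rotator that is passed through is diagonal
    rw [if_pos hHs]
    have hsz : H.size = ‖H.c‖ := by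
      rw [Core.size, hHs]; simp [Real.sqrt_sq]
    have hHc : H.c ≠ 0 := by rw [← norm_pos_iff, ← hsz]; exact ph
    have hus : H.unitize.s = 0 := by rw [Core.unitize_s, hHs, zero_div]
    have huc : H.unitize.c = H.c / (‖H.c‖ : ℂ) := by rw [Core.unitize_c, hsz]
    have hcc : H.unitize.c * conj H.unitize.c = 1 := by
      have := Core.mul_conj_add sh; rwa [hus, zero_mul, add_zero] at this
    obtain ⟨nM, mc, ms⟩ := unitize_mkCore_zero F hu hHc
    rw [← huc] at mc
    refine turnover_assemble F hu h1 h2 hh hd nM rfl (hcolB _) (hcolC _) ?_ ?_ ?_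
    · rw [botC, ms]
      have k1 := ((Core.approx_unitize_c ph hh).map_conj.cmul F hu (by norm_num) (by norm_num)
        (by norm_num) (by norm_num) egc).1
      have k2 : ‖conj H.unitize.c * G₂.unitize.c - conj (mkCore F H.c 0 1).unitize.c * G₂.unitize.c‖
          ≤ 11 * u * 1 := by
        rw [← sub_mul, norm_mul, ← map_sub, RCLike.norm_conj, norm_sub_rev]
        gcongr
      have k3 := norm_sub_le_norm_sub_add_norm_sub (F.cmul (conj H.c) G₂.c)
        (conj H.unitize.c * G₂.unitize.c) (conj (mkCore F H.c 0 1).unitize.c * G₂.unitize.c)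
      have k4 : (20 + 20 + 7) * u * (‖H.unitize.c‖ * ‖G₂.unitize.c‖) ≤ (20 + 20 + 7) * u * 1 := by
        gcongr
        exact mul_le_one₀ ch (norm_nonneg _) c2
      simp only [map_zero, zero_mul, mul_zero, add_zero]
      linarith
    · rw [botS, ms]
      have e : G₂.s - ((0 : ℂ) * G₁.unitize.s * conj H.unitize.s
          - G₁.unitize.sgn * (0 * conj G₁.unitize.c * G₂.unitize.c * conj H.unitize.c)
          + (mkCore F H.c 0 1).unitize.c * G₂.unitize.s * conj H.unitize.c)
          = (G₂.s - G₂.unitize.s) - ((mkCore F H.c 0 1).unitize.c - H.unitize.c)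
            * (G₂.unitize.s * conj H.unitize.c) := by
        linear_combination (-G₂.unitize.s) * hcc
      rw [e]
      have k := norm_sub_le (G₂.s - G₂.unitize.s) (((mkCore F H.c 0 1).unitize.c - H.unitize.c)
            * (G₂.unitize.s * conj H.unitize.c))
      have k2 : ‖((mkCore F H.c 0 1).unitize.c - H.unitize.c)
            * (G₂.unitize.s * conj H.unitize.c)‖ ≤ 11 * u * (1 * 1) := by
        rw [norm_mul, norm_mul, RCLike.norm_conj]; gcongr
      have k3 : 20 * u * ‖G₂.unitize.s‖ ≤ 20 * u * 1 := by gcongr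
      linarith
    · -- the computed second entry is close to `-s₁ c` with `|c| = 1`, and is zero only if `s₁` is
      intro _ hG _
      exfalso
      have k := (approx_flColB F hu h1 h2 hh).1
      rw [e0.1, colB, hus] at k
      simp only [norm_zero, mul_zero, add_zero, zero_sub, norm_neg, norm_mul] at k
      have hn : ‖H.unitize.c‖ = 1 := by
        rw [huc, norm_div, Complex.norm_real, norm_norm, div_self (norm_ne_zero_iff.2 hHc)]
      rw [hn, mul_one] at k
      have hG' : 0 < ‖G₁.unitize.s‖ := by
        rw [norm_pos_iff]
        intro h
        have := Core.size_mul_unitize_s p1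
        rw [h, mul_zero] at this
        exact hG this.symm
      nlinarith
  · -- the second core is diagonal
    rw [if_neg hHs]
    have hG2 : G₂.s = 0 := hsC.resolve_right hHs
    have hus : G₂.unitize.s = 0 := by rw [Core.unitize_s, hG2, zero_div]
    obtain ⟨nM, mc, ms⟩ := unitize_mkCore_zero F hu (one_ne_zero (α := ℂ))
    refine turnover_assemble F hu h1 h2 hh hd nM rfl (hcolB _) (hcolC _) ?_ ?_ ?_
    · rw [botC, ms]
      simp only [norm_one, Complex.ofReal_one, div_one] at mc
      have k1 := F.norm_cmul_sub_le (by linarith : u ≤ 1 / 2) (conj 1) G₂.c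
      rw [map_one, one_mul, norm_one, one_mul] at k1
      have k2 : ‖G₂.unitize.c - conj (mkCore F 1 0 1).unitize.c * G₂.unitize.c‖ ≤ 11 * u * 1 := by
        have e : G₂.unitize.c - conj (mkCore F 1 0 1).unitize.c * G₂.unitize.c
            = conj (1 - (mkCore F 1 0 1).unitize.c) * G₂.unitize.c := by
          rw [map_sub, map_one]; ring
        rw [e, norm_mul, RCLike.norm_conj, norm_sub_rev]
        gcongr
      have k3 := norm_sub_le_norm_sub_add_norm_sub (F.cmul (conj 1) G₂.c) G₂.c G₂.unitize.c
      have k4 := norm_sub_le_norm_sub_add_norm_sub (F.cmul (conj 1) G₂.c) G₂.unitize.c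
        (conj (mkCore F 1 0 1).unitize.c * G₂.unitize.c)
      have k5 := egc.1
      have k6 := egc.norm_le
      have k7 : 20 * u * ‖G₂.unitize.c‖ ≤ 20 * u * 1 := by gcongr
      have k8 : 5 * u * ‖G₂.c‖ ≤ 5 * u * 2 := by gcongr; linarith
      rw [map_one] at k3 k4 ⊢
      simp only [map_zero, zero_mul, mul_zero, add_zero]
      linarith
    · rw [botS, ms, hus, hG2]
      simp [h0]
    · intro _ _ hG
      exact absurd hG2 hG

/-- The computed turnover is backward stable, and preserves the product of the numbers `s`. -/
theorem turnover_spec (hu : u ≤ 1 / 10 ^ 6)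
    (h1 : G₁.Near (20 * u)) (h2 : G₂.Near (20 * u)) (hh : H.Near (20 * u)) (hd : H.d = 1) :
    TurnoverSpec u G₁ G₂ H (turnover F G₁ G₂ H) := by
  by_cases hr : F.norm2 (flColB F G₁ G₂ H) (flColC F G₂ H) = 0
  · exact turnover_spec_of_eq F hu h1 h2 hh hd hr
  · exact turnover_spec_of_ne F hu h1 h2 hh hd hr

/-! ### The turnover from left to right -/

/-- Transposition about the antidiagonal. Since `rev` exchanges the positions `0` and `1` of cores of
order three, it turns a turnover from left to right into one from right to left. -/
def antiTranspose {m : ℕ} (A : Matrix (Fin m) (Fin m) ℂ) : Matrix (Fin m) (Fin m) ℂ :=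
  Matrix.of fun i j => A (Fin.rev j) (Fin.rev i)

theorem antiTranspose_mul {m : ℕ} (A B : Matrix (Fin m) (Fin m) ℂ) :
    antiTranspose (A * B) = antiTranspose B * antiTranspose A := by
  ext i j
  simp only [antiTranspose, Matrix.of_apply, Matrix.mul_apply]
  rw [← Equiv.sum_comp Fin.revPerm]
  simp [mul_comm]

theorem antiTranspose_sub {m : ℕ} (A B : Matrix (Fin m) (Fin m) ℂ) :
    antiTranspose (A - B) = antiTranspose A - antiTranspose B := rfl

theorem norm_antiTranspose_three_le (A : Matrix (Fin 3) (Fin 3) ℂ) :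
    ‖antiTranspose A‖ ≤ 9 * ‖A‖ := by
  refine (norm_le_sum_entries _).trans ?_
  calc ∑ i, ∑ j, ‖antiTranspose A i j‖ ≤ ∑ _i : Fin 3, ∑ _j : Fin 3, ‖A‖ :=
        Finset.sum_le_sum fun i _ => Finset.sum_le_sum fun j _ => norm_entry_le A _ _
    _ = 9 * ‖A‖ := by simp; ring

theorem Core.antiTranspose_three_zero (g : Core) :
    antiTranspose (g.toMatrix 3 0) = g.flip.toMatrix 3 1 := by
  have hs : g.flip.sgn = g.sgn := rfl
  rw [toMatrix_three_zero, toMatrix_three_one, hs]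
  have h : ∀ z : ℂ, g.sgn * (g.sgn * z) = z := fun z => by rw [← mul_assoc, sgn_mul_self, one_mul]
  ext i j
  fin_cases i <;> fin_cases j <;> simp [antiTranspose, flip, h, Fin.rev]

theorem Core.antiTranspose_three_one (g : Core) :
    antiTranspose (g.toMatrix 3 1) = g.flip.toMatrix 3 0 := by
  have hs : g.flip.sgn = g.sgn := rfl
  rw [toMatrix_three_zero, toMatrix_three_one, hs]
  have h : ∀ z : ℂ, g.sgn * (g.sgn * z) = z := fun z => by rw [← mul_assoc, sgn_mul_self, one_mul]
  ext i j
  fin_cases i <;> fin_cases j <;> simp [antiTranspose, flip, h, Fin.rev]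

/-- What a computed turnover `(G₁', G₂', L)` of `K`, `G₁`, `G₂` from left to right achieves. -/
structure TurnoverLRSpec (u : ℝ) (K G₁ G₂ : Core) (t : Core × Core × Core) : Prop where
  near_fst : t.1.Near (5 * u)
  near_snd : t.2.1.Near (5 * u)
  near_thd : t.2.2.Near (5 * u)
  d_fst : t.1.d = G₁.d
  d_snd : t.2.1.d = G₂.d
  d_thd : t.2.2.d = 1
  err : ‖K.unitize.toMatrix 3 1 * G₁.toMatrix 3 0 * G₂.toMatrix 3 1
    - t.1.toMatrix 3 0 * t.2.1.toMatrix 3 1 * t.2.2.unitize.toMatrix 3 0‖ ≤ 27 * 10 ^ 5 * u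
  s_mul_s : G₁.s ≠ 0 → G₂.s ≠ 0 → ‖t.1.s * t.2.1.s - G₁.s * G₂.s‖ ≤ 5000 * u * ‖G₁.s * G₂.s‖

/-- The mirror image of `turnover_spec` under transposition about the antidiagonal. The error is
larger only because the norm of the transpose is estimated entrywise. -/
theorem turnoverLR_spec {K : Core} (hu : u ≤ 1 / 10 ^ 6)
    (hK : K.Near (20 * u)) (hd : K.d = 1) (h1 : G₁.Near (20 * u)) (h2 : G₂.Near (20 * u)) :
    TurnoverLRSpec u K G₁ G₂ (turnoverLR F K G₁ G₂) := by
  have h := turnover_spec F hu h2.flip h1.flip hK.flip hd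
  unfold turnoverLR
  set t := turnover F G₂.flip G₁.flip K.flip
  refine ⟨h.near_thd.flip, h.near_snd.flip, h.near_fst.flip, h.d_thd, h.d_snd, h.d_fst, ?_, ?_⟩
  · have e := norm_antiTranspose_three_le (G₂.flip.toMatrix 3 0 * G₁.flip.toMatrix 3 1
      * K.flip.unitize.toMatrix 3 0
      - t.1.unitize.toMatrix 3 1 * t.2.1.toMatrix 3 0 * t.2.2.toMatrix 3 1)
    rw [antiTranspose_sub, antiTranspose_mul, antiTranspose_mul, antiTranspose_mul,
      antiTranspose_mul, Core.antiTranspose_three_zero, Core.antiTranspose_three_zero,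
      Core.antiTranspose_three_zero, Core.antiTranspose_three_one, Core.antiTranspose_three_one,
      Core.antiTranspose_three_one, ← Core.unitize_flip, ← Core.unitize_flip, Core.flip_flip,
      Core.flip_flip, Core.flip_flip, ← Matrix.mul_assoc, ← Matrix.mul_assoc] at e
    have := h.err
    exact e.trans (by linarith)
  · intro k1 k2
    have := h.s_mul_s k2 k1
    rw [mul_comm, mul_comm G₁.s]
    exact this

/-! ### The computed fusion -/

/-- The computed product of two cores in the same position is backward stable. -/
theorem norm_fuse_sub_le {G H : Core} (hu : u ≤ 1 / 10 ^ 6)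
    (hG : G.Near (20 * u)) (hH : H.Near (20 * u)) {m i : ℕ} (hi : i + 2 ≤ m) :
    (fuse F G H).Near (5 * u) ∧
      ‖G.toMatrix m i * H.toMatrix m i - (fuse F G H).toMatrix m i‖ ≤ 2000 * u := by
  have h0 := F.u_nonneg
  have pG := hG.size_pos F hu (by norm_num)
  have pH := hH.size_pos F hu (by norm_num)
  have sG := Core.size_unitize pG
  have sH := Core.size_unitize pH
  have aGc := Core.approx_unitize_c pG hG
  have aGs := Core.approx_unitize_s pG hG
  have aHc := Core.approx_unitize_c pH hH
  have aHs := Core.approx_unitize_s pH hH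
  have e1 := aGc.cmul F hu (by norm_num) (by norm_num) (by norm_num) (by norm_num) aHc
  have e2 := (aGs.map_conj.cmul F hu (by norm_num) (by norm_num) (by norm_num) (by norm_num)
    aHs).sgn_mul G
  have e3 := aGs.cmul F hu (by norm_num) (by norm_num) (by norm_num) (by norm_num) aHc
  have e4 := (aGc.map_conj.cmul F hu (by norm_num) (by norm_num) (by norm_num) (by norm_num)
    aHs).sgn_mul G
  have ex := (e1.csub F hu (by norm_num) (by norm_num) e2).1
  have ey := (e3.cadd F hu (by norm_num) (by norm_num) e4).1
  have cG := Core.norm_c_le_one sG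
  have tG := Core.norm_s_le_one sG
  have cH := Core.norm_c_le_one sH
  have tH := Core.norm_s_le_one sH
  set g := G.unitize
  set h := H.unitize
  set x := F.csub (F.cmul G.c H.c) (G.sgn * F.cmul (conj G.s) H.s)
  set y := F.cadd (F.cmul G.s H.c) (G.sgn * F.cmul (conj G.c) H.s)
  set x' := g.c * h.c - G.sgn * (conj g.s * h.s)
  set y' := g.s * h.c + G.sgn * (conj g.c * h.s)
  have hx : ‖x - x'‖ ≤ 98 * u := ex.trans (by
    have := mul_le_one₀ cG (norm_nonneg _) cH
    have := mul_le_one₀ tG (norm_nonneg _) tH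
    nlinarith)
  have hy : ‖y - y'‖ ≤ 98 * u := ey.trans (by
    have := mul_le_one₀ cG (norm_nonneg _) tH
    have := mul_le_one₀ tG (norm_nonneg _) cH
    nlinarith)
  have hxy : hyp x' y' = 1 := by
    have k1 := Core.mul_conj_add sG
    have k2 := Core.mul_conj_add sH
    have : x' * conj x' + y' * conj y' = 1 := by
      simp only [x', y', map_add, map_sub, map_mul, Complex.conj_conj, Core.conj_sgn]
      linear_combination (h.c * conj h.c + G.sgn * G.sgn * h.s * conj h.s) * k1
        + h.s * conj h.s * G.sgn_mul_self + k2
    rw [Complex.mul_conj, Complex.mul_conj, Complex.normSq_eq_norm_sq,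
      Complex.normSq_eq_norm_sq] at this
    have : ‖x'‖ ^ 2 + ‖y'‖ ^ 2 = 1 := by exact_mod_cast this
    rw [hyp, this, Real.sqrt_one]
  have hN := abs_hyp_sub_hyp_le x y x' y'
  rw [hxy] at hN
  obtain ⟨hN1, hN2⟩ := abs_le.1 hN
  have hN0 : 0 < hyp x y := by linarith
  have hNc : (hyp x y : ℂ) ≠ 0 := by exact_mod_cast hN0.ne'
  have fin : ∀ z z' w : ℂ, ‖w - z / (hyp x y : ℂ)‖ ≤ 5 * u * ‖z / (hyp x y : ℂ)‖ →
      ‖z - z'‖ ≤ 98 * u → ‖z‖ ≤ hyp x y → ‖w - z'‖ ≤ 310 * u := by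
    intro z z' w k1 k2 k3
    have k4 : ‖z / (hyp x y : ℂ)‖ ≤ 1 := by
      rw [norm_div, norm_ofReal_hyp]; exact div_le_one_of_le₀ k3 hN0.le
    have e : w - z' = (w - z / (hyp x y : ℂ)) + (z - z')
        - ((hyp x y - 1 : ℝ) : ℂ) * (z / (hyp x y : ℂ)) := by
      push_cast; field_simp; ring
    rw [e]
    have k5 := norm_sub_le ((w - z / (hyp x y : ℂ)) + (z - z'))
      (((hyp x y - 1 : ℝ) : ℂ) * (z / (hyp x y : ℂ)))
    have k6 := norm_add_le (w - z / (hyp x y : ℂ)) (z - z')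
    have k7 : ‖((hyp x y - 1 : ℝ) : ℂ) * (z / (hyp x y : ℂ))‖ ≤ (98 * u + 98 * u) * 1 := by
      rw [norm_mul, Complex.norm_real, Real.norm_eq_abs]
      gcongr
      linarith
    have k8 : 5 * u * ‖z / (hyp x y : ℂ)‖ ≤ 5 * u * 1 := by gcongr
    linarith
  have hfc := fin x x' (fuse F G H).c (norm_mkCore_c_sub_le F hu hN0 _) hx (norm_le_hyp_left x y)
  have hfs := fin y y' (fuse F G H).s (norm_mkCore_s_sub_le F hu hN0 _) hy (norm_le_hyp_right x y)
  refine ⟨mkCore_near F hu hN0 _, ?_⟩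
  -- the product of the unitary cores is again a core
  have hprod : g.toMatrix m i * h.toMatrix m i
      = (⟨x', y', G.d * H.d⟩ : Core).toMatrix m i := by
    have hsg : (⟨x', y', G.d * H.d⟩ : Core).sgn = g.sgn * h.sgn := by
      simp [Core.sgn, g, h, Core.unitize_d]
    rw [g.toMatrix_eq_emb_two, h.toMatrix_eq_emb_two, Core.toMatrix_eq_emb_two ⟨x', y', G.d * H.d⟩,
      ← emb_mul hi, Core.toMatrix_two, Core.toMatrix_two, Core.toMatrix_two, hsg]
    have hg1 : G.sgn = g.sgn := rfl
    have hg2 := g.sgn_mul_self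
    congr 1
    ext i j
    fin_cases i <;> fin_cases j <;> simp [Matrix.mul_apply, Fin.sum_univ_two, x', y', hg1]
    · ring
    · linear_combination (h.sgn * g.c * conj h.s) * hg2
    · ring
    · linear_combination (h.sgn * g.s * conj h.s) * hg2
  have k1 := (Core.norm_toMatrix_sub_unitize pG hi).trans hG
  have k2 := (Core.norm_toMatrix_sub_unitize pH hi).trans hH
  have k3 := norm_le_one_of_unitary (Core.unitize_toMatrix_unitary pG hi)
  have k4 := Core.norm_toMatrix_le pH hH hi
  have k5 := norm_mul_sub_mul_le (G.toMatrix m i) (H.toMatrix m i) (g.toMatrix m i) (h.toMatrix m i)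
  have k6 := Core.norm_toMatrix_sub_le (g := ⟨x', y', G.d * H.d⟩) (h := fuse F G H) rfl hi
  rw [norm_sub_rev x', norm_sub_rev y'] at k6
  have k7 := norm_sub_le_norm_sub_add_norm_sub (G.toMatrix m i * H.toMatrix m i)
    (g.toMatrix m i * h.toMatrix m i) ((fuse F G H).toMatrix m i)
  have k8 : ‖G.toMatrix m i - g.toMatrix m i‖ * ‖H.toMatrix m i‖ ≤ 20 * u * 2 := by
    gcongr
    linarith
  have k9 : ‖g.toMatrix m i‖ * ‖H.toMatrix m i - h.toMatrix m i‖ ≤ 1 * (20 * u) := by gcongr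
  rw [hprod] at k5 k7
  linarith

end Turnover


/-! ### Local changes in a product of cores -/

/-- Replace two consecutive members of a sequence of cores. -/
def updateTwo (G : ℕ → Core) (i : ℕ) (a b : Core) : ℕ → Core :=
  Function.update (Function.update G i a) (i + 1) b

section Splice

variable {G : ℕ → Core} {i : ℕ} {a b : Core}

@[simp] theorem updateTwo_fst : updateTwo G i a b i = a := by simp [updateTwo]

@[simp] theorem updateTwo_snd : updateTwo G i a b (i + 1) = b := by simp [updateTwo]

theorem updateTwo_of_ne {j : ℕ} (h1 : j ≠ i) (h2 : j ≠ i + 1) : updateTwo G i a b j = G j := by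
  simp [updateTwo, Function.update_of_ne h1, Function.update_of_ne h2]

/-- A property of all cores in a range survives the replacement of two of them. -/
theorem forall_updateTwo {p : Core → Prop} {k : ℕ} (hG : ∀ j, j < k → p (G j)) (ha : p a) (hb : p b) :
    ∀ j, j < k → p (updateTwo G i a b j) := by
  intro j hj
  by_cases h1 : j = i
  · subst h1; rwa [updateTwo_fst]
  by_cases h2 : j = i + 1
  · subst h2; rwa [updateTwo_snd]
  rw [updateTwo_of_ne h1 h2]; exact hG j hj

theorem descProd_split_one (m : ℕ) {k : ℕ} (h : i + 1 ≤ k) (G : ℕ → Core) :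
    descProd m k G = segProd m 0 i G * (G i).toMatrix m i * segProd m (i + 1) (k - (i + 1)) G := by
  have h1 : k = (i + 1) + (k - (i + 1)) := by omega
  conv_lhs => rw [descProd_eq_segProd, h1, segProd_add, segProd_succ]
  simp

theorem descProd_split_two (m : ℕ) {k : ℕ} (h : i + 2 ≤ k) (G : ℕ → Core) :
    descProd m k G = segProd m 0 i G * ((G i).toMatrix m i * (G (i + 1)).toMatrix m (i + 1))
      * segProd m (i + 2) (k - (i + 2)) G := by
  have h1 : k = (i + 2) + (k - (i + 2)) := by omega
  conv_lhs => rw [descProd_eq_segProd, h1, segProd_add, segProd_succ, segProd_succ]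
  simp [Matrix.mul_assoc]

theorem descProd_updateTwo (m : ℕ) {k : ℕ} (h : i + 2 ≤ k) (G : ℕ → Core) (a b : Core) :
    descProd m k (updateTwo G i a b) = segProd m 0 i G * (a.toMatrix m i * b.toMatrix m (i + 1))
      * segProd m (i + 2) (k - (i + 2)) G := by
  rw [descProd_split_two m h, updateTwo_fst, updateTwo_snd]
  congr 1
  · congr 1
    exact segProd_congr fun j _ h2 => updateTwo_of_ne (by omega) (by omega)
  · exact segProd_congr fun j h1 h2 => updateTwo_of_ne (by omega) (by omega)

theorem descProd_update (m : ℕ) {k : ℕ} (h : i + 1 ≤ k) (G : ℕ → Core) (a : Core) :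
    descProd m k (Function.update G i a) = segProd m 0 i G * a.toMatrix m i
      * segProd m (i + 1) (k - (i + 1)) G := by
  rw [descProd_split_one m h, Function.update_self]
  congr 1
  · congr 1
    exact segProd_congr fun j _ h2 => Function.update_of_ne (by omega) _ _
  · exact segProd_congr fun j h1 h2 => Function.update_of_ne (by omega) _ _

theorem norm_mul_mul_le_four {m : ℕ} {A B D : Matrix (Fin m) (Fin m) ℂ} (hA : ‖A‖ ≤ 2)
    (hB : ‖B‖ ≤ 2) : ‖A * D * B‖ ≤ 4 * ‖D‖ := by
  calc _ ≤ ‖A * D‖ * ‖B‖ := Matrix.l2_opNorm_mul _ _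
    _ ≤ (‖A‖ * ‖D‖) * ‖B‖ := by gcongr; exact Matrix.l2_opNorm_mul _ _
    _ ≤ (2 * ‖D‖) * 2 := by gcongr
    _ = _ := by ring

/-- A core `X` is passed through a descending sequence from right to left: the only error is that
of the turnover. -/
theorem norm_descProd_mul_sub_le {m k : ℕ} {X M : Core} {e : ℝ} (he0 : 0 ≤ e) (he : m * e ≤ 1 / 2)
    (hi : i + 2 ≤ k) (hk : k + 1 ≤ m) (hG : ∀ j, j < k → (G j).Near e) :
    ‖descProd m k G * X.toMatrix m i - M.toMatrix m (i + 1) * descProd m k (updateTwo G i a b)‖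
      ≤ 4 * ‖(G i).toMatrix 3 0 * (G (i + 1)).toMatrix 3 1 * X.toMatrix 3 0
        - M.toMatrix 3 1 * a.toMatrix 3 0 * b.toMatrix 3 1‖ := by
  have hm : i + 3 ≤ m := by omega
  rw [descProd_split_two m hi, descProd_updateTwo m hi]
  have c1 := segProd_commute_right (m := m) (i := i + 2) (len := k - (i + 2)) (G := G) X
    (j := i) le_rfl
  have c2 := segProd_commute_left (m := m) (i := 0) (len := i) (G := G) M (j := i + 1) (by omega)
  have n1 := norm_segProd_le_two he0 he (by omega : 0 + i + 1 ≤ m) (G := G)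
    fun j _ h2 => hG j (by omega)
  have n2 := norm_segProd_le_two he0 he (by omega : (i + 2) + (k - (i + 2)) + 1 ≤ m) (G := G)
    fun j h1 h2 => hG j (by omega)
  set P := segProd m 0 i G
  set R := segProd m (i + 2) (k - (i + 2)) G
  have e1 : P * ((G i).toMatrix m i * (G (i + 1)).toMatrix m (i + 1)) * R * X.toMatrix m i
      - M.toMatrix m (i + 1) * (P * (a.toMatrix m i * b.toMatrix m (i + 1)) * R)
      = P * ((G i).toMatrix m i * (G (i + 1)).toMatrix m (i + 1) * X.toMatrix m i
        - M.toMatrix m (i + 1) * a.toMatrix m i * b.toMatrix m (i + 1)) * R := by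
    rw [Matrix.mul_assoc _ R, c1.eq, ← Matrix.mul_assoc (M.toMatrix m (i + 1)),
      ← Matrix.mul_assoc (M.toMatrix m (i + 1)), ← c2.eq]
    noncomm_ring
  rw [e1]
  refine (norm_mul_mul_le_four n1 n2).trans ?_
  gcongr
  simp only [Core.toMatrix_eq_emb_three_zero _ m i, Core.toMatrix_eq_emb_three_one _ m i,
    ← emb_mul hm]
  exact norm_emb_sub_le hm _ _

/-- A core `K` is passed through a descending sequence from left to right. -/
theorem norm_mul_descProd_sub_le {m k : ℕ} {K L : Core} {e : ℝ} (he0 : 0 ≤ e) (he : m * e ≤ 1 / 2)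
    (hi : i + 2 ≤ k) (hk : k + 1 ≤ m) (hG : ∀ j, j < k → (G j).Near e) :
    ‖K.toMatrix m (i + 1) * descProd m k G - descProd m k (updateTwo G i a b) * L.toMatrix m i‖
      ≤ 4 * ‖K.toMatrix 3 1 * (G i).toMatrix 3 0 * (G (i + 1)).toMatrix 3 1
        - a.toMatrix 3 0 * b.toMatrix 3 1 * L.toMatrix 3 0‖ := by
  have hm : i + 3 ≤ m := by omega
  rw [descProd_split_two m hi, descProd_updateTwo m hi]
  have c1 := segProd_commute_right (m := m) (i := i + 2) (len := k - (i + 2)) (G := G) L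
    (j := i) le_rfl
  have c2 := segProd_commute_left (m := m) (i := 0) (len := i) (G := G) K (j := i + 1) (by omega)
  have n1 := norm_segProd_le_two he0 he (by omega : 0 + i + 1 ≤ m) (G := G)
    fun j _ h2 => hG j (by omega)
  have n2 := norm_segProd_le_two he0 he (by omega : (i + 2) + (k - (i + 2)) + 1 ≤ m) (G := G)
    fun j h1 h2 => hG j (by omega)
  set P := segProd m 0 i G
  set R := segProd m (i + 2) (k - (i + 2)) G
  have e1 : K.toMatrix m (i + 1) * (P * ((G i).toMatrix m i * (G (i + 1)).toMatrix m (i + 1)) * R)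
      - P * (a.toMatrix m i * b.toMatrix m (i + 1)) * R * L.toMatrix m i
      = P * (K.toMatrix m (i + 1) * (G i).toMatrix m i * (G (i + 1)).toMatrix m (i + 1)
        - a.toMatrix m i * b.toMatrix m (i + 1) * L.toMatrix m i) * R := by
    rw [Matrix.mul_assoc _ R (L.toMatrix m i), c1.eq, ← Matrix.mul_assoc (K.toMatrix m (i + 1)),
      ← Matrix.mul_assoc (K.toMatrix m (i + 1)), ← c2.eq]
    noncomm_ring
  rw [e1]
  refine (norm_mul_mul_le_four n1 n2).trans ?_
  gcongr
  simp only [Core.toMatrix_eq_emb_three_zero _ m i, Core.toMatrix_eq_emb_three_one _ m i,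
    ← emb_mul hm]
  exact norm_emb_sub_le hm _ _

end Splice

/-! ### The first row of a product of cores -/

/-- The first row of a descending product: the core `j` contributes its `c`, the cores before it
their entries in the first row and second column. -/
theorem descProd_row_zero {m : ℕ} (G : ℕ → Core) (k : ℕ) (hk : k + 1 ≤ m) (j : Fin m) :
    descProd m k G ⟨0, by omega⟩ j =
      if (j : ℕ) < k then (∏ i ∈ Finset.range j, -((G i).sgn * conj (G i).s)) * (G j).c
      else if (j : ℕ) = k then ∏ i ∈ Finset.range k, -((G i).sgn * conj (G i).s) else 0 := by
  induction k generalizing j with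
  | zero =>
    have h1 : descProd m 0 G = 1 := rfl
    rw [h1, Matrix.one_apply]
    simp only [Fin.ext_iff]
    by_cases hj : (j : ℕ) = 0
    · simp [hj]
    · simp [hj, Ne.symm hj]
  | succ k ih =>
    rw [descProd_succ, Matrix.mul_apply]
    have ih' := fun l => ih (by omega) l
    simp only [ih']
    rcases lt_trichotomy (j : ℕ) k with hj | hj | hj
    · rw [Finset.sum_eq_single j]
      · rw [if_pos hj, if_pos (by omega)]
        have : (G k).toMatrix m k j j = 1 := by
          simp only [Core.toMatrix, Matrix.of_apply]
          rw [if_neg (by omega), if_neg (by omega), if_neg (by omega), if_neg (by omega),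
            if_pos trivial]
        rw [this, mul_one]
      · intro l _ hl
        have hl' : (l : ℕ) ≠ j := fun h => hl (Fin.ext h)
        have : (G k).toMatrix m k l j = 0 := by
          simp only [Core.toMatrix, Matrix.of_apply]
          rw [if_neg (by omega), if_neg (by omega), if_neg (by omega), if_neg (by omega), if_neg hl]
        rw [this, mul_zero]
      · simp
    · rw [Finset.sum_eq_single j]
      · rw [if_neg (by omega), if_pos hj, if_pos (by omega)]
        have : (G k).toMatrix m k j j = (G k).c := by
          simp only [Core.toMatrix, Matrix.of_apply]
          rw [if_pos (by omega)]
        rw [this, hj]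
      · intro l _ hl
        have hl' : (l : ℕ) ≠ j := fun h => hl (Fin.ext h)
        by_cases hlk : (l : ℕ) < k
        · have : (G k).toMatrix m k l j = 0 := by
            simp only [Core.toMatrix, Matrix.of_apply]
            rw [if_neg (by omega), if_neg (by omega), if_neg (by omega), if_neg (by omega), if_neg hl]
          rw [this, mul_zero]
        · rw [if_neg hlk, if_neg (by omega), zero_mul]
      · simp
    · by_cases hj2 : (j : ℕ) = k + 1
      · rw [Finset.sum_eq_single (⟨k, by omega⟩ : Fin m)]
        · rw [if_neg (by simp), if_pos rfl, if_neg (by omega), if_pos hj2, Finset.prod_range_succ]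
          congr 1
          simp only [Core.toMatrix, Matrix.of_apply]
          rw [if_neg (by omega), if_pos ⟨trivial, hj2⟩]
        · intro l _ hl
          have hl' : (l : ℕ) ≠ k := fun h => hl (Fin.ext h)
          by_cases hlk : (l : ℕ) < k
          · have : (G k).toMatrix m k l j = 0 := by
              simp only [Core.toMatrix, Matrix.of_apply]
              rw [if_neg (by omega), if_neg (by omega), if_neg (by omega), if_neg (by omega),
                if_neg (by rw [Fin.ext_iff]; omega)]
            rw [this, mul_zero]
          · rw [if_neg hlk, if_neg hl', zero_mul]
        · simp
      · rw [if_neg (by omega), if_neg hj2]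
        refine Finset.sum_eq_zero fun l _ => ?_
        by_cases hlk : (l : ℕ) ≤ k
        · have : (G k).toMatrix m k l j = 0 := by
            simp only [Core.toMatrix, Matrix.of_apply]
            rw [if_neg (by omega), if_neg (by omega), if_neg (by omega), if_neg (by omega),
              if_neg (by rw [Fin.ext_iff]; omega)]
          rw [this, mul_zero]
        · rw [if_neg (by omega), if_neg (by omega), zero_mul]

/-- The number `ρ` of a state is, up to sign, the product of the `s` of its `C` cores. -/
theorem State.rhohat_eq {n : ℕ} (S : State n) :
    S.rhohat = ∏ i ∈ Finset.range n, -((S.C i).sgn * (S.C i).s) := by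
  have h := descProd_row_zero (m := n + 1) S.C n le_rfl (Fin.last n)
  rw [if_neg (by simp), if_pos (by simp)] at h
  have h2 : S.rhohat = conj (descProd (n + 1) n S.C ⟨0, by omega⟩ (Fin.last n)) := rfl
  rw [h2, h, map_prod]
  refine Finset.prod_congr rfl fun i _ => ?_
  simp

/-- A relative error in the product of two neighbouring numbers `s` is a relative error of the same
size in the product of all of them. -/
theorem norm_prod_updateTwo_sub_le {n i : ℕ} {C : ℕ → Core} {a b : Core} {δ : ℝ} (hi : i + 2 ≤ n)
    (ha : a.d = (C i).d) (hb : b.d = (C (i + 1)).d)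
    (h : ‖a.s * b.s - (C i).s * (C (i + 1)).s‖ ≤ δ * ‖(C i).s * (C (i + 1)).s‖) :
    ‖∏ j ∈ Finset.range n, -((updateTwo C i a b j).sgn * (updateTwo C i a b j).s)
      - ∏ j ∈ Finset.range n, -((C j).sgn * (C j).s)‖
      ≤ δ * ‖∏ j ∈ Finset.range n, -((C j).sgn * (C j).s)‖ := by
  have sp : ∀ f : ℕ → ℂ, ∏ j ∈ Finset.range n, f j
      = f i * f (i + 1) * ∏ j ∈ ((Finset.range n).erase i).erase (i + 1), f j := by
    intro f
    rw [← Finset.mul_prod_erase (Finset.range n) f (Finset.mem_range.2 (by omega : i < n)),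
      ← Finset.mul_prod_erase ((Finset.range n).erase i) f
        (Finset.mem_erase.2 ⟨by omega, Finset.mem_range.2 (by omega : i + 1 < n)⟩), mul_assoc]
  rw [sp, sp]
  have hr : ∏ j ∈ ((Finset.range n).erase i).erase (i + 1),
      -((updateTwo C i a b j).sgn * (updateTwo C i a b j).s)
      = ∏ j ∈ ((Finset.range n).erase i).erase (i + 1), -((C j).sgn * (C j).s) := by
    refine Finset.prod_congr rfl fun j hj => ?_
    simp only [Finset.mem_erase] at hj
    rw [updateTwo_of_ne hj.2.1 hj.1]
  rw [hr, updateTwo_fst, updateTwo_snd]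
  set P := ∏ j ∈ ((Finset.range n).erase i).erase (i + 1), -((C j).sgn * (C j).s)
  have hsa : a.sgn = (C i).sgn := by simp [Core.sgn, ha]
  have hsb : b.sgn = (C (i + 1)).sgn := by simp [Core.sgn, hb]
  have e1 : -(a.sgn * a.s) * -(b.sgn * b.s) * P - -((C i).sgn * (C i).s) *
      -((C (i + 1)).sgn * (C (i + 1)).s) * P
      = (C i).sgn * (C (i + 1)).sgn * (a.s * b.s - (C i).s * (C (i + 1)).s) * P := by
    rw [hsa, hsb]; ring
  have e2 : -((C i).sgn * (C i).s) * -((C (i + 1)).sgn * (C (i + 1)).s) * P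
      = (C i).sgn * (C (i + 1)).sgn * ((C i).s * (C (i + 1)).s) * P := by ring
  rw [e1, e2]
  simp only [norm_mul _ P, norm_mul (_ * _) (_ - _), norm_mul (_ * _) (_ * _)]
  rw [norm_mul, Core.norm_sgn, Core.norm_sgn, one_mul, one_mul, ← mul_assoc]
  gcongr
  rwa [one_mul]


/-! ### Passing a core through the triangular factor -/

/-- The backward error of the triangular part of a state after `j` passes. The stored sequences `B`
and `C` represent, up to errors proportional to `j * u`, the matrices `Vᴴ * B₀ * U` and
`Vᴴ * C₀ * X`, with a unitary matrix `V` that fixes the first unit vector, and the number `ρ` has a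
small *relative* error. -/
structure TriTracks {n : ℕ} (u : ℝ) (B₀ C₀ : Matrix (Fin (n + 1)) (Fin (n + 1)) ℂ) (ρ₀ : ℂ)
    (j : ℕ) (S : State n) : Prop where
  near_B : ∀ i, i < n → (S.B i).Near (5 * u)
  near_C : ∀ i, i < n → (S.C i).Near (5 * u)
  s_C : ∀ i, i < n → (S.C i).s ≠ 0
  unitary_U : S.U ∈ Matrix.unitaryGroup (Fin n) ℂ
  unitary_X : S.X ∈ Matrix.unitaryGroup (Fin n) ℂ
  back : ∃ V ∈ Matrix.unitaryGroup (Fin (n + 1)) ℂ,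
    (∀ i, V i 0 = (1 : Matrix (Fin (n + 1)) (Fin (n + 1)) ℂ) i 0) ∧
    ‖S.Bhat - Vᴴ * B₀ * emb (n + 1) 0 S.U‖ ≤ j * (2 * 10 ^ 7 * u) ∧
    ‖S.Chat - Vᴴ * C₀ * emb (n + 1) 0 S.X‖ ≤ j * (2 * 10 ^ 7 * u)
  rho : ‖S.rhohat - ρ₀‖ ≤ ((1 + 2 * 10 ^ 7 * u) ^ j - 1) * ‖ρ₀‖

theorem TriTracks.congr {n : ℕ} {u : ℝ} {B₀ C₀ : Matrix (Fin (n + 1)) (Fin (n + 1)) ℂ} {ρ₀ : ℂ}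
    {j : ℕ} {S S' : State n} (h : TriTracks u B₀ C₀ ρ₀ j S) (hB : S'.B = S.B) (hC : S'.C = S.C)
    (hU : S'.U = S.U) (hX : S'.X = S.X) : TriTracks u B₀ C₀ ρ₀ j S' := by
  obtain ⟨Q, B, C, U, X⟩ := S
  obtain ⟨Q', B', C', U', X'⟩ := S'
  simp only at hB hC hU hX
  subst hB hC hU hX
  exact ⟨h.near_B, h.near_C, h.s_C, h.unitary_U, h.unitary_X, h.back, h.rho⟩

theorem emb_toMatrix {n i : ℕ} (g : Core) (hi : i + 2 ≤ n) :
    emb (n + 1) 0 (g.toMatrix n i) = g.toMatrix (n + 1) i := by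
  have := g.toMatrix_eq_emb (m := n + 1) (i := 0) hi
  rw [← this, zero_add]

/-- Multiplying an approximation `Vᴴ * M₀ * W` by unitary matrices on both sides. -/
theorem norm_sub_unitary_step_le {m : ℕ} {A A' M₀ V W D E : Matrix (Fin m) (Fin m) ℂ} {t δ : ℝ}
    (hD : D ∈ Matrix.unitaryGroup (Fin m) ℂ) (hE : E ∈ Matrix.unitaryGroup (Fin m) ℂ)
    (h : ‖A - Vᴴ * M₀ * W‖ ≤ t) (h' : ‖Dᴴ * A * E - A'‖ ≤ δ) :
    ‖A' - (V * D)ᴴ * M₀ * (W * E)‖ ≤ t + δ := by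
  have e : A' - (V * D)ᴴ * M₀ * (W * E)
      = Dᴴ * (A - Vᴴ * M₀ * W) * E - (Dᴴ * A * E - A') := by
    rw [Matrix.conjTranspose_mul]; noncomm_ring
  rw [e]
  refine (norm_sub_le _ _).trans (add_le_add ?_ h')
  rwa [norm_mul_unitary hE, norm_unitary_mul (conjTranspose_mem_unitaryGroup hD)]

/-- Passing a core through `R` adds one unit to the backward error. The ejected rotator `M` of `B`
is absorbed on both sides by `V`, the incoming core by `U`, and the core ejected from `C` by `X`;
the number `ρ` changes by a small relative amount because the turnover preserves the product of the
numbers `s`. -/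
theorem passR_tracks {n : ℕ} {u : ℝ} (F : FloatArith u)
    {B₀ C₀ : Matrix (Fin (n + 1)) (Fin (n + 1)) ℂ} {ρ₀ : ℂ} {i j : ℕ} {G : Core} {S : State n} (hu : u ≤ 1 / 10 ^ 6)
    (hnu : ((n + 1 : ℕ) : ℝ) * (20 * u) ≤ 1 / 2) (h : TriTracks u B₀ C₀ ρ₀ j S) (hi : i + 2 ≤ n)
    (hG : G.Near (5 * u)) (hd : G.d = 1) :
    TriTracks u B₀ C₀ ρ₀ (j + 1) (passR F i G S).1 ∧ (passR F i G S).2.Near (5 * u) ∧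
      (passR F i G S).2.d = 1 := by
  have h0 := F.u_nonneg
  have l520 : (5 : ℝ) * u ≤ 20 * u := by linarith
  have tb := turnover_spec F hu ((h.near_B i (by omega)).mono l520)
    ((h.near_B (i + 1) (by omega)).mono l520) (hG.mono l520) hd
  have hbdef : passR F i G S =
    (let b := turnover F (S.B i) (S.B (i + 1)) G
     let t := turnoverLR F b.1.inv (S.C i) (S.C (i + 1))
     let Y := t.2.2.inv
     ({ Q := S.Q
        B := updateTwo S.B i b.2.1 b.2.2
        C := updateTwo S.C i t.1 t.2.1
        U := S.U * G.unitize.toMatrix n i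
        X := S.X * Y.unitize.toMatrix n i }, Y)) := rfl
  rw [hbdef]
  generalize turnover F (S.B i) (S.B (i + 1)) G = b at tb ⊢
  obtain ⟨M, b₁, b₂⟩ := b
  have tc := turnoverLR_spec F hu (tb.near_fst.inv.mono l520) (K := M.inv) (tb.d_fst)
    ((h.near_C i (by omega)).mono l520) ((h.near_C (i + 1) (by omega)).mono l520)
  simp only
  generalize turnoverLR F M.inv (S.C i) (S.C (i + 1)) = t at tc ⊢
  obtain ⟨c₁, c₂, L⟩ := t
  have nM : M.Near (5 * u) := tb.near_fst
  have nL : L.Near (5 * u) := tc.near_thd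
  have dM : M.d = 1 := tb.d_fst
  have dL : L.d = 1 := tc.d_thd
  have pM := nM.size_pos F hu (by norm_num)
  have pL := nL.size_pos F hu (by norm_num)
  have pG := hG.size_pos F hu (by norm_num)
  have sc := tc.s_mul_s (h.s_C i (by omega)) (h.s_C (i + 1) (by omega))
  simp only at sc ⊢
  obtain ⟨V, hV, hV0, hBV, hCV⟩ := h.back
  refine ⟨⟨forall_updateTwo h.near_B tb.near_snd tb.near_thd,
    forall_updateTwo h.near_C tc.near_fst tc.near_snd, ?_, ?_, ?_, ?_, ?_⟩, nL.inv, dL⟩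
  · -- the product of the new `s` has a small relative error, hence is nonzero
    have hne : c₁.s * c₂.s ≠ 0 := by
      intro h0'
      rw [h0', zero_sub, norm_neg] at sc
      have : 0 < ‖(S.C i).s * (S.C (i + 1)).s‖ :=
        norm_pos_iff.2 (mul_ne_zero (h.s_C i (by omega)) (h.s_C (i + 1) (by omega)))
      nlinarith
    exact forall_updateTwo (p := fun g => g.s ≠ 0) h.s_C (left_ne_zero_of_mul hne)
      (right_ne_zero_of_mul hne)
  · exact mul_mem h.unitary_U (Core.unitize_toMatrix_unitary pG hi)
  · refine mul_mem h.unitary_X (Core.unitize_toMatrix_unitary ?_ hi)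
    rwa [Core.size_inv]
  · have uM := Core.unitize_toMatrix_unitary pM (m := n + 1) (i := i + 1) (by omega)
    have uG := Core.unitize_toMatrix_unitary pG (m := n + 1) (i := i) (by omega)
    have uL := Core.unitize_toMatrix_unitary pL (m := n + 1) (i := i) (by omega)
    have eB := norm_descProd_mul_sub_le (m := n + 1) (k := n) (X := G.unitize) (M := M.unitize)
      (a := b₁) (b := b₂) (by linarith : 0 ≤ 20 * u) hnu hi le_rfl
      fun j hj => (h.near_B j hj).mono l520
    have eC := norm_mul_descProd_sub_le (m := n + 1) (k := n) (K := M.inv.unitize) (L := L.unitize)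
      (a := c₁) (b := c₂) (by linarith : 0 ≤ 20 * u) hnu hi le_rfl
      fun j hj => (h.near_C j hj).mono l520
    have tbe := tb.err
    have tce := tc.err
    simp only at tbe tce
    have dMu : M.unitize.d = 1 := dM
    have dLu : L.unitize.d = 1 := dL
    refine ⟨V * M.unitize.toMatrix (n + 1) (i + 1), mul_mem hV uM, ?_, ?_, ?_⟩
    · -- the position `i + 1` of `M` is not the first, so that `e₁` is left alone
      intro k
      have hcol : ∀ l : Fin (n + 1), M.unitize.toMatrix (n + 1) (i + 1) l 0
          = (1 : Matrix (Fin (n + 1)) (Fin (n + 1)) ℂ) l 0 := by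
        intro l
        rw [Matrix.one_apply]
        simp [Core.toMatrix]
      rw [Matrix.mul_apply]
      simp only [hcol]
      rw [← Matrix.mul_apply, Matrix.mul_one, hV0]
    · rw [emb_mul (by omega), emb_toMatrix _ hi]
      have := norm_sub_unitary_step_le (A' := descProd (n + 1) n (updateTwo S.B i b₁ b₂))
        (δ := 2 * 10 ^ 7 * u) uM uG hBV (by
          rw [← norm_unitary_mul uM, Matrix.mul_sub, ← Matrix.mul_assoc, ← Matrix.mul_assoc,
            mul_conjTranspose_self_of_unitary uM, Matrix.one_mul]
          refine eB.trans ?_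
          linarith)
      refine this.trans ?_
      push_cast; linarith
    · rw [emb_mul (by omega), emb_toMatrix _ hi]
      have hY : L.inv.unitize.toMatrix (n + 1) i = (L.unitize.toMatrix (n + 1) i)ᴴ := by
        rw [Core.unitize_inv, Core.toMatrix_inv dLu]
      have hK : M.inv.unitize.toMatrix (n + 1) (i + 1) = (M.unitize.toMatrix (n + 1) (i + 1))ᴴ := by
        rw [Core.unitize_inv, Core.toMatrix_inv dMu]
      rw [hK] at eC
      rw [hY]
      have := norm_sub_unitary_step_le (A' := descProd (n + 1) n (updateTwo S.C i c₁ c₂))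
        (δ := 2 * 10 ^ 7 * u) uM (conjTranspose_mem_unitaryGroup uL) hCV (by
          rw [← norm_mul_unitary uL, Matrix.sub_mul, Matrix.mul_assoc _ _ (L.unitize.toMatrix _ _),
            conjTranspose_mul_self_of_unitary uL, Matrix.mul_one]
          refine eC.trans ?_
          linarith)
      refine this.trans ?_
      push_cast; linarith
  · -- `ρ` is a product of numbers of the form `± s`, of which two neighbours have changed
    rw [State.rhohat_eq]
    have e := norm_prod_updateTwo_sub_le hi tc.d_fst tc.d_snd sc
    have hρ := h.rho
    rw [State.rhohat_eq] at hρ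
    set P := ∏ j ∈ Finset.range n, -((S.C j).sgn * (S.C j).s)
    have k1 : ‖P‖ ≤ (1 + 2 * 10 ^ 7 * u) ^ j * ‖ρ₀‖ := by
      have := norm_le_norm_add_norm_sub' P ρ₀
      linarith
    refine (norm_sub_le_norm_sub_add_norm_sub _ P _).trans ((add_le_add e hρ).trans ?_)
    have k2 : 5000 * u * ‖P‖ ≤ 2 * 10 ^ 7 * u * ((1 + 2 * 10 ^ 7 * u) ^ j * ‖ρ₀‖) := by
      gcongr
      norm_num
    rw [pow_succ (1 + 2 * 10 ^ 7 * u) j]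
    generalize (1 + 2 * 10 ^ 7 * u) ^ j = w at k2 ⊢
    nlinarith


/-! ### One iteration -/

section Iteration

variable {n : ℕ} {u : ℝ} (F : FloatArith u)

/-- The cores of the unitary factor are unitary up to rounding. The bound is larger for the
deflated cores, which are no longer rescaled. -/
def QNear (u : ℝ) (Q : ℕ → Core) : Prop :=
  ∀ i, (Q i).Near (7 * u) ∧ ((Q i).s ≠ 0 → (Q i).Near (5 * u))

theorem QNear.update {Q : ℕ → Core} {i : ℕ} {a : Core} (h : QNear u Q) (h0 : 0 ≤ u)
    (ha : a.Near (5 * u)) : QNear u (Function.update Q i a) := by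
  intro j
  by_cases hj : j = i
  · subst hj
    rw [Function.update_self]
    exact ⟨ha.mono (by linarith), fun _ => ha⟩
  · rw [Function.update_of_ne hj]; exact h j

/-- Multiplying the entry `s` of a core by a number of modulus close to one. -/
theorem near_mul_s (hu : u ≤ 1 / 10 ^ 6) {Y : Core} (hY : Y.Near (5 * u)) {z : ℂ}
    (hz : |‖z‖ - 1| ≤ 7 * u) (d : ℤˣ) :
    (⟨Y.c, F.cmul z Y.s, d⟩ : Core).Near (20 * u) ∧ ‖F.cmul z Y.s - z * Y.s‖ ≤ 6 * u := by
  have h0 := F.u_nonneg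
  have e := F.norm_cmul_sub_le (by linarith) z Y.s
  obtain ⟨z1, z2⟩ := abs_le.1 hz
  have hs : ‖Y.s‖ ≤ 1 + 5 * u := Y.norm_s_le.trans hY.le
  have e1 : ‖z‖ * ‖Y.s‖ ≤ (1 + 7 * u) * (1 + 5 * u) := by gcongr; linarith
  have e2 : ‖F.cmul z Y.s - z * Y.s‖ ≤ 6 * u := by
    refine e.trans ?_
    have : ‖z‖ * ‖Y.s‖ ≤ 6 / 5 := by nlinarith
    nlinarith
  refine ⟨?_, e2⟩
  have k1 := abs_hyp_sub_hyp_le Y.c (F.cmul z Y.s) Y.c (z * Y.s)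
  have k2 := abs_hyp_sub_hyp_le Y.c ((‖z‖ : ℂ) * Y.s) Y.c Y.s
  have k3 : hyp Y.c ((‖z‖ : ℂ) * Y.s) = hyp Y.c (z * Y.s) := by simp [hyp]
  have k4 : ‖(‖z‖ : ℂ) * Y.s - Y.s‖ ≤ 7 * u * (1 + 5 * u) := by
    have : (‖z‖ : ℂ) * Y.s - Y.s = ((‖z‖ - 1 : ℝ) : ℂ) * Y.s := by push_cast; ring
    rw [this, norm_mul, Complex.norm_real, Real.norm_eq_abs]
    gcongr
  have k5 : |hyp Y.c Y.s - 1| ≤ 5 * u := hY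
  rw [sub_self, norm_zero, zero_add] at k1 k2
  rw [k3] at k2
  change |hyp Y.c (F.cmul z Y.s) - 1| ≤ 20 * u
  have t1 := abs_sub_le (hyp Y.c (F.cmul z Y.s)) (hyp Y.c (z * Y.s)) 1
  have t2 := abs_sub_le (hyp Y.c (z * Y.s)) (hyp Y.c Y.s) 1
  nlinarith

theorem norm_le_of_entries_three {A : Matrix (Fin 3) (Fin 3) ℂ} {δ : ℝ} (h : ∀ i j, ‖A i j‖ ≤ δ) :
    ‖A‖ ≤ 9 * δ := by
  refine (norm_le_sum_entries _).trans ?_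
  calc ∑ i, ∑ j, ‖A i j‖ ≤ ∑ _i : Fin 3, ∑ _j : Fin 3, δ :=
        Finset.sum_le_sum fun i _ => Finset.sum_le_sum fun j _ => h i j
    _ = 9 * δ := by simp; ring

theorem Core.abs_norm_c_sub_one_le {D : Core} {e : ℝ} (hD : D.Near e) (hs : D.s = 0) :
    |‖D.c‖ - 1| ≤ e := by
  have : D.size = ‖D.c‖ := by simp [size, hs, Real.sqrt_sq]
  rw [← this]; exact hD

theorem norm_mul_conj_sub_one_le (h0 : 0 ≤ u) (hu : u ≤ 1 / 10 ^ 6) {z : ℂ}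
    (hz : |‖z‖ - 1| ≤ 7 * u) : ‖z * conj z - 1‖ ≤ 15 * u := by
  rw [Complex.mul_conj, Complex.normSq_eq_norm_sq, ← Complex.ofReal_one, ← Complex.ofReal_sub,
    Complex.norm_real, Real.norm_eq_abs]
  obtain ⟨z1, z2⟩ := abs_le.1 hz
  exact abs_le.2 ⟨by nlinarith, by nlinarith⟩

/-- A core is moved from the right to the left of a deflated core below it. -/
theorem norm_diagonal_mul_sub_le (hu : u ≤ 1 / 10 ^ 6) {D Y : Core} (hD : D.Near (7 * u))
    (hDs : D.s = 0) (hY : Y.Near (5 * u)) (hYd : Y.d = 1) :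
    ‖D.toMatrix 3 1 * Y.unitize.toMatrix 3 0
      - (⟨Y.c, F.cmul D.c Y.s, Y.d⟩ : Core).toMatrix 3 0 * D.toMatrix 3 1‖ ≤ 500 * u := by
  have h0 := F.u_nonneg
  have hz := D.abs_norm_c_sub_one_le hD hDs
  have e := (near_mul_s F hu hY hz Y.d).2
  have e2 := norm_mul_conj_sub_one_le h0 hu hz
  have hs : ‖Y.s‖ ≤ 1 + 5 * u := Y.norm_s_le.trans hY.le
  have hc : ‖D.c‖ ≤ 1 + 7 * u := D.norm_c_le.trans hD.le
  set s' := F.cmul D.c Y.s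
  have hsY : Y.sgn = 1 := by rw [Core.sgn, hYd]; simp
  have hsY' : (⟨Y.c, s', Y.d⟩ : Core).sgn = 1 := by rw [Core.sgn, hYd]; simp
  have k1 : ‖D.toMatrix 3 1 * Y.toMatrix 3 0
      - (⟨Y.c, s', Y.d⟩ : Core).toMatrix 3 0 * D.toMatrix 3 1‖ ≤ 9 * (30 * u) := by
    refine norm_le_of_entries_three ?_
    have z1 : ‖D.c * Y.s - s'‖ ≤ 30 * u := by rw [norm_sub_rev]; linarith
    have z2 : ‖-conj Y.s + conj s' * D.c‖ ≤ 30 * u := by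
      have : -conj Y.s + conj s' * D.c
          = conj (s' - D.c * Y.s) * D.c + conj Y.s * (D.c * conj D.c - 1) := by
        rw [map_sub, map_mul]; ring
      rw [this]
      refine (norm_add_le _ _).trans ?_
      rw [norm_mul, norm_mul, RCLike.norm_conj, RCLike.norm_conj]
      have : ‖s' - D.c * Y.s‖ * ‖D.c‖ ≤ 6 * u * (1 + 7 * u) := by gcongr
      have : ‖Y.s‖ * ‖D.c * conj D.c - 1‖ ≤ (1 + 5 * u) * (15 * u) := by gcongr
      nlinarith
    have z3 : (0 : ℝ) ≤ 30 * u := by linarith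
    rw [Core.toMatrix_three_one, Core.toMatrix_three_zero, Core.toMatrix_three_zero, hsY, hsY', hDs]
    intro i j
    fin_cases i <;> fin_cases j <;>
      simp [z1, z2, z3, mul_comm (conj Y.c)]
  have k2 := (Core.norm_toMatrix_sub_unitize (hY.size_pos F hu (by norm_num)) (m := 3) (i := 0)
    (by norm_num)).trans hY
  have k3 := Core.norm_toMatrix_le (hD.size_pos F hu (by norm_num)) hD (m := 3) (i := 1)
    (by norm_num)
  have k4 : ‖D.toMatrix 3 1 * Y.unitize.toMatrix 3 0 - D.toMatrix 3 1 * Y.toMatrix 3 0‖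
      ≤ (1 + 7 * u) * (5 * u) := by
    rw [← Matrix.mul_sub]
    refine (Matrix.l2_opNorm_mul _ _).trans ?_
    rw [norm_sub_rev]
    gcongr
  have k5 := norm_sub_le_norm_sub_add_norm_sub (D.toMatrix 3 1 * Y.unitize.toMatrix 3 0)
    (D.toMatrix 3 1 * Y.toMatrix 3 0) ((⟨Y.c, s', Y.d⟩ : Core).toMatrix 3 0 * D.toMatrix 3 1)
  nlinarith

/-- The inverse of a core is moved from the left to the right of a deflated core above it. -/
theorem norm_mul_diagonal_sub_le (hu : u ≤ 1 / 10 ^ 6) {D G : Core} (hD : D.Near (7 * u))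
    (hDs : D.s = 0) (hG : G.Near (5 * u)) (hGd : G.d = 1) :
    ‖(G.unitize.toMatrix 3 1)ᴴ * D.toMatrix 3 0
      - D.toMatrix 3 0 * (⟨G.c, F.cmul (D.sgn * conj D.c) G.s, G.d⟩ : Core).inv.toMatrix 3 1‖
      ≤ 500 * u := by
  have h0 := F.u_nonneg
  have hz' := D.abs_norm_c_sub_one_le hD hDs
  have hz : |‖D.sgn * conj D.c‖ - 1| ≤ 7 * u := by
    rwa [norm_mul, Core.norm_sgn, one_mul, RCLike.norm_conj]
  have e := (near_mul_s F hu hG hz G.d).2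
  have e2 := norm_mul_conj_sub_one_le h0 hu hz
  have hs : ‖G.s‖ ≤ 1 + 5 * u := G.norm_s_le.trans hG.le
  have hc : ‖D.sgn * conj D.c‖ ≤ 1 + 7 * u := by have := (abs_le.1 hz).2; linarith
  have hδ : D.toMatrix 3 0 = !![D.c, 0, 0; 0, D.sgn * conj D.c, 0; 0, 0, 1] := by
    rw [Core.toMatrix_three_zero, hDs]; simp
  rw [hδ]
  set δ := D.sgn * conj D.c
  set s' := F.cmul δ G.s
  have hsY : G.sgn = 1 := by rw [Core.sgn, hGd]; simp
  have hsY' : (⟨G.c, s', G.d⟩ : Core).inv.sgn = 1 := by simp [Core.sgn, Core.inv, hGd]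
  have k1 : ‖(G.toMatrix 3 1)ᴴ * !![D.c, 0, 0; 0, δ, 0; 0, 0, 1]
      - !![D.c, 0, 0; 0, δ, 0; 0, 0, 1] * (⟨G.c, s', G.d⟩ : Core).inv.toMatrix 3 1‖
      ≤ 9 * (30 * u) := by
    refine norm_le_of_entries_three ?_
    have z1 : ‖-(G.s * δ) + s'‖ ≤ 30 * u := by
      have : -(G.s * δ) + s' = s' - δ * G.s := by ring
      rw [this]; linarith
    have z2 : ‖conj G.s - δ * conj s'‖ ≤ 30 * u := by
      have : conj G.s - δ * conj s'
          = -(conj (s' - δ * G.s) * δ + conj G.s * (δ * conj δ - 1)) := by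
        rw [map_sub, map_mul]; ring
      rw [this, norm_neg]
      refine (norm_add_le _ _).trans ?_
      rw [norm_mul _ δ, norm_mul (conj G.s), RCLike.norm_conj, RCLike.norm_conj]
      have : ‖s' - δ * G.s‖ * ‖δ‖ ≤ 6 * u * (1 + 7 * u) := by gcongr
      have : ‖G.s‖ * ‖δ * conj δ - 1‖ ≤ (1 + 5 * u) * (15 * u) := by gcongr
      nlinarith
    have z3 : (0 : ℝ) ≤ 30 * u := by linarith
    rw [Core.toMatrix_three_one, Core.toMatrix_three_one, hsY, hsY']
    intro i j
    fin_cases i <;> fin_cases j <;>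
      simp [Matrix.mul_apply, Fin.sum_univ_three, Core.inv, z1, z2, z3, mul_comm (conj G.c),
        Matrix.conjTranspose_apply]
  have k2 := (Core.norm_toMatrix_sub_unitize (hG.size_pos F hu (by norm_num)) (m := 3) (i := 1)
    (by norm_num)).trans hG
  have k3 := Core.norm_toMatrix_le (hD.size_pos F hu (by norm_num)) hD (m := 3) (i := 0)
    (by norm_num)
  rw [hδ] at k3
  have k4 : ‖(G.unitize.toMatrix 3 1)ᴴ * !![D.c, 0, 0; 0, δ, 0; 0, 0, 1]
      - (G.toMatrix 3 1)ᴴ * !![D.c, 0, 0; 0, δ, 0; 0, 0, 1]‖ ≤ (5 * u) * (1 + 7 * u) := by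
    rw [← Matrix.sub_mul, ← Matrix.conjTranspose_sub]
    refine (Matrix.l2_opNorm_mul _ _).trans ?_
    rw [Matrix.l2_opNorm_conjTranspose, norm_sub_rev]
    gcongr
  have k5 := norm_sub_le_norm_sub_add_norm_sub
    ((G.unitize.toMatrix 3 1)ᴴ * !![D.c, 0, 0; 0, δ, 0; 0, 0, 1])
    ((G.toMatrix 3 1)ᴴ * !![D.c, 0, 0; 0, δ, 0; 0, 0, 1])
    (!![D.c, 0, 0; 0, δ, 0; 0, 0, 1] * (⟨G.c, s', G.d⟩ : Core).inv.toMatrix 3 1)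
  nlinarith

end Iteration


/-! ### Chasing and deflation -/

section Sweep

variable {n : ℕ} {u : ℝ} (F : FloatArith u)

theorem TriTracks.mono {B₀ C₀ : Matrix (Fin (n + 1)) (Fin (n + 1)) ℂ} {ρ₀ : ℂ} {j j' : ℕ}
    {S : State n} (h : TriTracks u B₀ C₀ ρ₀ j S) (h0 : 0 ≤ u) (hj : j ≤ j') :
    TriTracks u B₀ C₀ ρ₀ j' S := by
  obtain ⟨V, hV, hV0, hB, hC⟩ := h.back
  have k : (j : ℝ) * (2 * 10 ^ 7 * u) ≤ j' * (2 * 10 ^ 7 * u) := by gcongr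
  refine ⟨h.near_B, h.near_C, h.s_C, h.unitary_U, h.unitary_X, ⟨V, hV, hV0, hB.trans k, hC.trans k⟩,
    h.rho.trans ?_⟩
  have : (1 + 2 * 10 ^ 7 * u) ^ j ≤ (1 + 2 * 10 ^ 7 * u) ^ j' :=
    pow_le_pow_right₀ (by linarith) hj
  gcongr

theorem QNear.near {Q : ℕ → Core} (h : QNear u Q) (h0 : 0 ≤ u) (i : ℕ) : (Q i).Near (20 * u) :=
  (h i).1.mono (by linarith)

/-- The fusion at the bottom of a chase: the misfit is absorbed by the last core of the active
block, after it has been moved past the deflated core below. -/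
theorem norm_bottom_fusion_le {Q : ℕ → Core} {i : ℕ} {Y : Core} (hu : u ≤ 1 / 10 ^ 6)
    (hnu : ((n + 1 : ℕ) : ℝ) * (20 * u) ≤ 1 / 2) (hi : i + 2 ≤ n) (hQ : QNear u Q)
    (hd : i + 2 < n → (Q (i + 1)).s = 0) (hY : Y.Near (5 * u)) (hYd : Y.d = 1) :
    let Y' : Core := if i + 2 < n then ⟨Y.c, F.cmul (Q (i + 1)).c Y.s, Y.d⟩ else Y
    (fuse F (Q i) Y').Near (5 * u) ∧
      ‖descProd n (n - 1) Q * Y.unitize.toMatrix n i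
        - descProd n (n - 1) (Function.update Q i (fuse F (Q i) Y'))‖ ≤ 20000 * u := by
  have h0 := F.u_nonneg
  have l520 : (5 : ℝ) * u ≤ 20 * u := by linarith
  have hnu' : (n : ℝ) * (20 * u) ≤ 1 / 2 := by push_cast at hnu; linarith
  have e0 : (0 : ℝ) ≤ 20 * u := by linarith
  have pos : ∀ j, 0 < (Q j).size := fun j => (hQ.near h0 j).size_pos F hu (by norm_num)
  intro Y'
  by_cases hin : i + 2 < n
  · have hY' : Y' = ⟨Y.c, F.cmul (Q (i + 1)).c Y.s, Y.d⟩ := if_pos hin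
    have hz := (Q (i + 1)).abs_norm_c_sub_one_le (hQ (i + 1)).1 (hd hin)
    have nY' : Y'.Near (20 * u) := by rw [hY']; exact (near_mul_s F hu hY hz Y.d).1
    obtain ⟨hf, ef⟩ := norm_fuse_sub_le F hu (hQ.near h0 i) nY' (m := 3) (i := 0) (by norm_num)
    refine ⟨hf, ?_⟩
    set f := fuse F (Q i) Y'
    have hup : Function.update Q i f = updateTwo Q i f (Q (i + 1)) := by
      funext j
      rcases eq_or_ne j i with rfl | h1
      · simp
      rcases eq_or_ne j (i + 1) with rfl | h2
      · rw [updateTwo_snd, Function.update_of_ne h1]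
      · rw [updateTwo_of_ne h1 h2, Function.update_of_ne h1]
    have hk : i + 2 ≤ n - 1 := by omega
    rw [hup, descProd_split_two n hk, descProd_updateTwo n hk]
    have c1 := segProd_commute_right (m := n) (i := i + 2) (len := n - 1 - (i + 2)) (G := Q)
      Y.unitize (j := i) le_rfl
    have n1 := norm_segProd_le_two e0 hnu' (by omega : 0 + i + 1 ≤ n) (G := Q)
      fun j _ _ => hQ.near h0 j
    have n2 := norm_segProd_le_two e0 hnu' (by omega : (i + 2) + (n - 1 - (i + 2)) + 1 ≤ n) (G := Q)
      fun j _ _ => hQ.near h0 j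
    have hm : i + 3 ≤ n := by omega
    set P := segProd n 0 i Q
    set R := segProd n (i + 2) (n - 1 - (i + 2)) Q
    have e1 : P * ((Q i).toMatrix n i * (Q (i + 1)).toMatrix n (i + 1)) * R * Y.unitize.toMatrix n i
        - P * (f.toMatrix n i * (Q (i + 1)).toMatrix n (i + 1)) * R
        = P * ((Q i).toMatrix n i * (Q (i + 1)).toMatrix n (i + 1) * Y.unitize.toMatrix n i
          - f.toMatrix n i * (Q (i + 1)).toMatrix n (i + 1)) * R := by
      rw [Matrix.mul_assoc _ R, c1.eq]
      noncomm_ring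
    rw [e1]
    refine (norm_mul_mul_le_four n1 n2).trans ?_
    have e2 : ‖(Q i).toMatrix n i * (Q (i + 1)).toMatrix n (i + 1) * Y.unitize.toMatrix n i
          - f.toMatrix n i * (Q (i + 1)).toMatrix n (i + 1)‖
        ≤ ‖(Q i).toMatrix 3 0 * (Q (i + 1)).toMatrix 3 1 * Y.unitize.toMatrix 3 0
          - f.toMatrix 3 0 * (Q (i + 1)).toMatrix 3 1‖ := by
      simp only [Core.toMatrix_eq_emb_three_zero _ n i, Core.toMatrix_eq_emb_three_one _ n i,
        ← emb_mul hm]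
      exact norm_emb_sub_le hm _ _
    have k1 := norm_diagonal_mul_sub_le F hu (hQ (i + 1)).1 (hd hin) hY hYd
    rw [← hY'] at k1
    have e3 : (Q i).toMatrix 3 0 * (Q (i + 1)).toMatrix 3 1 * Y.unitize.toMatrix 3 0
          - f.toMatrix 3 0 * (Q (i + 1)).toMatrix 3 1
        = (Q i).toMatrix 3 0 * ((Q (i + 1)).toMatrix 3 1 * Y.unitize.toMatrix 3 0
          - Y'.toMatrix 3 0 * (Q (i + 1)).toMatrix 3 1)
          + ((Q i).toMatrix 3 0 * Y'.toMatrix 3 0 - f.toMatrix 3 0) * (Q (i + 1)).toMatrix 3 1 := by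
      noncomm_ring
    have m1 := Core.norm_toMatrix_le (pos i) (hQ.near h0 i) (m := 3) (i := 0) (by norm_num)
    have m2 := Core.norm_toMatrix_le (pos (i + 1)) (hQ.near h0 (i + 1)) (m := 3) (i := 1)
      (by norm_num)
    have e4 : ‖(Q i).toMatrix 3 0 * (Q (i + 1)).toMatrix 3 1 * Y.unitize.toMatrix 3 0
          - f.toMatrix 3 0 * (Q (i + 1)).toMatrix 3 1‖
        ≤ (1 + 20 * u) * (500 * u) + 2000 * u * (1 + 20 * u) := by
      rw [e3]
      exact (norm_add_le _ _).trans (add_le_add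
        ((Matrix.l2_opNorm_mul _ _).trans (mul_le_mul m1 k1 (norm_nonneg _) (by linarith)))
        ((Matrix.l2_opNorm_mul _ _).trans (mul_le_mul ef m2 (norm_nonneg _) (by linarith))))
    refine (mul_le_mul_of_nonneg_left (e2.trans e4) (by norm_num)).trans ?_
    nlinarith
  · have hY' : Y' = Y := if_neg hin
    rw [hY']
    obtain ⟨hf, ef⟩ := norm_fuse_sub_le F hu (hQ.near h0 i) (hY.mono l520) hi
    refine ⟨hf, ?_⟩
    set f := fuse F (Q i) Y
    have hk : i + 1 ≤ n - 1 := by omega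
    have hlen : n - 1 - (i + 1) = 0 := by omega
    rw [descProd_split_one n hk, descProd_update n hk, hlen, segProd_zero]
    simp only [Matrix.mul_one]
    have n1 := norm_segProd_le_two e0 hnu' (by omega : 0 + i + 1 ≤ n) (G := Q)
      fun j _ _ => hQ.near h0 j
    set P := segProd n 0 i Q
    have e3 : P * (Q i).toMatrix n i * Y.unitize.toMatrix n i - P * f.toMatrix n i
        = P * ((Q i).toMatrix n i * (Y.unitize.toMatrix n i - Y.toMatrix n i)
          + ((Q i).toMatrix n i * Y.toMatrix n i - f.toMatrix n i)) := by
      noncomm_ring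
    rw [e3]
    have m1 := Core.norm_toMatrix_le (pos i) (hQ.near h0 i) (m := n) (i := i) hi
    have m2 : ‖Y.unitize.toMatrix n i - Y.toMatrix n i‖ ≤ 5 * u := by
      rw [norm_sub_rev]
      exact (Core.norm_toMatrix_sub_unitize (hY.size_pos F hu (by norm_num)) hi).trans hY
    calc _ ≤ ‖P‖ * (‖(Q i).toMatrix n i‖ * ‖Y.unitize.toMatrix n i - Y.toMatrix n i‖
          + ‖(Q i).toMatrix n i * Y.toMatrix n i - f.toMatrix n i‖) := by
          refine (Matrix.l2_opNorm_mul _ _).trans ?_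
          gcongr
          exact (norm_add_le _ _).trans (by gcongr; exact Matrix.l2_opNorm_mul _ _)
      _ ≤ 2 * ((1 + 20 * u) * (5 * u) + 2000 * u) := by gcongr
      _ ≤ 20000 * u := by nlinarith

/-- Chasing a misfit to the bottom. The hypothesis and the conclusion bound the backward error of
the unitary factor, in the hypothesis with the misfit still attached. Each turnover multiplies `Q`
on the left by the inverse of the new core, which `U` absorbs, and on the right by the core ejected
from `R`, which `X` absorbs. -/
theorem chase_tracks {B₀ C₀ : Matrix (Fin (n + 1)) (Fin (n + 1)) ℂ} {ρ₀ : ℂ}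
    {Q₀ : Matrix (Fin n) (Fin n) ℂ} (hu : u ≤ 1 / 10 ^ 6)
    (hnu : ((n + 1 : ℕ) : ℝ) * (20 * u) ≤ 1 / 2) {k i j : ℕ} {Y : Core} {S : State n} {t : ℝ}
    (hik : i + k + 2 ≤ n) (hQ : QNear u S.Q) (hd : i + k + 2 < n → (S.Q (i + k + 1)).s = 0)
    (hY : Y.Near (5 * u)) (hYd : Y.d = 1) (hT : TriTracks u B₀ C₀ ρ₀ j S)
    (h : ‖S.Qhat * Y.unitize.toMatrix n i - S.Uᴴ * Q₀ * S.X‖ ≤ t) :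
    TriTracks u B₀ C₀ ρ₀ (j + k) (chase F k i Y S) ∧ QNear u (chase F k i Y S).Q ∧
      ‖(chase F k i Y S).Qhat - (chase F k i Y S).Uᴴ * Q₀ * (chase F k i Y S).X‖
        ≤ t + (k + 1 : ℕ) * (10 ^ 7 * u) := by
  have h0 := F.u_nonneg
  have l520 : (5 : ℝ) * u ≤ 20 * u := by linarith
  have hnu' : (n : ℝ) * (20 * u) ≤ 1 / 2 := by push_cast at hnu; linarith
  induction k generalizing i j Y S t with
  | zero =>
    obtain ⟨hf, ef⟩ := norm_bottom_fusion_le F hu hnu (by omega) hQ (i := i)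
      (fun hh => hd (by omega)) hY hYd
    unfold chase
    refine ⟨hT.congr rfl rfl rfl rfl, hQ.update h0 hf, ?_⟩
    simp only [State.Qhat] at h ⊢
    refine (norm_sub_le_norm_sub_add_norm_sub _ (descProd n (n - 1) S.Q * Y.unitize.toMatrix n i)
      _).trans ?_
    rw [norm_sub_rev] at ef
    refine (add_le_add ef h).trans ?_
    push_cast
    linarith
  | succ k ih =>
    have ts := turnover_spec F hu (hQ.near h0 i) (hQ.near h0 (i + 1)) (hY.mono l520) hYd
    have hdef : chase F (k + 1) i Y S =
      (let t := turnover F (S.Q i) (S.Q (i + 1)) Y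
       let p := passR F (i + 1) t.1 { S with Q := updateTwo S.Q i t.2.1 t.2.2 }
       chase F k (i + 1) p.2 p.1) := rfl
    rw [hdef]
    generalize turnover F (S.Q i) (S.Q (i + 1)) Y = w at ts ⊢
    obtain ⟨M, a, b⟩ := w
    have nM : M.Near (5 * u) := ts.near_fst
    have err := ts.err
    simp only at err ⊢
    set S₁ : State n := { S with Q := updateTwo S.Q i a b } with hS₁
    have hT₁ : TriTracks u B₀ C₀ ρ₀ j S₁ := hT.congr rfl rfl rfl rfl
    obtain ⟨hT₂, nY', dY'⟩ := passR_tracks F hu hnu hT₁ (i := i + 1) (by omega) nM ts.d_fst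
    have uM := Core.unitize_toMatrix_unitary (nM.size_pos F hu (by norm_num)) (m := n) (i := i + 1)
      (by omega)
    have uY := Core.unitize_toMatrix_unitary (nY'.size_pos F hu (by norm_num)) (m := n) (i := i + 1)
      (by omega)
    have hQ₁ : QNear u S₁.Q := (hQ.update h0 ts.near_snd).update h0 ts.near_thd
    have hp : (passR F (i + 1) M S₁).1.Q = S₁.Q := rfl
    have hU : (passR F (i + 1) M S₁).1.U = S.U * M.unitize.toMatrix n (i + 1) := rfl
    have hX : (passR F (i + 1) M S₁).1.X
        = S.X * (passR F (i + 1) M S₁).2.unitize.toMatrix n (i + 1) := rfl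
    have eQ := norm_descProd_mul_sub_le (m := n) (k := n - 1) (X := Y.unitize) (M := M.unitize)
      (a := a) (b := b) (G := S.Q) (i := i) (by linarith : 0 ≤ 20 * u) hnu' (by omega) (by omega)
      fun j _ => hQ.near h0 j
    have step := norm_sub_unitary_step_le uM uY h
      (A' := S₁.Qhat * (passR F (i + 1) M S₁).2.unitize.toMatrix n (i + 1)) (δ := 10 ^ 7 * u) (by
        rw [← Matrix.sub_mul, norm_mul_unitary uY, ← norm_unitary_mul uM, Matrix.mul_sub,
          ← Matrix.mul_assoc, mul_conjTranspose_self_of_unitary uM, Matrix.one_mul]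
        refine eQ.trans ?_
        linarith)
    obtain ⟨r1, r2, r3⟩ := ih (i := i + 1) (j := j + 1) (S := (passR F (i + 1) M S₁).1)
      (Y := (passR F (i + 1) M S₁).2) (t := t + 10 ^ 7 * u) (by omega) (by rw [hp]; exact hQ₁)
      (by
        intro hlt
        rw [hp]
        have : S₁.Q (i + 1 + k + 1) = S.Q (i + (k + 1) + 1) := by
          rw [show i + (k + 1) + 1 = i + 1 + k + 1 by omega]
          exact updateTwo_of_ne (by omega) (by omega)
        rw [this]
        exact hd (by omega))
      nY' dY' hT₂
      (by rw [hU, hX]; exact step)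
    refine ⟨?_, r2, r3.trans ?_⟩
    · rw [show j + (k + 1) = j + 1 + k by omega]; exact r1
    · push_cast; linarith

/-- The fusion at the top of a sweep: the inverse of the starting core is absorbed by the first core
of the active block, after it has been moved past the deflated core above. -/
theorem norm_top_fusion_le {Q : ℕ → Core} {l : ℕ} {G : Core} (hu : u ≤ 1 / 10 ^ 6)
    (hnu : ((n + 1 : ℕ) : ℝ) * (20 * u) ≤ 1 / 2) (hl : l + 2 ≤ n) (hQ : QNear u Q)
    (hd : l ≠ 0 → (Q (l - 1)).s = 0) (hG : G.Near (5 * u)) (hGd : G.d = 1) :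
    let G' : Core := if l = 0 then G
      else ⟨G.c, F.cmul ((Q (l - 1)).sgn * conj (Q (l - 1)).c) G.s, G.d⟩
    (fuse F G'.inv (Q l)).Near (5 * u) ∧
      ‖(G.unitize.toMatrix n l)ᴴ * descProd n (n - 1) Q
        - descProd n (n - 1) (Function.update Q l (fuse F G'.inv (Q l)))‖ ≤ 20000 * u := by
  have h0 := F.u_nonneg
  have l520 : (5 : ℝ) * u ≤ 20 * u := by linarith
  have hnu' : (n : ℝ) * (20 * u) ≤ 1 / 2 := by push_cast at hnu; linarith
  have e0 : (0 : ℝ) ≤ 20 * u := by linarith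
  have pos : ∀ j, 0 < (Q j).size := fun j => (hQ.near h0 j).size_pos F hu (by norm_num)
  have hGud : G.unitize.d = 1 := hGd
  have pG := hG.size_pos F hu (by norm_num)
  intro G'
  obtain _ | i := l
  · have hG' : G' = G := if_pos rfl
    rw [hG']
    obtain ⟨hf, ef⟩ := norm_fuse_sub_le F hu (hG.inv.mono l520) (hQ.near h0 0) hl
    refine ⟨hf, ?_⟩
    set f := fuse F G.inv (Q 0)
    have hk : 0 + 1 ≤ n - 1 := by omega
    rw [descProd_split_one n hk, descProd_update n hk, segProd_zero]
    simp only [Matrix.one_mul]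
    have n1 := norm_segProd_le_two e0 hnu' (by omega : 0 + 1 + (n - 1 - (0 + 1)) + 1 ≤ n) (G := Q)
      fun j _ _ => hQ.near h0 j
    set R := segProd n (0 + 1) (n - 1 - (0 + 1)) Q
    rw [Core.toMatrix_inv hGd] at ef
    have e3 : (G.unitize.toMatrix n 0)ᴴ * ((Q 0).toMatrix n 0 * R) - f.toMatrix n 0 * R
        = ((G.unitize.toMatrix n 0 - G.toMatrix n 0)ᴴ * (Q 0).toMatrix n 0
          + ((G.toMatrix n 0)ᴴ * (Q 0).toMatrix n 0 - f.toMatrix n 0)) * R := by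
      rw [Matrix.conjTranspose_sub]
      noncomm_ring
    rw [e3]
    have m1 := Core.norm_toMatrix_le (pos 0) (hQ.near h0 0) (m := n) (i := 0) hl
    have m2 : ‖(G.unitize.toMatrix n 0 - G.toMatrix n 0)ᴴ‖ ≤ 5 * u := by
      rw [Matrix.l2_opNorm_conjTranspose, norm_sub_rev]
      exact (Core.norm_toMatrix_sub_unitize pG hl).trans hG
    calc _ ≤ (‖(G.unitize.toMatrix n 0 - G.toMatrix n 0)ᴴ‖ * ‖(Q 0).toMatrix n 0‖
          + ‖(G.toMatrix n 0)ᴴ * (Q 0).toMatrix n 0 - f.toMatrix n 0‖) * ‖R‖ := by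
          refine (Matrix.l2_opNorm_mul _ _).trans ?_
          gcongr
          exact (norm_add_le _ _).trans (by gcongr; exact Matrix.l2_opNorm_mul _ _)
      _ ≤ (5 * u * (1 + 20 * u) + 2000 * u) * 2 := by gcongr
      _ ≤ 20000 * u := by nlinarith
  · have hs : (Q i).s = 0 := hd (by omega)
    have hG' : G' = ⟨G.c, F.cmul ((Q i).sgn * conj (Q i).c) G.s, G.d⟩ := if_neg (by omega)
    have hz : |‖(Q i).sgn * conj (Q i).c‖ - 1| ≤ 7 * u := by
      rw [norm_mul, Core.norm_sgn, one_mul, RCLike.norm_conj]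
      exact (Q i).abs_norm_c_sub_one_le (hQ i).1 hs
    have nG' : G'.Near (20 * u) := by rw [hG']; exact (near_mul_s F hu hG hz G.d).1
    obtain ⟨hf, ef⟩ := norm_fuse_sub_le F hu nG'.inv (hQ.near h0 (i + 1)) (m := 3) (i := 1)
      (by norm_num)
    refine ⟨hf, ?_⟩
    set f := fuse F G'.inv (Q (i + 1))
    have hup : Function.update Q (i + 1) f = updateTwo Q i (Q i) f := by
      rw [updateTwo, Function.update_eq_self]
    have hk : i + 2 ≤ n - 1 := by omega
    rw [hup, descProd_split_two n hk, descProd_updateTwo n hk, ← Core.toMatrix_inv hGud]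
    have c1 := segProd_commute_left (m := n) (i := 0) (len := i) (G := Q)
      G.unitize.inv (j := i + 1) (by omega)
    have n1 := norm_segProd_le_two e0 hnu' (by omega : 0 + i + 1 ≤ n) (G := Q)
      fun j _ _ => hQ.near h0 j
    have n2 := norm_segProd_le_two e0 hnu' (by omega : (i + 2) + (n - 1 - (i + 2)) + 1 ≤ n) (G := Q)
      fun j _ _ => hQ.near h0 j
    have hm : i + 3 ≤ n := by omega
    set P := segProd n 0 i Q
    set R := segProd n (i + 2) (n - 1 - (i + 2)) Q
    have e1 : G.unitize.inv.toMatrix n (i + 1)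
          * (P * ((Q i).toMatrix n i * (Q (i + 1)).toMatrix n (i + 1)) * R)
        - P * ((Q i).toMatrix n i * f.toMatrix n (i + 1)) * R
        = P * (G.unitize.inv.toMatrix n (i + 1) * (Q i).toMatrix n i * (Q (i + 1)).toMatrix n (i + 1)
          - (Q i).toMatrix n i * f.toMatrix n (i + 1)) * R := by
      rw [← Matrix.mul_assoc, ← Matrix.mul_assoc, ← c1.eq]
      noncomm_ring
    rw [e1]
    refine (norm_mul_mul_le_four n1 n2).trans ?_
    have e2 : ‖G.unitize.inv.toMatrix n (i + 1) * (Q i).toMatrix n i * (Q (i + 1)).toMatrix n (i + 1)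
          - (Q i).toMatrix n i * f.toMatrix n (i + 1)‖
        ≤ ‖G.unitize.inv.toMatrix 3 1 * (Q i).toMatrix 3 0 * (Q (i + 1)).toMatrix 3 1
          - (Q i).toMatrix 3 0 * f.toMatrix 3 1‖ := by
      simp only [Core.toMatrix_eq_emb_three_zero _ n i, Core.toMatrix_eq_emb_three_one _ n i,
        ← emb_mul hm]
      exact norm_emb_sub_le hm _ _
    have k1 := norm_mul_diagonal_sub_le F hu (hQ i).1 hs hG hGd
    rw [← hG', ← Core.toMatrix_inv hGud] at k1
    have e3 : G.unitize.inv.toMatrix 3 1 * (Q i).toMatrix 3 0 * (Q (i + 1)).toMatrix 3 1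
          - (Q i).toMatrix 3 0 * f.toMatrix 3 1
        = (G.unitize.inv.toMatrix 3 1 * (Q i).toMatrix 3 0
          - (Q i).toMatrix 3 0 * G'.inv.toMatrix 3 1) * (Q (i + 1)).toMatrix 3 1
          + (Q i).toMatrix 3 0 * (G'.inv.toMatrix 3 1 * (Q (i + 1)).toMatrix 3 1
            - f.toMatrix 3 1) := by
      noncomm_ring
    have m1 := Core.norm_toMatrix_le (pos i) (hQ.near h0 i) (m := 3) (i := 0) (by norm_num)
    have m2 := Core.norm_toMatrix_le (pos (i + 1)) (hQ.near h0 (i + 1)) (m := 3) (i := 1)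
      (by norm_num)
    have e4 : ‖G.unitize.inv.toMatrix 3 1 * (Q i).toMatrix 3 0 * (Q (i + 1)).toMatrix 3 1
          - (Q i).toMatrix 3 0 * f.toMatrix 3 1‖
        ≤ 500 * u * (1 + 20 * u) + (1 + 20 * u) * (2000 * u) := by
      rw [e3]
      exact (norm_add_le _ _).trans (add_le_add
        ((Matrix.l2_opNorm_mul _ _).trans (mul_le_mul k1 m2 (norm_nonneg _) (by linarith)))
        ((Matrix.l2_opNorm_mul _ _).trans (mul_le_mul m1 ef (norm_nonneg _) (by linarith))))
    refine (mul_le_mul_of_nonneg_left (e2.trans e4) (by norm_num)).trans ?_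
    nlinarith

/-- One iteration before deflation, with at most `n` passes through `R`. -/
theorem sweep_tracks {B₀ C₀ : Matrix (Fin (n + 1)) (Fin (n + 1)) ℂ} {ρ₀ : ℂ}
    {Q₀ : Matrix (Fin n) (Fin n) ℂ} (hu : u ≤ 1 / 10 ^ 6)
    (hnu : ((n + 1 : ℕ) : ℝ) * (20 * u) ≤ 1 / 2) {l m j : ℕ} {q₁ q₂ : ℂ} {S : State n} {t : ℝ}
    (hact : ActiveBlock S l m) (hq : q₁ ≠ 0 ∨ q₂ ≠ 0) (hQ : QNear u S.Q)
    (hT : TriTracks u B₀ C₀ ρ₀ j S) (h : ‖S.Qhat - S.Uᴴ * Q₀ * S.X‖ ≤ t) :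
    TriTracks u B₀ C₀ ρ₀ (j + n) (sweep F l m q₁ q₂ S) ∧ QNear u (sweep F l m q₁ q₂ S).Q ∧
      ‖(sweep F l m q₁ q₂ S).Qhat - (sweep F l m q₁ q₂ S).Uᴴ * Q₀ * (sweep F l m q₁ q₂ S).X‖
        ≤ t + n * (10 ^ 7 * u) := by
  have h0 := F.u_nonneg
  obtain ⟨hlm, hmn, -, htop, hbot⟩ := hact
  have hhyp : 0 < hyp q₁ q₂ := hyp_pos hq
  have nG := mkCore_near F hu hhyp 1
  have dG : (mkCore F q₁ q₂ 1).d = 1 := rfl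
  have hdef : sweep F l m q₁ q₂ S =
    (let G := mkCore F q₁ q₂ 1
     let G' : Core := if l = 0 then G
       else ⟨G.c, F.cmul ((S.Q (l - 1)).sgn * conj (S.Q (l - 1)).c) G.s, G.d⟩
     let p := passR F l G { S with Q := Function.update S.Q l (fuse F G'.inv (S.Q l)) }
     chase F (m - l) l p.2 p.1) := rfl
  rw [hdef]
  generalize mkCore F q₁ q₂ 1 = G at nG dG ⊢
  obtain ⟨hf, ef⟩ := norm_top_fusion_le F hu hnu (by omega) hQ htop nG dG
  simp only at hf ef ⊢
  generalize fuse F (Core.inv (if l = 0 then G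
    else ⟨G.c, F.cmul ((S.Q (l - 1)).sgn * conj (S.Q (l - 1)).c) G.s, G.d⟩)) (S.Q l) = f at hf ef ⊢
  set S₁ : State n := { S with Q := Function.update S.Q l f } with hS₁
  have hT₁ : TriTracks u B₀ C₀ ρ₀ j S₁ := hT.congr rfl rfl rfl rfl
  obtain ⟨hT₂, nY, dY⟩ := passR_tracks F hu hnu hT₁ (i := l) (by omega) nG dG
  have uG := Core.unitize_toMatrix_unitary (nG.size_pos F hu (by norm_num)) (m := n) (i := l)
    (by omega)
  have uY := Core.unitize_toMatrix_unitary (nY.size_pos F hu (by norm_num)) (m := n) (i := l)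
    (by omega)
  have hU : (passR F l G S₁).1.U = S.U * G.unitize.toMatrix n l := rfl
  have hX : (passR F l G S₁).1.X = S.X * (passR F l G S₁).2.unitize.toMatrix n l := rfl
  have step := norm_sub_unitary_step_le uG uY h
    (A' := S₁.Qhat * (passR F l G S₁).2.unitize.toMatrix n l) (δ := 20000 * u) (by
      rw [← Matrix.sub_mul, norm_mul_unitary uY]
      exact ef)
  obtain ⟨r1, r2, r3⟩ := chase_tracks F hu hnu (k := m - l) (i := l) (j := j + 1)
    (S := (passR F l G S₁).1) (Y := (passR F l G S₁).2) (t := t + 20000 * u) (Q₀ := Q₀) (by omega)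
    (hQ.update h0 hf)
    (by
      intro hlt
      have : (passR F l G S₁).1.Q (l + (m - l) + 1) = S.Q (m + 1) := by
        rw [show l + (m - l) + 1 = m + 1 by omega]
        exact Function.update_of_ne (by omega) _ _
      rw [this]
      exact hbot (by omega))
    nY dY hT₂ (by rw [hU, hX]; exact step)
  refine ⟨r1.mono h0 (by omega), r2, r3.trans ?_⟩
  have : ((m - l + 1 : ℕ) : ℝ) + 1 ≤ n := by exact_mod_cast (by omega : m - l + 1 + 1 ≤ n)
  nlinarith

/-- Deflation perturbs each core by `O(u)`, hence `Q` by `O(nu)`, and leaves the rest of the state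
alone. -/
theorem deflate_tracks {B₀ C₀ : Matrix (Fin (n + 1)) (Fin (n + 1)) ℂ} {ρ₀ : ℂ}
    (hu : u ≤ 1 / 10 ^ 6) (hn : 1 ≤ n)
    (hnu : ((n + 1 : ℕ) : ℝ) * (20 * u) ≤ 1 / 2) {j : ℕ} {S : State n}
    (hQ : QNear u S.Q) (hT : TriTracks u B₀ C₀ ρ₀ j S) :
    TriTracks u B₀ C₀ ρ₀ j (deflate F S) ∧ QNear u (deflate F S).Q ∧
      ‖(deflate F S).Qhat - S.Qhat‖ ≤ n * (16 * u) := by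
  have h0 := F.u_nonneg
  have hnu' : (n : ℝ) * (20 * u) ≤ 1 / 2 := by push_cast at hnu; linarith
  have small : ∀ i, F.norm2 (S.Q i).s 0 ≤ u → ‖(S.Q i).s‖ ≤ 2 * u := by
    intro i hi
    have e := F.abs_norm2_sub_le (by linarith) (S.Q i).s 0
    have hh : hyp (S.Q i).s 0 = ‖(S.Q i).s‖ := by simp [hyp, Real.sqrt_sq]
    rw [hh] at e
    have := (abs_le.1 e).1
    nlinarith [norm_nonneg (S.Q i).s]
  have hdQ : ∀ i, (deflate F S).Q i
      = if F.norm2 (S.Q i).s 0 ≤ u then ⟨(S.Q i).c, 0, (S.Q i).d⟩ else S.Q i := fun i => rfl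
  have hQ' : QNear u (deflate F S).Q := by
    intro i
    rw [hdQ]
    split_ifs with hi
    · -- a core that was deflated before is not changed again, so that its defect does not grow
      refine ⟨?_, fun hne => absurd rfl hne⟩
      by_cases hs : (S.Q i).s = 0
      · have e : (⟨(S.Q i).c, 0, (S.Q i).d⟩ : Core) = S.Q i := by
          rw [← hs]
        rw [e]; exact (hQ i).1
      · have k1 : |hyp (S.Q i).c (S.Q i).s - 1| ≤ 5 * u := (hQ i).2 hs
        have k2 := abs_hyp_sub_hyp_le (S.Q i).c 0 (S.Q i).c (S.Q i).s
        rw [sub_self, norm_zero, zero_add, zero_sub, norm_neg] at k2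
        have k3 := small i hi
        change |hyp (S.Q i).c 0 - 1| ≤ 7 * u
        have := abs_sub_le (hyp (S.Q i).c 0) (hyp (S.Q i).c (S.Q i).s) 1
        linarith
    · exact hQ i
  refine ⟨hT.congr rfl rfl rfl rfl, hQ', ?_⟩
  rw [State.Qhat, State.Qhat, descProd_eq_segProd, descProd_eq_segProd]
  refine (norm_segProd_sub_le (by linarith : 0 ≤ 20 * u) hnu' (by omega : 0 + (n - 1) + 1 ≤ n)
    (fun i _ _ => hQ'.near h0 i) (fun i _ _ => hQ.near h0 i) (δ := 4 * u) fun i _ hi => ?_).trans ?_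
  · rw [hdQ]
    split_ifs with hs
    · refine (Core.norm_toMatrix_sub_le (g := ⟨(S.Q i).c, 0, (S.Q i).d⟩) (h := S.Q i) rfl
        (by omega)).trans ?_
      have := small i hs
      simp only [sub_self, norm_zero, zero_sub, norm_neg]
      linarith
    · rw [sub_self, norm_zero]; linarith
  · have : ((n - 1 : ℕ) : ℝ) ≤ n := by exact_mod_cast Nat.sub_le n 1
    nlinarith

/-- The backward error after any number of iterations, from that of the initial state. -/
theorem Run.tracks {a : Fin n → ℂ} {B₀ C₀ : Matrix (Fin (n + 1)) (Fin (n + 1)) ℂ} {ρ₀ : ℂ}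
    {Q₀ : Matrix (Fin n) (Fin n) ℂ} (hu : u ≤ 1 / 10 ^ 6) (hn : 1 ≤ n)
    (hnu : ((n + 1 : ℕ) : ℝ) * (20 * u) ≤ 1 / 2) {j N : ℕ} {S : State n}
    (hT : TriTracks u B₀ C₀ ρ₀ j (initState F a)) (hQ : QNear u (initState F a).Q)
    (hQ₀ : (initState F a).Qhat = Q₀) (hS : Run F a N S) :
    TriTracks u B₀ C₀ ρ₀ (j + N * n) S ∧ QNear u S.Q ∧
      ‖S.Qhat - S.Uᴴ * Q₀ * S.X‖ ≤ N * (n * (2 * 10 ^ 7 * u)) := by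
  have h0 := F.u_nonneg
  induction hS with
  | init =>
    refine ⟨by simpa using hT, hQ, ?_⟩
    have hU : (initState F a).U = 1 := rfl
    have hX : (initState F a).X = 1 := rfl
    simp [hQ₀, hU, hX]
  | @step N S h l m q₁ q₂ hact hq ih =>
    obtain ⟨i1, i2, i3⟩ := ih
    obtain ⟨s1, s2, s3⟩ := sweep_tracks F hu hnu hact hq i2 i1 i3
    obtain ⟨d1, d2, d3⟩ := deflate_tracks F hu hn hnu s2 s1
    refine ⟨?_, d2, ?_⟩
    · rwa [show j + (N + 1) * n = j + N * n + n by ring]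
    · have hU : (deflate F (sweep F l m q₁ q₂ S)).U = (sweep F l m q₁ q₂ S).U := rfl
      have hX : (deflate F (sweep F l m q₁ q₂ S)).X = (sweep F l m q₁ q₂ S).X := rfl
      rw [hU, hX]
      refine (norm_sub_le_norm_sub_add_norm_sub _ (sweep F l m q₁ q₂ S).Qhat _).trans
        ((add_le_add d3 s3).trans ?_)
      have : 0 ≤ (n : ℝ) * u := by positivity
      push_cast
      nlinarith

end Sweep


/-! ### The exact initial factorization -/

section Exact

variable {n : ℕ} (a : Fin n → ℂ)

/-- The exact norms of the tails of the coefficient vector. As in `tailNorm`, the sign of the last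
coefficient is kept. -/
noncomputable def exactTail : ℕ → ℝ
  | 0 => -1
  | j + 1 => hyp (zVec a (n - 1 - j)) (exactTail j : ℂ)

/-- The cores that the first step of the algorithm would compute in exact arithmetic. -/
noncomputable def exactC (k : ℕ) : Core :=
  ⟨conj (zVec a k) / (exactTail a (n - k) : ℂ),
    -((exactTail a (n - 1 - k) : ℂ) / (exactTail a (n - k) : ℂ)), 1⟩

/-- The reflector that exchanges two neighbouring positions. -/
def swapCore : Core := ⟨0, 1, -1⟩

/-- The exact initial matrix `C`. -/
noncomputable def exactChat : Matrix (Fin (n + 1)) (Fin (n + 1)) ℂ := descProd (n + 1) n (exactC a)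

theorem exactTail_succ (j : ℕ) :
    exactTail a (j + 1) = hyp (zVec a (n - 1 - j)) (exactTail a j : ℂ) := rfl

theorem one_le_abs_exactTail (j : ℕ) : 1 ≤ |exactTail a j| := by
  induction j with
  | zero => simp [exactTail]
  | succ j ih =>
    rw [exactTail_succ, abs_of_nonneg (hyp_nonneg _ _)]
    refine ih.trans ?_
    rw [← Real.norm_eq_abs, ← Complex.norm_real]
    exact norm_le_hyp_right _ _

theorem exactTail_ne_zero (j : ℕ) : exactTail a j ≠ 0 := by
  intro h
  have := one_le_abs_exactTail a j
  rw [h, abs_zero] at this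
  linarith

theorem exactTail_sq (j : ℕ) :
    exactTail a j ^ 2 = 1 + ∑ i ∈ Finset.range j, ‖zVec a (n - 1 - i)‖ ^ 2 := by
  induction j with
  | zero => simp [exactTail]
  | succ j ih =>
    rw [exactTail_succ, hyp_sq, Complex.norm_real, Real.norm_eq_abs, sq_abs, ih,
      Finset.sum_range_succ]
    ring

theorem sum_norm_zVec_sq : ∑ i ∈ Finset.range n, ‖zVec a i‖ ^ 2 = ∑ i, ‖a i‖ ^ 2 := by
  obtain _ | m := n
  · simp
  · rw [Fin.sum_univ_succ, Finset.sum_range_succ, Finset.sum_range, add_comm]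
    congr 1
    · simp [zVec]
    · refine Finset.sum_congr rfl fun i _ => ?_
      have : (i : ℕ) + 1 < m + 1 := by omega
      simp [zVec]
      congr

theorem exactTail_eq_alpha (hn : 1 ≤ n) : exactTail a n = alpha a := by
  have h1 : 0 ≤ exactTail a n := by
    obtain ⟨m, rfl⟩ : ∃ m, n = m + 1 := ⟨n - 1, by omega⟩
    exact hyp_nonneg _ _
  rw [alpha, ← Real.sqrt_sq h1, exactTail_sq, Finset.sum_range_reflect (fun i => ‖zVec a i‖ ^ 2) n,
    sum_norm_zVec_sq, add_comm]

theorem exactC_size {k : ℕ} (hk : k < n) : (exactC a k).size = 1 := by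
  have h1 : n - k = (n - 1 - k) + 1 := by omega
  have h2 : n - 1 - (n - 1 - k) = k := by omega
  have hpos : 0 < hyp (zVec a k) (exactTail a (n - 1 - k) : ℂ) :=
    hyp_pos (Or.inr (by exact_mod_cast exactTail_ne_zero a _))
  have h3 := norm_div_hyp_sq hpos
  have h4 : (exactC a k).size ^ 2 = 1 := by
    rw [Core.size_sq, exactC, h1, exactTail_succ, h2]
    simpa using h3
  exact (pow_eq_one_iff_of_nonneg (Core.size_nonneg _) two_ne_zero).1 h4

/-- The numbers `s` are quotients of successive tail norms, so that their product telescopes. -/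
theorem prod_neg_exactC_s {j : ℕ} (hj : j ≤ n) :
    ∏ i ∈ Finset.range j, -((exactC a i).sgn * (exactC a i).s)
      = (exactTail a (n - j) : ℂ) / (exactTail a n : ℂ) := by
  have hne : ∀ j, (exactTail a j : ℂ) ≠ 0 := fun j => by exact_mod_cast exactTail_ne_zero a j
  induction j with
  | zero => rw [Finset.prod_range_zero, Nat.sub_zero, div_self (hne n)]
  | succ j ih =>
    rw [Finset.prod_range_succ, ih (by omega)]
    have : n - 1 - j = n - (j + 1) := by omega
    have h1 := hne n
    have h2 := hne (n - j)
    simp only [exactC, this, Core.sgn, Units.val_one, Int.cast_one, one_mul, neg_neg]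
    field_simp

theorem exactChat_unitary : exactChat a ∈ Matrix.unitaryGroup (Fin (n + 1)) ℂ := by
  rw [exactChat, descProd_eq_segProd]
  exact segProd_unitary (by omega) fun j _ h => exactC_size a (by omega)

/-- The first row of the exact matrix `C`, which expresses that `C * z = α e₁`. -/
theorem exactChat_zero (hn : 1 ≤ n) (j : Fin (n + 1)) :
    exactChat a 0 j = conj (zVec a j) / (alpha a : ℂ) := by
  have hne : ∀ j, (exactTail a j : ℂ) ≠ 0 := fun j => by exact_mod_cast exactTail_ne_zero a j
  have hprod : ∀ j, j ≤ n → ∏ i ∈ Finset.range j, -((exactC a i).sgn * conj (exactC a i).s)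
      = (exactTail a (n - j) : ℂ) / (exactTail a n : ℂ) := by
    intro j hj
    rw [← prod_neg_exactC_s a hj]
    refine Finset.prod_congr rfl fun i _ => ?_
    simp [exactC]
  have h := descProd_row_zero (m := n + 1) (exactC a) n le_rfl j
  rw [← exactTail_eq_alpha a hn]
  refine h.trans ?_
  have h1 := hne n
  split_ifs with h2 h3
  · rw [hprod j h2.le]
    have h4 := hne (n - j)
    simp only [exactC]
    field_simp
  · rw [hprod n le_rfl, h3, Nat.sub_self]
    simp [exactTail, zVec]
  · omega

/-- A descending product of exchanges of neighbours is a cyclic shift of the first `k + 1`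
positions. -/
theorem descProd_swapCore (m k : ℕ) (hk : k + 1 ≤ m) :
    descProd m k (fun _ => swapCore) = Matrix.of fun i j : Fin m =>
      if (j : ℕ) < k then (if (i : ℕ) = j + 1 then 1 else 0)
      else if (j : ℕ) = k then (if (i : ℕ) = 0 then 1 else 0)
      else if i = j then 1 else 0 := by
  induction k with
  | zero =>
    have h1 : descProd m 0 (fun _ => swapCore) = 1 := rfl
    rw [h1]
    ext i j
    simp only [Matrix.one_apply, Matrix.of_apply, Fin.ext_iff]
    by_cases hj : (j : ℕ) = 0 <;> simp [hj]
  | succ k ih =>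
    have hS : ∀ l j : Fin m, swapCore.toMatrix m k l j = if (l : ℕ) =
        (if (j : ℕ) = k then k + 1 else if (j : ℕ) = k + 1 then k else j) then 1 else 0 := by
      intro l j
      have hsg : swapCore.sgn = -1 := by simp [Core.sgn, swapCore]
      simp only [Core.toMatrix, Matrix.of_apply, hsg, Fin.ext_iff]
      simp only [swapCore, map_one, map_zero, mul_zero, mul_one, neg_neg]
      by_cases h1 : (j : ℕ) = k
      · by_cases h2 : (l : ℕ) = k <;> simp [h1, h2]
      · by_cases h2 : (j : ℕ) = k + 1
        · by_cases h3 : (l : ℕ) = k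
          · simp [h2, h3]
          · by_cases h4 : (l : ℕ) = k + 1 <;> simp [h2, h3, h4]
        · simp [h1, h2]
    rw [descProd_succ, ih (by omega)]
    ext i j
    have hlt : (if (j : ℕ) = k then k + 1 else if (j : ℕ) = k + 1 then k else j) < m := by
      split_ifs <;> omega
    rw [Matrix.mul_apply, Finset.sum_eq_single ⟨_, hlt⟩]
    · rw [hS]
      simp only [Matrix.of_apply, if_true, mul_one, Fin.ext_iff]
      by_cases h1 : (j : ℕ) = k
      · simp [h1]
      · by_cases h2 : (j : ℕ) = k + 1
        · simp [h2]
        · have : (j : ℕ) < k ↔ (j : ℕ) < k + 1 := by omega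
          simp [h1, h2, this]
    · intro l _ hl
      rw [hS, if_neg, mul_zero]
      exact fun h => hl (Fin.ext h)
    · simp

theorem descProd_swapCore_eq_qFactor (hn : 1 ≤ n) :
    descProd n (n - 1) (fun _ => swapCore) = qFactor n := by
  rw [descProd_swapCore n (n - 1) (by omega)]
  ext i j
  simp only [qFactor, Matrix.of_apply]
  have hi := i.2
  have hj := j.2
  by_cases h1 : (j : ℕ) < n - 1
  · have h2 : ¬ (j : ℕ) + 1 = n := by omega
    simp [h1, h2]
  · have h2 : (j : ℕ) = n - 1 := by omega
    have h3 : ¬ (i : ℕ) = j + 1 := by omega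
    have h4 : (j : ℕ) + 1 = n := by omega
    rw [if_neg h1, if_pos h2, if_neg h3]
    simp [h4]

theorem swapCore_size : swapCore.size = 1 := by simp [Core.size, swapCore]

theorem qFactor_unitary (hn : 1 ≤ n) : qFactor n ∈ Matrix.unitaryGroup (Fin n) ℂ := by
  rw [← descProd_swapCore_eq_qFactor hn, descProd_eq_segProd]
  exact segProd_unitary (by omega) fun _ _ _ => swapCore_size

end Exact

/-! ### The computed initial factorization -/

theorem one_add_pow_le_linear {x : ℝ} {k : ℕ} (hx : 0 ≤ x) (h : k * x ≤ 1 / 2) :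
    (1 + x) ^ k ≤ 1 + 2 * (k * x) := by
  rcases Nat.eq_zero_or_pos k with rfl | hk
  · simp
  have hk1 : (1 : ℝ) ≤ k := by exact_mod_cast hk
  have hx1 : x ≤ 1 / 2 := by nlinarith
  have h1 : 1 - k * x ≤ (1 - x) ^ k := by
    have := one_add_mul_le_pow (by linarith : (-2 : ℝ) ≤ -x) k
    rw [← sub_eq_add_neg] at this
    linarith
  have h2 : (1 + x) ^ k * (1 - x) ^ k ≤ 1 := by
    rw [← mul_pow]
    exact pow_le_one₀ (by nlinarith) (by nlinarith)
  have h3 : 0 < (1 + x) ^ k := by positivity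
  have h4 : (1 + x) ^ k * (1 - k * x) ≤ 1 := (by gcongr : _ ≤ _).trans h2
  have h5 : 0 ≤ k * x := by positivity
  have h6 : 1 ≤ (1 + 2 * (k * x)) * (1 - k * x) := by nlinarith
  exact le_of_mul_le_mul_right (h4.trans h6) (by linarith)

/-- Relative errors of a quotient. -/
theorem norm_sub_div_le {f x x' : ℂ} {h t η : ℝ} (hη : η ≤ 1 / 100) (hη0 : 0 ≤ η) (ht : 0 < t)
    (hx : ‖x' - x‖ ≤ η * ‖x‖) (hh : |h - t| ≤ η * t)
    (hf : ‖f - x' / (h : ℂ)‖ ≤ η * ‖x' / (h : ℂ)‖) :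
    ‖f - x / (t : ℂ)‖ ≤ 4 * η * ‖x / (t : ℂ)‖ := by
  obtain ⟨h1, h2⟩ := abs_le.1 hh
  have hpos : 0 < h := by nlinarith
  have hc : (h : ℂ) ≠ 0 := by exact_mod_cast hpos.ne'
  have tc : (t : ℂ) ≠ 0 := by exact_mod_cast ht.ne'
  have e : x' / (h : ℂ) - x / (t : ℂ) = ((x' - x) - ((h - t : ℝ) : ℂ) / t * x) / h := by
    push_cast
    field_simp
    ring
  have k1 : ‖(x' - x) - ((h - t : ℝ) : ℂ) / t * x‖ ≤ 2 * η * ‖x‖ := by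
    refine (norm_sub_le _ _).trans ?_
    have : ‖((h - t : ℝ) : ℂ) / t * x‖ ≤ η * ‖x‖ := by
      rw [norm_mul, norm_div, Complex.norm_real, Complex.norm_real, Real.norm_eq_abs,
        Real.norm_eq_abs, abs_of_pos ht]
      gcongr
      rwa [div_le_iff₀ ht]
    linarith
  have k2 : ‖x' / (h : ℂ) - x / (t : ℂ)‖ ≤ 21 / 10 * η * ‖x / (t : ℂ)‖ := by
    rw [e, norm_div, norm_div, Complex.norm_real, Complex.norm_real, Real.norm_eq_abs,
      Real.norm_eq_abs, abs_of_pos ht, abs_of_pos hpos, div_le_iff₀ hpos]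
    refine k1.trans ?_
    have : 21 / 10 * η * (‖x‖ / t) * h = (21 / 10 * (h / t)) * η * ‖x‖ := by ring
    rw [this]
    have : 2 ≤ 21 / 10 * (h / t) := by
      have : 99 / 100 ≤ h / t := by rw [le_div_iff₀ ht]; nlinarith
      linarith
    gcongr
  have k3 := norm_le_norm_add_norm_sub' (x' / (h : ℂ)) (x / (t : ℂ))
  have k4 := norm_sub_le_norm_sub_add_norm_sub f (x' / (h : ℂ)) (x / (t : ℂ))
  have := norm_nonneg (x / (t : ℂ))
  have k5 : η * ‖x' / (h : ℂ)‖ ≤ η * ((1 + 21 / 10 * η) * ‖x / (t : ℂ)‖) := by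
    gcongr
    linarith
  have k6 : 0 ≤ η * ‖x / (t : ℂ)‖ := by positivity
  nlinarith

section Initial

variable {n : ℕ} {u : ℝ} (F : FloatArith u) (a : Fin n → ℂ)

/-- The relative errors of the tail norms grow linearly with the length of the tail, to first order
in `u`. -/
theorem abs_tailNorm_sub_le (hu : u ≤ 1 / 10 ^ 6) (j : ℕ) :
    |tailNorm F a j - exactTail a j| ≤ ((1 + 3 * u) ^ j - 1) * |exactTail a j| := by
  have h0 := F.u_nonneg
  induction j with
  | zero => simp [tailNorm, exactTail]
  | succ j ih =>
    have e1 := F.abs_norm2_sub_le (by linarith) (zVec a (n - 1 - j)) (tailNorm F a j : ℂ)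
    have e2 := abs_hyp_sub_hyp_le (zVec a (n - 1 - j)) (tailNorm F a j : ℂ) (zVec a (n - 1 - j))
      (exactTail a j : ℂ)
    have e3 : |exactTail a j| ≤ hyp (zVec a (n - 1 - j)) (exactTail a j : ℂ) := by
      rw [← Real.norm_eq_abs, ← Complex.norm_real]
      exact norm_le_hyp_right _ _
    rw [sub_self, norm_zero, zero_add, ← Complex.ofReal_sub, Complex.norm_real,
      Real.norm_eq_abs] at e2
    change |F.norm2 (zVec a (n - 1 - j)) (tailNorm F a j : ℂ) - _| ≤ _
    rw [exactTail_succ, abs_of_nonneg (hyp_nonneg _ _), pow_succ (1 + 3 * u)]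
    set H := hyp (zVec a (n - 1 - j)) (tailNorm F a j : ℂ)
    set H' := hyp (zVec a (n - 1 - j)) (exactTail a j : ℂ)
    have e4 : 1 ≤ (1 + 3 * u) ^ j := one_le_pow₀ (by linarith)
    set w := (1 + 3 * u) ^ j
    have e5 : |H - H'| ≤ (w - 1) * H' := e2.trans (ih.trans (by gcongr))
    have e6 : H ≤ w * H' := by have := (abs_le.1 e5).2; linarith
    have e7 := abs_sub_le (F.norm2 (zVec a (n - 1 - j)) (tailNorm F a j : ℂ)) H H'
    have e8 : 3 * u * H ≤ 3 * u * (w * H') := by gcongr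
    nlinarith

/-- The real division in the definition of `initC` is a case of the complex one. -/
theorem FloatArith.ofReal_fl_div (t r : ℝ) : ((F.fl (t / r) : ℝ) : ℂ) = F.cdiv (t : ℂ) r := by
  have h : F.fl 0 = 0 := by
    have := F.fl_err 0
    simpa using this
  apply Complex.ext <;> simp [cdiv, h]

/-- The stored initial cores are unitary up to rounding, and their entries have small relative
errors. -/
theorem initC_spec (hu : u ≤ 1 / 10 ^ 6) (hnu : (n : ℝ) * u ≤ 1 / 1000) {k : ℕ} (hk : k < n) :
    (initC F a k).Near (5 * u) ∧ (initC F a k).s ≠ 0 ∧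
      ‖(initC F a k).c - (exactC a k).c‖ ≤ 24 * (n * u) * ‖(exactC a k).c‖ ∧
      ‖(initC F a k).s - (exactC a k).s‖ ≤ 24 * (n * u) * ‖(exactC a k).s‖ := by
  have h0 := F.u_nonneg
  have h1 : n - k = (n - 1 - k) + 1 := by omega
  have h2 : n - 1 - (n - 1 - k) = k := by omega
  set j := n - 1 - k
  have hn1 : (1 : ℝ) ≤ n := by exact_mod_cast (by omega : 1 ≤ n)
  have hpos : 0 < hyp (zVec a k) (exactTail a j : ℂ) :=
    hyp_pos (Or.inr (by exact_mod_cast exactTail_ne_zero a _))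
  have hnu0 : 0 ≤ n * u := by positivity
  have hη : |tailNorm F a j - exactTail a j| ≤ 6 * (n * u) * |exactTail a j| := by
    refine (abs_tailNorm_sub_le F a hu j).trans ?_
    have hjn : (j : ℝ) * (3 * u) ≤ 3 * (n * u) := by
      have : (j : ℝ) ≤ n := by exact_mod_cast (by omega : j ≤ n)
      nlinarith
    have := one_add_pow_le_linear (x := 3 * u) (k := j) (by linarith) (by linarith)
    gcongr
    linarith
  have hxs : ‖(tailNorm F a j : ℂ) - (exactTail a j : ℂ)‖
      ≤ 6 * (n * u) * ‖(exactTail a j : ℂ)‖ := by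
    rw [← Complex.ofReal_sub, Complex.norm_real, Complex.norm_real]
    exact hη
  have ht0 : (tailNorm F a j : ℂ) ≠ 0 := by
    intro h
    rw [h, zero_sub, norm_neg] at hxs
    have : 0 < ‖(exactTail a j : ℂ)‖ :=
      norm_pos_iff.2 (by exact_mod_cast exactTail_ne_zero a j)
    nlinarith
  have hpos' : 0 < hyp (zVec a k) (tailNorm F a j : ℂ) := hyp_pos (Or.inr ht0)
  have hh : |hyp (zVec a k) (tailNorm F a j : ℂ) - hyp (zVec a k) (exactTail a j : ℂ)|
      ≤ 6 * (n * u) * hyp (zVec a k) (exactTail a j : ℂ) := by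
    have e2 := abs_hyp_sub_hyp_le (zVec a k) (tailNorm F a j : ℂ) (zVec a k) (exactTail a j : ℂ)
    rw [sub_self, norm_zero, zero_add] at e2
    refine e2.trans (hxs.trans ?_)
    gcongr
    exact norm_le_hyp_right _ _
  have hR : tailNorm F a (n - k) = F.norm2 (zVec a k) (tailNorm F a j : ℂ) := by
    rw [h1, tailNorm, h2]
  have hT : exactTail a (n - k) = hyp (zVec a k) (exactTail a j : ℂ) := by
    rw [h1, exactTail_succ, h2]
  have hc : (initC F a k).c = F.cdiv (conj (zVec a k)) (F.norm2 (zVec a k) (tailNorm F a j : ℂ)) := by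
    rw [← hR]; rfl
  have hs : (initC F a k).s
      = -F.cdiv (tailNorm F a j : ℂ) (F.norm2 (zVec a k) (tailNorm F a j : ℂ)) := by
    rw [← hR, ← F.ofReal_fl_div, ← Complex.ofReal_neg]; rfl
  have hc' : (exactC a k).c = conj (zVec a k) / (hyp (zVec a k) (exactTail a j : ℂ) : ℂ) := by
    rw [← hT]; rfl
  have hs' : (exactC a k).s = -((exactTail a j : ℂ) / (hyp (zVec a k) (exactTail a j : ℂ) : ℂ)) := by
    rw [← hT]; rfl
  have ec := norm_cdiv_norm2_sub_le F hu hpos' (conj (zVec a k))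
  have es := norm_cdiv_norm2_sub_le F hu hpos' (tailNorm F a j : ℂ)
  have hns : ∀ x y : ℂ, ‖-x - -y‖ = ‖x - y‖ := fun x y => by rw [← norm_neg]; congr 1; ring
  have l5 : 5 * u ≤ 6 * (n * u) := by nlinarith
  refine ⟨?_, ?_, ?_, ?_⟩
  · refine Core.near_of_relative (by linarith)
      (c := conj (zVec a k) / (hyp (zVec a k) (tailNorm F a j : ℂ) : ℂ))
      (s := -((tailNorm F a j : ℂ) / (hyp (zVec a k) (tailNorm F a j : ℂ) : ℂ))) ?_ ?_ ?_
    · have := norm_div_hyp_sq hpos'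
      simpa using this
    · rw [hc]; exact ec
    · rw [hs, hns, norm_neg]; exact es
  · rw [hs, neg_ne_zero]
    intro h
    rw [h, zero_sub, norm_neg] at es
    have : 0 < ‖(tailNorm F a j : ℂ) / (hyp (zVec a k) (tailNorm F a j : ℂ) : ℂ)‖ :=
      norm_pos_iff.2 (div_ne_zero ht0 (by exact_mod_cast hpos'.ne'))
    nlinarith
  · rw [hc, hc']
    refine (norm_sub_div_le (x' := conj (zVec a k)) (by linarith) (by linarith) hpos ?_ hh
      (ec.trans (by gcongr))).trans (le_of_eq (by ring))
    rw [sub_self, norm_zero]; positivity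
  · rw [hs, hs', hns, norm_neg]
    exact (norm_sub_div_le (by linarith) (by linarith) hpos hxs hh
      (es.trans (by gcongr))).trans (le_of_eq (by ring))

/-- Relative errors of factors are multiplied up in a product. -/
theorem norm_prod_sub_prod_le {x y : ℕ → ℂ} {δ : ℝ} (hδ : 0 ≤ δ) (k : ℕ)
    (h : ∀ i, i < k → ‖x i - y i‖ ≤ δ * ‖y i‖) :
    ‖∏ i ∈ Finset.range k, x i - ∏ i ∈ Finset.range k, y i‖
      ≤ ((1 + δ) ^ k - 1) * ‖∏ i ∈ Finset.range k, y i‖ := by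
  induction k with
  | zero => simp
  | succ k ih =>
    have ih' := ih fun i hi => h i (by omega)
    have hk := h k (by omega)
    rw [Finset.prod_range_succ, Finset.prod_range_succ, norm_mul, pow_succ]
    set X := ∏ i ∈ Finset.range k, x i
    set Y := ∏ i ∈ Finset.range k, y i
    have e : X * x k - Y * y k = (X - Y) * x k + Y * (x k - y k) := by ring
    have e1 : ‖x k‖ ≤ (1 + δ) * ‖y k‖ := by
      have := norm_le_norm_add_norm_sub' (x k) (y k)
      linarith
    have e2 : 1 ≤ (1 + δ) ^ k := one_le_pow₀ (by linarith)
    rw [e]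
    calc _ ≤ ‖X - Y‖ * ‖x k‖ + ‖Y‖ * ‖x k - y k‖ := by
          rw [← norm_mul, ← norm_mul]; exact norm_add_le _ _
      _ ≤ (((1 + δ) ^ k - 1) * ‖Y‖) * ((1 + δ) * ‖y k‖) + ‖Y‖ * (δ * ‖y k‖) := by
          gcongr
      _ = _ := by ring

/-- The columns of the active part of the last core of `B` are exchanged. -/
theorem initB_eq_mul_swapCore (hn : 1 ≤ n) :
    (initState F a).Bhat = (initState F a).Chat * swapCore.toMatrix (n + 1) (n - 1) := by
  obtain ⟨m, rfl⟩ : ∃ m, n = m + 1 := ⟨n - 1, by omega⟩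
  change descProd (m + 2) (m + 1) (initB F a)
    = descProd (m + 2) (m + 1) (initC F a) * swapCore.toMatrix (m + 2) m
  rw [descProd_succ, descProd_succ, Matrix.mul_assoc]
  congr 1
  · rw [descProd_eq_segProd, descProd_eq_segProd]
    refine segProd_congr fun j _ hj => ?_
    rw [initB, if_neg (by omega)]
  · have h1 : initB F a m = ⟨-conj (initC F a m).s, conj (initC F a m).c, -1⟩ := by
      rw [initB, if_pos rfl]
    have hd : (initC F a m).sgn = 1 := by simp [Core.sgn, initC]
    rw [h1]
    simp only [Core.toMatrix_eq_emb_two _ (m + 2) m]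
    rw [← emb_mul (by omega)]
    congr 1
    have hsg : (⟨-conj (initC F a m).s, conj (initC F a m).c, -1⟩ : Core).sgn = -1 := by
      simp [Core.sgn]
    have hsg' : swapCore.sgn = -1 := by simp [Core.sgn, swapCore]
    rw [Core.toMatrix_two, Core.toMatrix_two, Core.toMatrix_two, hsg, hd, hsg']
    ext i j
    fin_cases i <;> fin_cases j <;> simp [swapCore]

/-- The initial state has the backward error of `n * n` passes, with `V = 1`: each of the `n` cores
has an error `O(nu)`, inherited from the tail norms. -/
theorem initState_tracks (hu : u ≤ 1 / 10 ^ 6) (hn : 1 ≤ n) (hnu : (n : ℝ) * u ≤ 1 / 1000)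
    (hnu' : ((n + 1 : ℕ) : ℝ) * (20 * u) ≤ 1 / 2) :
    TriTracks u (exactChat a * swapCore.toMatrix (n + 1) (n - 1)) (exactChat a)
      (-1 / (alpha a : ℂ)) (n * n) (initState F a) := by
  have h0 := F.u_nonneg
  have hnu0 : 0 ≤ n * u := by positivity
  have uZ : swapCore.toMatrix (n + 1) (n - 1) ∈ Matrix.unitaryGroup (Fin (n + 1)) ℂ :=
    Core.toMatrix_unitary swapCore_size (by omega)
  have hC : ‖(initState F a).Chat - exactChat a‖ ≤ ((n * n : ℕ) : ℝ) * (2 * 10 ^ 7 * u) := by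
    change ‖descProd (n + 1) n (initC F a) - descProd (n + 1) n (exactC a)‖ ≤ _
    rw [descProd_eq_segProd, descProd_eq_segProd]
    refine (norm_segProd_sub_le (e := 20 * u) (δ := 96 * (n * u)) (by linarith) hnu' (by omega)
      (fun j _ hj => (initC_spec F a hu hnu (by omega)).1.mono (by linarith))
      (fun j _ hj => ?_) (fun j _ hj => ?_)).trans ?_
    · change |(exactC a j).size - 1| ≤ 20 * u
      rw [exactC_size a (by omega), sub_self, abs_zero]; linarith
    · obtain ⟨-, -, e1, e2⟩ := initC_spec F a hu hnu (by omega : j < n)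
      have s1 := exactC_size a (by omega : j < n)
      have k1 := (exactC a j).norm_c_le
      have k2 := (exactC a j).norm_s_le
      rw [s1] at k1 k2
      refine (Core.norm_toMatrix_sub_le (g := initC F a j) (h := exactC a j) rfl (by omega)).trans ?_
      nlinarith
    · push_cast
      have : 0 ≤ (n : ℝ) * n * u := by positivity
      nlinarith
  have hU : (initState F a).U = 1 := rfl
  have hX : (initState F a).X = 1 := rfl
  have hCdef : (initState F a).C = initC F a := rfl
  have hBdef : (initState F a).B = initB F a := rfl
  refine ⟨fun i hi => ?_, fun i hi => (initC_spec F a hu hnu hi).1,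
    fun i hi => (initC_spec F a hu hnu hi).2.1, one_mem _, one_mem _,
    ⟨1, one_mem _, fun _ => rfl, ?_, ?_⟩, ?_⟩
  · have h1 := (initC_spec F a hu hnu hi).1
    rw [hBdef, initB]
    split_ifs with h2
    · have : (⟨-conj (initC F a i).s, conj (initC F a i).c, -1⟩ : Core).size = (initC F a i).size := by
        simp [Core.size, add_comm]
      change |_ - 1| ≤ _
      rw [this]; exact h1
    · exact h1
  · rw [hU, emb_one, Matrix.conjTranspose_one, Matrix.one_mul, Matrix.mul_one,
      initB_eq_mul_swapCore F a hn, ← Matrix.sub_mul, norm_mul_unitary uZ]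
    exact hC
  · rw [hX, emb_one, Matrix.conjTranspose_one, Matrix.one_mul, Matrix.mul_one]
    exact hC
  · have hρ : (-1 / (alpha a : ℂ))
        = ∏ i ∈ Finset.range n, -((exactC a i).sgn * (exactC a i).s) := by
      rw [prod_neg_exactC_s a le_rfl, Nat.sub_self, exactTail_eq_alpha a hn]
      simp [exactTail]
    rw [State.rhohat_eq, hCdef, hρ]
    refine (norm_prod_sub_prod_le (δ := 24 * (n * u)) (by linarith) n fun i hi => ?_).trans ?_
    · have e := (initC_spec F a hu hnu hi).2.2.2
      have s1 : (initC F a i).sgn = 1 := by simp [Core.sgn, initC]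
      have s2 : (exactC a i).sgn = 1 := by simp [Core.sgn, exactC]
      rw [s1, s2, one_mul, one_mul, norm_neg, neg_sub_neg, norm_sub_rev]
      exact e
    · have k1 : 1 + 24 * (n * u) ≤ (1 + 2 * 10 ^ 7 * u) ^ n := by
        refine le_trans ?_ (one_add_mul_le_pow (by linarith : (-2 : ℝ) ≤ 2 * 10 ^ 7 * u) n)
        nlinarith
      have k2 : (1 + 24 * (n * u)) ^ n ≤ (1 + 2 * 10 ^ 7 * u) ^ (n * n) := by
        rw [pow_mul]
        gcongr
      gcongr

theorem initState_qNear : QNear u (initState F a).Q := by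
  have h0 := F.u_nonneg
  have : ∀ e, 0 ≤ e → swapCore.Near e := fun e he => by
    change |swapCore.size - 1| ≤ e
    rw [swapCore_size, sub_self, abs_zero]; exact he
  exact fun i => ⟨this _ (by linarith), fun _ => this _ (by linarith)⟩

end Initial


/-! ### The perturbation of the triangular factor -/

section Final

variable {n : ℕ}

theorem submatrix_castSucc (M : Matrix (Fin (n + 1)) (Fin (n + 1)) ℂ) :
    M.submatrix Fin.castSucc Fin.castSucc = (window (n + 1) 0 n)ᴴ * M * window (n + 1) 0 n := by
  have hw : ∀ (k : Fin (n + 1)) (i : Fin n), window (n + 1) 0 n k i = if k = i.castSucc then 1 else 0 := by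
    intro k i
    simp [window, Fin.ext_iff]
  ext i j
  rw [Matrix.mul_apply, Finset.sum_eq_single j.castSucc]
  · rw [Matrix.mul_apply, Finset.sum_eq_single i.castSucc]
    · simp [Matrix.conjTranspose_apply, hw]
    · intro k _ hk
      rw [Matrix.conjTranspose_apply, hw, if_neg hk, star_zero, zero_mul]
    · simp
  · intro k _ hk
    rw [hw, if_neg hk, mul_zero]
  · simp

theorem norm_submatrix_castSucc_le (M : Matrix (Fin (n + 1)) (Fin (n + 1)) ℂ) :
    ‖M.submatrix Fin.castSucc Fin.castSucc‖ ≤ ‖M‖ := by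
  rw [submatrix_castSucc]
  exact norm_conjTranspose_window_mul_mul_le (by omega) M

/-- Multiplying the leading block by `X` and `Uᴴ` is multiplying the extended matrix by the embedded
matrices. -/
theorem mul_submatrix_castSucc_mul (M : Matrix (Fin (n + 1)) (Fin (n + 1)) ℂ)
    (X U : Matrix (Fin n) (Fin n) ℂ) :
    X * M.submatrix Fin.castSucc Fin.castSucc * Uᴴ
      = (emb (n + 1) 0 X * M * (emb (n + 1) 0 U)ᴴ).submatrix Fin.castSucc Fin.castSucc := by
  have hP := window_conjTranspose_mul (m := n + 1) (i := 0) (w := n) (by omega)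
  rw [submatrix_castSucc, submatrix_castSucc]
  have h1 : ∀ N : Matrix (Fin n) (Fin n) ℂ,
      (window (n + 1) 0 n)ᴴ * emb (n + 1) 0 N = N * (window (n + 1) 0 n)ᴴ := by
    intro N
    rw [emb, Matrix.mul_add, ← Matrix.mul_assoc, ← Matrix.mul_assoc, hP, Matrix.one_mul,
      Matrix.sub_mul, Matrix.mul_one, Matrix.one_mul, add_sub_cancel]
  have h2 : (emb (n + 1) 0 U)ᴴ * window (n + 1) 0 n = window (n + 1) 0 n * Uᴴ := by
    have := congrArg Matrix.conjTranspose (h1 U)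
    simpa [Matrix.conjTranspose_mul] using this
  rw [← Matrix.mul_assoc, ← Matrix.mul_assoc, ← Matrix.mul_assoc, ← Matrix.mul_assoc, h1]
  simp only [Matrix.mul_assoc, h2]

theorem norm_column_le {m : ℕ} (M : Matrix (Fin m) (Fin m) ℂ) (k : Fin m) :
    ‖WithLp.toLp 2 (fun i => M i k)‖ ≤ ‖M‖ := by
  have h := Matrix.l2_opNorm_mulVec M (EuclideanSpace.single k 1)
  rw [PiLp.norm_single, norm_one, mul_one] at h
  refine le_trans (le_of_eq ?_) h
  congr 1
  ext i
  simp [Matrix.mulVec_single]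

theorem norm_column_castSucc_le (M : Matrix (Fin (n + 1)) (Fin (n + 1)) ℂ) (k : Fin (n + 1)) :
    ‖WithLp.toLp 2 (fun i : Fin n => M i.castSucc k)‖ ≤ ‖M‖ := by
  refine le_trans ?_ (norm_column_le M k)
  rw [EuclideanSpace.norm_eq, EuclideanSpace.norm_eq, Fin.sum_univ_castSucc]
  exact Real.sqrt_le_sqrt (by simp)

theorem norm_row_castSucc_le (M : Matrix (Fin (n + 1)) (Fin (n + 1)) ℂ) (k : Fin (n + 1)) :
    ‖WithLp.toLp 2 (fun j : Fin n => M k j.castSucc)‖ ≤ ‖M‖ := by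
  have h := norm_column_castSucc_le Mᴴ k
  rw [Matrix.l2_opNorm_conjTranspose] at h
  refine le_trans (le_of_eq ?_) h
  simp [EuclideanSpace.norm_eq]

/-- The triangular factor in terms of the transformed matrices `C'` and `B'`. -/
theorem State.mul_Rhat_mul (S : State n) {V : Matrix (Fin (n + 1)) (Fin (n + 1)) ℂ}
    (hV : V ∈ Matrix.unitaryGroup (Fin (n + 1)) ℂ)
    (hV0 : ∀ i, V i 0 = (1 : Matrix (Fin (n + 1)) (Fin (n + 1)) ℂ) i 0)
    {C' B' : Matrix (Fin (n + 1)) (Fin (n + 1)) ℂ}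
    (hC : C' = V * S.Chat * (emb (n + 1) 0 S.X)ᴴ) (hB : B' = V * S.Bhat * (emb (n + 1) 0 S.U)ᴴ) :
    S.X * S.Rhat * S.Uᴴ = (C'ᴴ * B').submatrix Fin.castSucc Fin.castSucc
      + Matrix.vecMulVec (fun i : Fin n => C'ᴴ i.castSucc 0)
        (fun j : Fin n => -S.rhohat⁻¹ * (C'ᴴ * B') (Fin.last n) j.castSucc) := by
  set X' := emb (n + 1) 0 S.X
  set U' := emb (n + 1) 0 S.U
  have hV0' : ∀ i, Vᴴ i 0 = (1 : Matrix (Fin (n + 1)) (Fin (n + 1)) ℂ) i 0 := by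
    intro i
    have h := congrFun (congrFun (conjTranspose_mul_self_of_unitary hV) i) 0
    rw [Matrix.mul_apply] at h
    simp only [hV0] at h
    rwa [← Matrix.mul_apply, Matrix.mul_one] at h
  have hlast : ∀ k, X' (Fin.last n) k = if Fin.last n = k then 1 else 0 :=
    fun k => emb_apply_of_left _ (Or.inr (by simp))
  have hC' : C'ᴴ = X' * S.Chatᴴ * Vᴴ := by
    rw [hC]; simp [Matrix.conjTranspose_mul, Matrix.mul_assoc]
  have hH : C'ᴴ * B' = X' * S.Ruhat * U'ᴴ := by
    have e : C'ᴴ * B' = X' * S.Chatᴴ * (Vᴴ * V) * S.Bhat * U'ᴴ := by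
      rw [hC', hB]; noncomm_ring
    rw [e, conjTranspose_mul_self_of_unitary hV, State.Ruhat]
    noncomm_ring
  rw [State.Rhat, mul_submatrix_castSucc_mul, State.extRhat, Matrix.mul_add, Matrix.mul_add,
    Matrix.add_mul, ← State.Ruhat, ← hH]
  have split : ∀ M N : Matrix (Fin (n + 1)) (Fin (n + 1)) ℂ,
      (M + N).submatrix Fin.castSucc Fin.castSucc
        = M.submatrix Fin.castSucc Fin.castSucc + N.submatrix Fin.castSucc Fin.castSucc :=
    fun _ _ => rfl
  rw [split]
  congr 1
  rw [Matrix.mul_vecMulVec, Matrix.mul_vecMulVec, Matrix.vecMulVec_mul]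
  · ext i j
    simp only [Matrix.submatrix_apply, Matrix.vecMulVec_apply]
    congr 1
    · rw [hC', Matrix.mul_apply]
      simp only [hV0']
      rw [← Matrix.mul_apply, Matrix.mul_one, Matrix.mulVec_mulVec, Matrix.mulVec_single_one]
      rfl
    · have h1 : (C'ᴴ * B') (Fin.last n) j.castSucc = (S.Ruhat * U'ᴴ) (Fin.last n) j.castSucc := by
        rw [hH, Matrix.mul_assoc, Matrix.mul_apply, Finset.sum_eq_single (Fin.last n)]
        · rw [hlast, if_pos rfl, one_mul]
        · intro k _ hk
          rw [hlast, if_neg (Ne.symm hk), zero_mul]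
        · simp
      rw [h1, Matrix.mul_apply, Finset.mul_sum]
      simp only [Matrix.vecMul, dotProduct, State.alphaYhat]
      exact Finset.sum_congr rfl fun k _ => by ring

theorem alpha_sq (a : Fin n → ℂ) : alpha a ^ 2 = ∑ i, ‖a i‖ ^ 2 + 1 :=
  Real.sq_sqrt (by positivity)

theorem one_le_alpha (a : Fin n → ℂ) : 1 ≤ alpha a :=
  Real.le_sqrt_of_sq_le (by have : 0 ≤ ∑ i, ‖a i‖ ^ 2 := by positivity
                            linarith)

theorem swapCore_matrix_apply (hn : 1 ≤ n) (i j : Fin (n + 1)) :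
    swapCore.toMatrix (n + 1) (n - 1) i j
      = if (j : ℕ) + 1 = n then (if (i : ℕ) = n then 1 else 0)
        else if (j : ℕ) = n then (if (i : ℕ) + 1 = n then 1 else 0) else if i = j then 1 else 0 := by
  have hsg : swapCore.sgn = -1 := by simp [Core.sgn, swapCore]
  have h1 : ∀ k : ℕ, k = n - 1 ↔ k + 1 = n := fun k => by omega
  have h2 : n - 1 + 1 = n := by omega
  simp only [Core.toMatrix, Matrix.of_apply, hsg, h1, h2]
  simp only [swapCore, map_one, map_zero, mul_zero, mul_one, neg_neg, Fin.ext_iff]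
  by_cases a1 : (j : ℕ) + 1 = n
  · have a2 : ¬ (j : ℕ) = n := by omega
    by_cases a3 : (i : ℕ) = n
    · simp [a1, a2, a3]
    · by_cases a4 : (i : ℕ) + 1 = n
      · simp [a1, a3, a4]
      · have : ¬ (i : ℕ) = j := by omega
        simp [a1, a2, a3, a4, this]
  · by_cases a2 : (j : ℕ) = n
    · by_cases a4 : (i : ℕ) + 1 = n
      · simp [a2, a4]
      · by_cases a3 : (i : ℕ) = n <;> simp [a2, a4, a3]
    · simp [a1, a2]

theorem norm_yVec_le : ‖yVec n‖ ≤ 1 := by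
  obtain _ | m := n
  · simp [EuclideanSpace.norm_eq]
  · have h : yVec (m + 1) = EuclideanSpace.single (Fin.last m) 1 := by
      ext i
      simp [yVec, Fin.ext_iff]
    rw [h]; simp

/-- Perturbations of the matrices `C`, `B` and of the number `ρ` that represent the triangular
factor become a perturbation of that factor which is structured up to second order: with
`C* B = Z + Δ`, the matrix `δRu` is the leading block of `Δ`, the vector `δx` is the perturbation of
the first column of `C*`, and `δy` collects the last row of `Δ` and the relative error of `ρ`. -/
theorem exists_structured_perturbation (hn : 1 ≤ n) (a : Fin n → ℂ)
    {C' B' : Matrix (Fin (n + 1)) (Fin (n + 1)) ℂ} {ρ : ℂ} {e : ℝ} (he : e ≤ 1 / 100)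
    (hC : ‖C' - exactChat a‖ ≤ e)
    (hB : ‖B' - exactChat a * swapCore.toMatrix (n + 1) (n - 1)‖ ≤ e)
    (hρ : ‖ρ - -1 / (alpha a : ℂ)‖ ≤ 2 * e * ‖-1 / (alpha a : ℂ)‖) :
    ∃ (δRu : Matrix (Fin n) (Fin n) ℂ) (δx δy : EuclideanSpace ℂ (Fin n)),
      (C'ᴴ * B').submatrix Fin.castSucc Fin.castSucc
        + Matrix.vecMulVec (fun i : Fin n => C'ᴴ i.castSucc 0)
          (fun j : Fin n => -ρ⁻¹ * (C'ᴴ * B') (Fin.last n) j.castSucc)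
        = rFactor a + (δRu + (alpha a : ℂ) •
          (Matrix.vecMulVec δx.ofLp (yVec n).ofLp + Matrix.vecMulVec (xVec a).ofLp δy.ofLp)
          + (alpha a : ℂ) • Matrix.vecMulVec δx.ofLp δy.ofLp) ∧
      ‖δRu‖ ≤ 3 * e ∧ ‖δx‖ ≤ e ∧ ‖δy‖ ≤ 10 * e := by
  have he0 : 0 ≤ e := (norm_nonneg _).trans hC
  have hα := one_le_alpha a
  have αc : (alpha a : ℂ) ≠ 0 := by
    have : alpha a ≠ 0 := by linarith
    exact_mod_cast this
  have uC := exactChat_unitary a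
  have hC0 := exactChat_zero a hn
  have hZe := swapCore_matrix_apply hn
  have uZ : swapCore.toMatrix (n + 1) (n - 1) ∈ Matrix.unitaryGroup (Fin (n + 1)) ℂ :=
    Core.toMatrix_unitary swapCore_size (by omega)
  set C₀ := exactChat a
  set Z := swapCore.toMatrix (n + 1) (n - 1)
  set Δ := C'ᴴ * B' - Z with hΔ
  have nΔ : ‖Δ‖ ≤ 3 * e := by
    have e1 : Δ = (C' - C₀)ᴴ * B' + C₀ᴴ * (B' - C₀ * Z) := by
      rw [hΔ, Matrix.conjTranspose_sub, Matrix.sub_mul, Matrix.mul_sub, ← Matrix.mul_assoc C₀ᴴ C₀ Z,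
        conjTranspose_mul_self_of_unitary uC, Matrix.one_mul]
      abel
    have n1 : ‖B'‖ ≤ 1 + e := by
      have := norm_le_norm_add_norm_sub' B' (C₀ * Z)
      have := norm_le_one_of_unitary (mul_mem uC uZ)
      linarith
    rw [e1]
    refine (norm_add_le _ _).trans ?_
    rw [norm_unitary_mul (conjTranspose_mem_unitaryGroup uC)]
    have : ‖(C' - C₀)ᴴ * B'‖ ≤ e * (1 + e) := by
      refine (Matrix.l2_opNorm_mul _ _).trans ?_
      rw [Matrix.l2_opNorm_conjTranspose]
      exact mul_le_mul hC n1 (norm_nonneg _) he0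
    nlinarith
  -- `-ρ⁻¹ = α * β` with a number `β` close to one: this needs the *relative* error of `ρ`, since `α`
  -- may be arbitrarily large
  set β : ℂ := -ρ⁻¹ / alpha a with hβ
  have nβ : ‖β - 1‖ ≤ 4 * e := by
    have k1 : ‖alpha a * ρ + 1‖ ≤ 2 * e := by
      have k2 : (alpha a : ℂ) * ρ + 1 = alpha a * (ρ - -1 / (alpha a : ℂ)) := by field_simp; ring
      have k3 : ‖(alpha a : ℂ)‖ * ‖-1 / (alpha a : ℂ)‖ = 1 := by
        rw [← norm_mul, mul_div_cancel₀ _ αc, norm_neg, norm_one]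
      rw [k2, norm_mul]
      calc _ ≤ ‖(alpha a : ℂ)‖ * (2 * e * ‖-1 / (alpha a : ℂ)‖) := by gcongr
        _ = 2 * e * (‖(alpha a : ℂ)‖ * ‖-1 / (alpha a : ℂ)‖) := by ring
        _ = 2 * e := by rw [k3, mul_one]
    have k4 : 1 - 2 * e ≤ ‖alpha a * ρ‖ := by
      have h5 := norm_sub_le (alpha a * ρ + 1) (alpha a * ρ)
      rw [add_sub_cancel_left, norm_one] at h5
      linarith
    have hρ0 : ρ ≠ 0 := by
      rintro rfl
      rw [mul_zero, norm_zero] at k4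
      linarith
    have k5 : β - 1 = -(alpha a * ρ + 1) / (alpha a * ρ) := by
      rw [hβ]; field_simp; ring
    rw [k5, norm_div, norm_neg, div_le_iff₀ (by linarith)]
    nlinarith
  have nβ' : ‖β‖ ≤ 2 := by
    have := norm_le_norm_add_norm_sub' β 1
    rw [norm_one] at this
    linarith
  have hβα : -ρ⁻¹ = alpha a * β := by rw [hβ]; field_simp
  set f : EuclideanSpace ℂ (Fin n) := WithLp.toLp 2 fun j => Δ (Fin.last n) j.castSucc with hf
  have nf : ‖f‖ ≤ 3 * e := (norm_row_castSucc_le Δ _).trans nΔ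
  have ny := norm_yVec_le (n := n)
  refine ⟨Δ.submatrix Fin.castSucc Fin.castSucc,
    WithLp.toLp 2 fun i => (C' - C₀)ᴴ i.castSucc 0, β • f + (β - 1) • yVec n, ?_,
    (norm_submatrix_castSucc_le Δ).trans nΔ, ?_, ?_⟩
  · -- without `Δ`, the leading block of `Z` has a zero last column, which the rank-one part fills
    have hH : C'ᴴ * B' = Z + Δ := by rw [hΔ]; abel
    ext i j
    have hi := i.2
    have hj := j.2
    have r1 : ¬ (j : ℕ) = n := by omega
    have r2 : ¬ (i : ℕ) = n := by omega
    have r3 : ¬ Fin.last n = j.castSucc := fun h => by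
      have := congrArg Fin.val h; simp at this; omega
    have hx : C'ᴴ i.castSucc 0 = zVec a i / (alpha a : ℂ) + (C' - C₀)ᴴ i.castSucc 0 := by
      have : C₀ᴴ i.castSucc 0 = zVec a i / (alpha a : ℂ) := by
        rw [Matrix.conjTranspose_apply, hC0]
        simp
      rw [Matrix.conjTranspose_sub, Matrix.sub_apply, this]; ring
    simp only [Matrix.add_apply, Matrix.submatrix_apply, Matrix.vecMulVec_apply, Matrix.smul_apply,
      smul_eq_mul, hH, hx, hβα, hZe, rFactor, Matrix.of_apply, yVec, xVec, PiLp.add_apply,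
      PiLp.smul_apply, hf]
    by_cases hj1 : (j : ℕ) + 1 = n
    · simp [hj1, r2]
      field_simp
      ring
    · simp [hj1, r1, r3]
      ring
  · refine (norm_column_castSucc_le _ 0).trans ?_
    rw [Matrix.l2_opNorm_conjTranspose]; exact hC
  · refine (norm_add_le _ _).trans ?_
    rw [norm_smul, norm_smul]
    have k1 : ‖β‖ * ‖f‖ ≤ 2 * (3 * e) := by gcongr
    have k2 : ‖β - 1‖ * ‖yVec n‖ ≤ 4 * e * 1 := by gcongr
    linarith

theorem norm_xVec_le (hn : 1 ≤ n) (a : Fin n → ℂ) : ‖xVec a‖ ≤ 1 := by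
  have h := norm_column_castSucc_le (exactChat a)ᴴ 0
  rw [Matrix.l2_opNorm_conjTranspose] at h
  refine le_trans (le_of_eq ?_) (h.trans (norm_le_one_of_unitary (exactChat_unitary a)))
  congr 1
  ext i
  simp only [xVec, Matrix.conjTranspose_apply, exactChat_zero a hn]
  simp

theorem companion_eq_mul (a : Fin n → ℂ) : companion a = qFactor n * rFactor a := by
  ext i j
  have hi := i.2
  have hj := j.2
  rw [Matrix.mul_apply]
  obtain h0 | h0 := Nat.eq_zero_or_pos (i : ℕ)
  · rw [Finset.sum_eq_single ⟨n - 1, by omega⟩]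
    · have h1 : n - 1 + 1 = n := by omega
      simp only [companion, qFactor, rFactor, Matrix.of_apply, h1, h0, true_and, if_true]
      by_cases h3 : (j : ℕ) + 1 = n
      · have h4 : i = ⟨0, by omega⟩ := Fin.ext h0
        simp [h3, zVec, h1, h4]
      · have h4 : ¬ (⟨n - 1, by omega⟩ : Fin n) = j := fun h => by
          have := congrArg Fin.val h; simp at this; omega
        simp [h3, h4]
    · intro k _ hk
      have h1 : ¬ (i : ℕ) = k + 1 := by omega
      have h2 : ¬ (k : ℕ) + 1 = n := fun h => hk (Fin.ext (by simp; omega))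
      simp [qFactor, h1, h2]
    · simp
  · rw [Finset.sum_eq_single ⟨i - 1, by omega⟩]
    · have h1 : (i : ℕ) - 1 + 1 = i := by omega
      simp only [companion, qFactor, rFactor, Matrix.of_apply, h1, if_true, one_mul]
      by_cases h3 : (j : ℕ) + 1 = n
      · simp [h3, zVec, h1]
      · have h4 : ((⟨(i : ℕ) - 1, by omega⟩ : Fin n) = j) ↔ (i : ℕ) = j + 1 := by
          rw [Fin.ext_iff]; simp; omega
        simp [h3, h4]
    · intro k _ hk
      have h1 : ¬ (i : ℕ) = k + 1 := fun h => hk (Fin.ext (by simp; omega))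
      have h2 : ¬ (i : ℕ) = 0 := by omega
      simp [qFactor, h1, h2]
    · simp

theorem norm_rFactor (hn : 1 ≤ n) (a : Fin n → ℂ) : ‖rFactor a‖ = ‖companion a‖ := by
  rw [companion_eq_mul, norm_unitary_mul (qFactor_unitary hn)]

/-- The first and the last column of the companion matrix bound its norm from below. -/
theorem norm_companion_ge (hn : 2 ≤ n) (a : Fin n → ℂ) :
    1 ≤ ‖companion a‖ ∧ alpha a ≤ 2 * ‖companion a‖ := by
  have h1 : 1 ≤ ‖companion a‖ := by
    refine le_trans ?_ (norm_column_le (companion a) ⟨0, by omega⟩)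
    refine le_trans ?_ (PiLp.norm_apply_le _ (⟨1, by omega⟩ : Fin n))
    have : ¬ 0 + 1 = n := by omega
    simp [companion]
    rw [if_neg (by omega)]
    simp
  refine ⟨h1, ?_⟩
  have h2 := norm_column_le (companion a) ⟨n - 1, by omega⟩
  have h3 : ‖WithLp.toLp 2 (fun i => companion a i ⟨n - 1, by omega⟩)‖ ^ 2 = ∑ i, ‖a i‖ ^ 2 := by
    rw [EuclideanSpace.norm_sq_eq]
    refine Finset.sum_congr rfl fun i _ => ?_
    have : n - 1 + 1 = n := by omega
    simp [companion, this]
  have h4 := pow_le_pow_left₀ (norm_nonneg _) h2 2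
  rw [h3] at h4
  refine le_of_sq_le_sq ?_ (by linarith)
  rw [alpha_sq]
  nlinarith

/-- A backward error does not depend on whether it is measured before or after the unitary
transformations. -/
theorem norm_conj_unitary_sub {m : ℕ} {V W A M : Matrix (Fin m) (Fin m) ℂ}
    (hV : V ∈ Matrix.unitaryGroup (Fin m) ℂ) (hW : W ∈ Matrix.unitaryGroup (Fin m) ℂ) :
    ‖V * A * Wᴴ - M‖ = ‖A - Vᴴ * M * W‖ := by
  have e : V * A * Wᴴ - M = V * (A - Vᴴ * M * W) * Wᴴ := by
    have : V * (A - Vᴴ * M * W) * Wᴴ = V * A * Wᴴ - (V * Vᴴ) * M * (W * Wᴴ) := by noncomm_ring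
    rw [this, mul_conjTranspose_self_of_unitary hV, mul_conjTranspose_self_of_unitary hW,
      Matrix.one_mul, Matrix.mul_one]
  rw [e, norm_mul_unitary (conjTranspose_mem_unitaryGroup hW), norm_unitary_mul hV]

theorem eq_conj_of_conj_eq {m : ℕ} {V W A M : Matrix (Fin m) (Fin m) ℂ}
    (hV : V ∈ Matrix.unitaryGroup (Fin m) ℂ) (hW : W ∈ Matrix.unitaryGroup (Fin m) ℂ)
    (h : V * A * Wᴴ = M) : A = Vᴴ * M * W := by
  have : Vᴴ * (V * A * Wᴴ) * W = (Vᴴ * V) * A * (Wᴴ * W) := by noncomm_ring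
  rw [← h, this, conjTranspose_mul_self_of_unitary hV, conjTranspose_mul_self_of_unitary hW,
    Matrix.one_mul, Matrix.mul_one]

end Final

end CompanionQR

theorem theorem5p4 :
    ∃ K : ℝ, 0 < K ∧
      ∀ (n : ℕ), 2 ≤ n → ∀ (N : ℕ) (u : ℝ) (F : FloatArith u) (ε : ℝ),
        ε = K * ((n : ℝ) * ((n : ℝ) + (N : ℝ))) * u → ε ≤ 1 →
        ∀ (a : Fin n → ℂ) (S : State n), Run F a N S →
          S.U ∈ Matrix.unitaryGroup (Fin n) ℂ ∧ S.X ∈ Matrix.unitaryGroup (Fin n) ℂ ∧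
          ∃ (δA δQ δR δRu E : Matrix (Fin n) (Fin n) ℂ) (δx δy : EuclideanSpace ℂ (Fin n)),
            (S.Ahat = S.Uᴴ * (companion a + δA) * S.U ∧ ‖δA‖ ≤ ε * ‖companion a‖) ∧
            (S.Qhat = S.Uᴴ * (qFactor n + δQ) * S.X ∧ ‖δQ‖ ≤ ε) ∧
            (S.Rhat = S.Xᴴ * (rFactor a + δR) * S.U ∧ ‖δR‖ ≤ ε * ‖companion a‖) ∧
            (δR = δRu + (alpha a : ℂ) •
                (Matrix.vecMulVec δx.ofLp (yVec n).ofLp + Matrix.vecMulVec (xVec a).ofLp δy.ofLp)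
                + E ∧
              ‖δRu‖ ≤ ε ∧ ‖δx‖ ≤ ε ∧ ‖δy‖ ≤ ε ∧ ‖E‖ ≤ ε ^ 2 * ‖companion a‖) := by
  -- one pass, and each of `n * n` units of the initial error, costs `2 * 10 ^ 7 * u`; the remaining
  -- factor of `K` covers the constants by which the errors are combined below
  refine ⟨10 ^ 12, by norm_num, ?_⟩
  intro n hn N u F ε hε hε1 a S hS
  have h0 := F.u_nonneg
  have hn1 : 1 ≤ n := by omega
  have hn2 : (2 : ℝ) ≤ n := by exact_mod_cast hn
  have hN0 : (0 : ℝ) ≤ N := Nat.cast_nonneg N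
  set T : ℝ := (n : ℝ) * ((n : ℝ) + N) with hT
  have hTn : 2 * (n : ℝ) ≤ T := by nlinarith
  have hTNn : (N : ℝ) * n ≤ T := by nlinarith
  have hTu : T * u ≤ 1 / 10 ^ 12 := by
    rw [le_div_iff₀ (by norm_num)]
    linarith
  have hnu : (n : ℝ) * u ≤ T * u := by gcongr; linarith
  have hu : u ≤ 1 / 10 ^ 6 := by nlinarith
  -- the bound for the errors of `Q`, `B` and `C`, and half the bound for the relative error of `ρ`
  set e : ℝ := T * (2 * 10 ^ 7 * u) with he
  have heε : e = 2 / 10 ^ 5 * ε := by rw [he, hε]; ring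
  have he0 : 0 ≤ e := by positivity
  have hnu' : ((n + 1 : ℕ) : ℝ) * (20 * u) ≤ 1 / 2 := by push_cast; nlinarith
  obtain ⟨tri, -, hQ⟩ := hS.tracks F hu hn1 hnu'
    (initState_tracks F a hu hn1 (by linarith) hnu') (initState_qNear F a)
    (descProd_swapCore_eq_qFactor hn1)
  have hj : ((n * n + N * n : ℕ) : ℝ) = T := by push_cast; rw [hT]; ring
  obtain ⟨V, hV, hV0, hB, hC⟩ := tri.back
  have hU := tri.unitary_U
  have hX := tri.unitary_X
  have hρ := tri.rho
  rw [hj, ← he] at hB hC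
  -- the relative error of `ρ` is compounded, so that it is linear only up to a factor two
  have hpow := one_add_pow_le_linear (x := 2 * 10 ^ 7 * u) (k := n * n + N * n) (by positivity)
    (by rw [hj, ← he]; linarith)
  rw [hj, ← he] at hpow
  have hU' : emb (n + 1) 0 S.U ∈ Matrix.unitaryGroup (Fin (n + 1)) ℂ := emb_unitary (by omega) hU
  have hX' : emb (n + 1) 0 S.X ∈ Matrix.unitaryGroup (Fin (n + 1)) ℂ := emb_unitary (by omega) hX
  rw [← norm_conj_unitary_sub hV hU'] at hB
  rw [← norm_conj_unitary_sub hV hX'] at hC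
  obtain ⟨δRu, δx, δy, hR, nRu, nx, ny⟩ := exists_structured_perturbation hn1 a
    (by linarith) hC hB (hρ.trans (by gcongr; linarith))
  rw [← S.mul_Rhat_mul hV hV0 rfl rfl] at hR
  obtain ⟨hA1, hαA⟩ := norm_companion_ge hn a
  have hα := one_le_alpha a
  have ex := norm_xVec_le hn1 a
  have ey := norm_yVec_le (n := n)
  have nα : ‖(alpha a : ℂ)‖ = alpha a := by
    rw [Complex.norm_real, Real.norm_eq_abs, abs_of_nonneg (by linarith)]
  -- what is left of the rank-one part is of second order, but has the factor `α`
  set E : Matrix (Fin n) (Fin n) ℂ := (alpha a : ℂ) • Matrix.vecMulVec δx.ofLp δy.ofLp with hE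
  set δR : Matrix (Fin n) (Fin n) ℂ := δRu + (alpha a : ℂ) •
    (Matrix.vecMulVec δx.ofLp (yVec n).ofLp + Matrix.vecMulVec (xVec a).ofLp δy.ofLp) + E with hδR
  set δQ : Matrix (Fin n) (Fin n) ℂ := S.U * S.Qhat * S.Xᴴ - qFactor n with hδQ
  have hRhat := eq_conj_of_conj_eq hX hU hR
  have hQhat : S.Qhat = S.Uᴴ * (qFactor n + δQ) * S.X :=
    eq_conj_of_conj_eq hU hX (by rw [hδQ]; abel)
  have nQ : ‖δQ‖ ≤ e := by
    rw [hδQ, norm_conj_unitary_sub hU hX]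
    refine hQ.trans ?_
    calc (N : ℝ) * (n * (2 * 10 ^ 7 * u)) = (N * n) * (2 * 10 ^ 7 * u) := by ring
      _ ≤ e := by rw [he]; gcongr
  have nE : ‖E‖ ≤ 20 * e ^ 2 * ‖companion a‖ := by
    rw [hE, norm_smul, nα]
    calc alpha a * ‖Matrix.vecMulVec δx.ofLp δy.ofLp‖ ≤ (2 * ‖companion a‖) * (e * (10 * e)) := by
          gcongr
          exact (norm_vecMulVec_le δx δy).trans (by gcongr)
      _ = _ := by ring
  have nR : ‖δR‖ ≤ 40 * e * ‖companion a‖ := by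
    have k1 : ‖(alpha a : ℂ) • (Matrix.vecMulVec δx.ofLp (yVec n).ofLp
        + Matrix.vecMulVec (xVec a).ofLp δy.ofLp)‖ ≤ (2 * ‖companion a‖) * (e * 1 + 1 * (10 * e)) := by
      rw [norm_smul, nα]
      gcongr
      refine (norm_add_le _ _).trans (add_le_add ?_ ?_)
      · exact (norm_vecMulVec_le _ _).trans (by gcongr)
      · exact (norm_vecMulVec_le _ _).trans (by gcongr)
    have k2 : ‖δR‖ ≤ 3 * e + (2 * ‖companion a‖) * (e * 1 + 1 * (10 * e))
        + 20 * e ^ 2 * ‖companion a‖ := by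
      rw [hδR]
      exact (norm_add_le _ _).trans (add_le_add ((norm_add_le _ _).trans (add_le_add nRu k1)) nE)
    -- `1 ≤ ‖A‖` turns the absolute bound for `δRu` into one relative to `‖A‖`
    have k3 : 3 * e ≤ 3 * e * ‖companion a‖ := le_mul_of_one_le_right (by linarith) hA1
    have k4 : e ^ 2 * ‖companion a‖ ≤ 1 / 20 * e * ‖companion a‖ := by
      gcongr
      rw [sq]
      exact mul_le_mul_of_nonneg_right (by linarith) he0
    linarith
  have hε0 : 0 ≤ ε := by linarith
  have hεA : 0 ≤ ε * ‖companion a‖ := by positivity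
  refine ⟨hU, hX, δQ * rFactor a + qFactor n * δR + δQ * δR, δQ, δR, δRu, E, δx, δy,
    ⟨?_, ?_⟩, ⟨hQhat, by linarith⟩, ⟨hRhat, ?_⟩, hδR, by linarith, by linarith, by linarith, ?_⟩
  · rw [State.Ahat, hQhat, hRhat, companion_eq_mul]
    have e1 : S.Uᴴ * (qFactor n + δQ) * S.X * (S.Xᴴ * (rFactor a + δR) * S.U)
        = S.Uᴴ * ((qFactor n + δQ) * (S.X * S.Xᴴ) * (rFactor a + δR)) * S.U := by noncomm_ring
    rw [e1, mul_conjTranspose_self_of_unitary hX]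
    noncomm_ring
  · have k1 : ‖δQ * rFactor a‖ ≤ e * ‖companion a‖ := by
      refine (Matrix.l2_opNorm_mul _ _).trans ?_
      rw [norm_rFactor hn1]
      gcongr
    have k2 : ‖δQ * δR‖ ≤ 1 * (40 * e * ‖companion a‖) :=
      (Matrix.l2_opNorm_mul _ _).trans (by gcongr; linarith)
    have k3 : ‖qFactor n * δR‖ ≤ 40 * e * ‖companion a‖ := by
      rw [norm_unitary_mul (qFactor_unitary hn1)]; exact nR
    refine (norm_add_le _ _).trans
      ((add_le_add ((norm_add_le _ _).trans (add_le_add k1 k3)) k2).trans ?_)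
    rw [heε]
    linarith
  · refine nR.trans ?_
    rw [heε]
    linarith
  · refine nE.trans ?_
    rw [heε]
    gcongr
    have := sq_nonneg ε
    linarith
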